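/- **Notation.** Functions take values in $\mathbb R\cup\{+\infty\}$, and $\operatorname{dom} g=\{x: g(x)<+\infty\}$. For $x\in\operatorname{dom} g$, the Fréchet subdifferential $\widehat\partial g(x)$ is the set of $v$ with $g(z)\ge g(x)+\langle v,z-x\rangle-o(\|z-x\|)$ as $z\to x$. The limiting subdifferential $\partial g(x)$ is the set of limits of $v_k\in\widehat\partial g(y_k)$ with $y_k\to x$, $g(y_k)\to g(x)$. The horizon subdifferential $\partial^\infty g(x)$ is the set of limits of $t_kv_k$ with such $v_k,y_k$ and $t_k>0$, $t_k\to0$. All three are empty off $\operatorname{dom} g$, and $\|\partial g(x)\|_-:=\inf_{v\in\partial g(x)}\|v\|$ ($=+\infty$ if $\partial g(x)=\emptyset$). $N_C(x)$ is the limiting normal cone of $C$ at $x\in C$. A function is *regular* at a point where it is finite if its epigraph is Clarke regular (locally closed, with all normals Fréchet normals) at the corresponding point. $\mathbb R^N\times\mathbb R^N$ carries the Euclidean structure. **Setting.** Let $f:\mathbb R^N\to\mathbb R\cup\{+\infty\}$ be proper, lower semicontinuous (lsc) and coercive ($f(x)\to\infty$ as $\|x\|\to\infty$). Let $h$ be a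 Legendre function on $\mathbb R^N$ (proper, lsc, convex, essentially smooth, essentially strictly convex) that is $C^2$ on $\operatorname{int}\operatorname{dom} h$, with Bregman distance $D_h(x,y)=h(x)-h(y)-\langle\nabla h(y),x-y\rangle$ for $y\in\operatorname{int}\operatorname{dom} h$, and $D_h(x,y)=+\infty$ for other $y$. Assume $\operatorname{dom} f\subset\overline{\operatorname{dom} h}$, $\operatorname{dom} f\cap\operatorname{int}\operatorname{dom} h\ne\emptyset$, and $0\in\partial f(x)$ for some $x\in\operatorname{int}\operatorname{dom} h$. Let $f(\cdot;\cdot):\mathbb R^N\times\mathbb R^N\to\mathbb R\cup\{+\infty\}$, let $\bar L>0$, $\underline L\in\mathbb R$, and assume: 1. $f(\cdot;\cdot)$ is proper and lsc, $f(x;y)=+\infty$ whenever $x\notin\operatorname{dom} f$, $f(x;y)<+\infty$ on $\operatorname{dom} f\times\operatorname{dom} f$, and $f(\cdot;\cdot)$ is continuous on $\operatorname{dom} f\times\operatorname{dom} f$. 2. For every $y\in\operatorname{dom} f\cap\operatorname{int}\operatorname{dom} h$, $f(\cdot;y)$ is a model function for $f$ around $y$: there is a differentiable $\omega_y:[0,\infty)\to[0,\infty)$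 with $\omega_y(0)=\omega_y'(0^+)=0$ and $|f(x)-f(x;y)|\le\omega_y(\|x-y\|)$ for all $x\in\operatorname{dom} f$; and $$-\underline L\,D_h(x,y)\le f(x)-f(x;y)\le\bar L\,D_h(x,y)\qquad\text{for all }x\in\operatorname{dom} f\cap\operatorname{dom} h .$$ 3. $\partial^\infty_x f(x;y)\cap(-N_{\operatorname{dom} h}(x))=\{0\}$ for all $y\in\operatorname{dom} f\cap\operatorname{int}\operatorname{dom} h$, $x\in\operatorname{dom} f\cap\operatorname{dom} h$. 4. Either (a) for all $x,y\in\operatorname{dom} f$: $(0,v)\in\partial^\infty f(x;y)$ implies $v=0$, $(v,0)\in\partial^\infty f(x;y)$ implies $v=0$, and $f(\cdot;\cdot)$ is regular at $(x,y)$; or (b) for all $x,y\in\operatorname{dom} f$: $\partial f(x;y)=\partial_xf(x;y)\times\partial_yf(x;y)$ and $\partial^\infty f(x;y)=\partial^\infty_xf(x;y)\times\partial^\infty_yf(x;y)$. 5. For every bounded $B\subset\operatorname{dom} f$ there is $c_B>0$ with $\inf_{v\in\partial_yf(x;y)}\|v\|\le c_B\|x-y\|$ for all $x,y\in B$. 6.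 For every compact convex $B\subset\operatorname{int}\operatorname{dom} h$ there is $\sigma_B>0$ with $D_h(x,y)\ge\frac{\sigma_B}2\|x-y\|^2$ for all $x,y\in B$. **Algorithm (Model BPG).** Let $0<\underline\tau<\bar\tau<1/\bar L$, $x_0=x_1\in\operatorname{dom} f\cap\operatorname{int}\operatorname{dom} h$, and for each $k\ge1$ let $\tau_k\in[\underline\tau,\bar\tau]$ and $$x_{k+1}\in\operatorname*{Argmin}_{x\in\mathbb R^N}\Big\{f(x;x_k)+\tfrac1{\tau_k}D_h(x,x_k)\Big\}.$$ **Theorem (convergence rates).** Suppose that $(x_k)$ converges to some $\bar x\in\operatorname{dom} f\cap\operatorname{int}\operatorname{dom} h$ and that the Lyapunov function $F(x,y)=f(x;y)+\bar L\,D_h(x,y)$ has the Kurdyka–Łojasiewicz property at $(\bar x,\bar x)$ with desingularizing function $\varphi(s)=c\,s^{1-\theta}$ for some $c>0$, $\theta\in[0,1)$; that is, there are $\eta\in(0,\infty]$ and a neighbourhood $U$ of $(\bar x,\bar x)$ with $\varphi'\big(F(z)-F(\bar x,\bar x)\big)\,\|\partial F(z)\|_-\ge1$ for all $z\in U$ such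 that $F(\bar x,\bar x)<F(z)<F(\bar x,\bar x)+\eta$. Then: - If $\theta=0$, then $(x_k)$ converges in finitely many steps: there is $K$ with $x_k=\bar x$ for all $k\ge K$. - If $\theta\in(0,\frac12]$, then there are $\rho\in[0,1)$ and $G>0$ with $\|x_k-\bar x\|\le G\rho^k$ for all $k\ge0$. - If $\theta\in(\frac12,1)$, then there is $G>0$ with $\|x_k-\bar x\|\le G\,k^{-\frac{1-\theta}{2\theta-1}}$ for all $k\ge1$. -/

import Mathlib

open Filter Topology Set

noncomputable section

namespace ModelBPG

section Subdifferentials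

variable {V : Type*} [NormedAddCommGroup V] [InnerProductSpace ℝ V]

/-- Effective domain of an extended-valued function. -/
def edom {X : Type*} (f : X → EReal) : Set X := {x | f x < ⊤}

/-- `f` takes values in `ℝ ∪ {+∞}` and is not identically `+∞`. -/
def IsProper {X : Type*} (f : X → EReal) : Prop :=
  (∀ x, f x ≠ ⊥) ∧ (edom f).Nonempty

/-- Fréchet subdifferential:
`f z ≥ f x + ⟨v, z - x⟩ - o(‖z - x‖)` as `z → x`, for `x ∈ dom f`; empty off `dom f`. -/
def frechetSubdiff (f : V → EReal) (x : V) : Set V :=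
  {v | x ∈ edom f ∧ ∀ ε : ℝ, 0 < ε → ∀ᶠ z in 𝓝 x,
    f x + ((inner ℝ v (z - x) - ε * ‖z - x‖ : ℝ) : EReal) ≤ f z}

/-- Limiting subdifferential; empty off `dom f`. -/
def limSubdiff (f : V → EReal) (x : V) : Set V :=
  {v | x ∈ edom f ∧ ∃ y w : ℕ → V,
    Tendsto y atTop (𝓝 x) ∧ Tendsto (fun k => f (y k)) atTop (𝓝 (f x)) ∧
    (∀ k, w k ∈ frechetSubdiff f (y k)) ∧ Tendsto w atTop (𝓝 v)}

/-- Horizon subdifferential; empty off `dom f`. -/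
def horizonSubdiff (f : V → EReal) (x : V) : Set V :=
  {v | x ∈ edom f ∧ ∃ (y w : ℕ → V) (t : ℕ → ℝ),
    Tendsto y atTop (𝓝 x) ∧ Tendsto (fun k => f (y k)) atTop (𝓝 (f x)) ∧
    (∀ k, w k ∈ frechetSubdiff f (y k)) ∧
    (∀ k, 0 < t k) ∧ Tendsto t atTop (𝓝 0) ∧ Tendsto (fun k => t k • w k) atTop (𝓝 v)}

/-- `inf { ‖v‖ : v ∈ ∂f(x) }`, which is `+∞` if `∂f(x)` is empty. -/
def subdiffNorm (f : V → EReal) (x : V) : ENNReal := ⨅ v ∈ limSubdiff f x, ‖v‖ₑ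

/-- Critical points of `f`. -/
def crit (f : V → EReal) : Set V := {x | (0 : V) ∈ limSubdiff f x}

/-- Regular (Fréchet) normals to `C` at `x`. -/
def frechetNormalCone (C : Set V) (x : V) : Set V :=
  {v | x ∈ C ∧ ∀ ε : ℝ, 0 < ε → ∀ᶠ z in 𝓝[C] x, inner ℝ v (z - x) ≤ ε * ‖z - x‖}

/-- (Limiting) normal cone to `C` at `x`. -/
def normalCone (C : Set V) (x : V) : Set V :=
  {v | x ∈ C ∧ ∃ y w : ℕ → V,
    Tendsto y atTop (𝓝 x) ∧ (∀ k, w k ∈ frechetNormalCone C (y k)) ∧ Tendsto w atTop (𝓝 v)}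

/-- Clarke regularity of a set at one of its points: the set is locally closed there and every
normal is a regular normal. -/
def ClarkeRegularAt (C : Set V) (x : V) : Prop :=
  x ∈ C ∧ (∃ r : ℝ, 0 < r ∧ IsClosed (C ∩ Metric.closedBall x r)) ∧
    normalCone C x = frechetNormalCone C x

/-- Epigraph of `f`, as a subset of the Euclidean product `V × ℝ`. -/
def epigraph (f : V → EReal) : Set (WithLp 2 (V × ℝ)) := {p | f p.fst ≤ (p.snd : EReal)}

/-- Subdifferential regularity of `f` at `x`: `f x` is finite and the epigraph of `f` is Clarke
regular at `(x, f x)`. -/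
def IsRegularAt (f : V → EReal) (x : V) : Prop :=
  f x ≠ ⊤ ∧ f x ≠ ⊥ ∧ ClarkeRegularAt (epigraph f) (WithLp.toLp 2 (x, (f x).toReal))

/-- `φ` is a desingularizing function on `[0, η)`, where `η ∈ (0, +∞]`. -/
structure IsDesingularizing (φ : ℝ → ℝ) (η : EReal) : Prop where
  nonneg : ∀ s : ℝ, 0 ≤ s → (s : EReal) < η → 0 ≤ φ s
  continuousOn : ContinuousOn φ {s : ℝ | 0 ≤ s ∧ (s : EReal) < η}
  concaveOn : ConcaveOn ℝ {s : ℝ | 0 ≤ s ∧ (s : EReal) < η} φ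
  map_zero : φ 0 = 0
  contDiffOn : ContDiffOn ℝ 1 φ {s : ℝ | 0 < s ∧ (s : EReal) < η}
  deriv_pos : ∀ s : ℝ, 0 < s → (s : EReal) < η → 0 < deriv φ s

/-- `F` has the Kurdyka–Łojasiewicz property at `x` with desingularizing function `φ`. -/
def HasKLPropertyAt (F : V → EReal) (x : V) (φ : ℝ → ℝ) : Prop :=
  ∃ η : EReal, 0 < η ∧ IsDesingularizing φ η ∧ ∃ U ∈ 𝓝 x, ∀ y ∈ U, F x < F y → F y < F x + η →
    1 ≤ ENNReal.ofReal (deriv φ ((F y).toReal - (F x).toReal)) * subdiffNorm F y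

end Subdifferentials

/-- The Euclidean space `ℝ^N`. -/
abbrev Euc (N : ℕ) : Type := EuclideanSpace ℝ (Fin N)

/-- The product `ℝ^N × ℝ^N` with its Euclidean structure. -/
abbrev Euc2 (N : ℕ) : Type := WithLp 2 (Euc N × Euc N)

variable {N : ℕ}

/-- A function of two variables as a function on the Euclidean product. -/
def joint (m : Euc N → Euc N → EReal) (z : Euc2 N) : EReal := m z.fst z.snd

/-- Domain of the convex subdifferential. -/
def domConvexSubdiff (h : Euc N → EReal) : Set (Euc N) :=
  {x | x ∈ edom h ∧ ∃ v : Euc N, ∀ z, h x + ((inner ℝ v (z - x) : ℝ) : EReal) ≤ h z}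

/-- The gradient of `h`; meaningful on the interior of `dom h`. -/
def grad (h : Euc N → EReal) (y : Euc N) : Euc N := gradient (fun z => (h z).toReal) y

/-- Legendre functions: proper, lower semicontinuous and convex, essentially smooth and
essentially strictly convex. -/
structure IsLegendre (h : Euc N → EReal) : Prop where
  proper : IsProper h
  lsc : LowerSemicontinuous h
  convexOn : ConvexOn ℝ (edom h) (fun x => (h x).toReal)
  interior_nonempty : (interior (edom h)).Nonempty
  differentiableOn : DifferentiableOn ℝ (fun x => (h x).toReal) (interior (edom h))
  steep : ∀ x ∈ frontier (edom h),
    Tendsto (fun y => ‖grad h y‖) (𝓝[interior (edom h)] x) atTop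
  strictConvexOn : ∀ C ⊆ domConvexSubdiff h, Convex ℝ C →
    StrictConvexOn ℝ C (fun x => (h x).toReal)

open Classical in
/-- Bregman distance `h x - h y - ⟨∇h(y), x - y⟩` for `y ∈ int dom h` (it is `+∞` for
`x ∉ dom h`), and `+∞` for `y ∉ int dom h`. -/
def bregman (h : Euc N → EReal) (x y : Euc N) : EReal :=
  if y ∈ interior (edom h) then
    h x - (((h y).toReal + inner ℝ (grad h y) (x - y) : ℝ) : EReal)
  else ⊤

/-- Growth functions `ω : [0, ∞) → [0, ∞)`. -/
structure IsGrowthFunction (ω : ℝ → ℝ) : Prop where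
  nonneg : ∀ t, 0 ≤ t → 0 ≤ ω t
  differentiableOn : DifferentiableOn ℝ ω (Ici 0)
  map_zero : ω 0 = 0
  deriv_zero : HasDerivWithinAt ω 0 (Ici 0) 0

/-- `g` is a model function for `f` around the model centre `y`. -/
def IsModelFunction (f g : Euc N → EReal) (y : Euc N) : Prop :=
  edom g = edom f ∧ ∃ ω : ℝ → ℝ, IsGrowthFunction ω ∧
    ∀ x ∈ edom f, |(f x).toReal - (g x).toReal| ≤ ω ‖x - y‖

/-- Model approximation property at `y` of `f` and the model `g` around `y`. All values compared
are finite. -/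
def HasMAP (f g h : Euc N → EReal) (Lu Ll : ℝ) (y : Euc N) : Prop :=
  ∀ x ∈ edom f ∩ edom h,
    -Ll * (bregman h x y).toReal ≤ (f x).toReal - (g x).toReal ∧
    (f x).toReal - (g x).toReal ≤ Lu * (bregman h x y).toReal

/-- Assumptions on the objective. -/
structure ObjectiveAssumption (f : Euc N → EReal) : Prop where
  proper : IsProper f
  lsc : LowerSemicontinuous f
  coercive : Tendsto f (Bornology.cobounded (Euc N)) (𝓝 ⊤)

/-- Horizon condition and regularity of `(x, y) ↦ m x y` on `dom f × dom f`. -/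
def HorizonAndRegular (f : Euc N → EReal) (m : Euc N → Euc N → EReal) : Prop :=
  ∀ x ∈ edom f, ∀ y ∈ edom f,
    (∀ v : Euc N, WithLp.toLp 2 (0, v) ∈ horizonSubdiff (joint m) (WithLp.toLp 2 (x, y)) → v = 0) ∧
    (∀ v : Euc N, WithLp.toLp 2 (v, 0) ∈ horizonSubdiff (joint m) (WithLp.toLp 2 (x, y)) → v = 0) ∧
    IsRegularAt (joint m) (WithLp.toLp 2 (x, y))

/-- On `dom f × dom f` the joint (horizon) subdifferential of `m` is the product of the partial
(horizon) subdifferentials. -/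
def SeparableSubdiff (f : Euc N → EReal) (m : Euc N → Euc N → EReal) : Prop :=
  ∀ x ∈ edom f, ∀ y ∈ edom f,
    limSubdiff (joint m) (WithLp.toLp 2 (x, y)) =
      {w | w.fst ∈ limSubdiff (fun x' => m x' y) x ∧ w.snd ∈ limSubdiff (m x) y} ∧
    horizonSubdiff (joint m) (WithLp.toLp 2 (x, y)) =
      {w | w.fst ∈ horizonSubdiff (fun x' => m x' y) x ∧ w.snd ∈ horizonSubdiff (m x) y}

/-- Assumptions on the Legendre function `h` and on the model `m`, where `m x y` is the value at
`x` of the model around `y`. -/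
structure ModelAssumption (f h : Euc N → EReal) (m : Euc N → Euc N → EReal) (Lu Ll : ℝ) :
    Prop where
  legendre : IsLegendre h
  contDiffOn : ContDiffOn ℝ 2 (fun x => (h x).toReal) (interior (edom h))
  dom_inter : (edom f ∩ interior (edom h)).Nonempty
  crit_inter : (crit f ∩ interior (edom h)).Nonempty
  dom_subset : edom f ⊆ closure (edom h)
  Lu_pos : 0 < Lu
  model : ∀ y ∈ edom f ∩ interior (edom h), IsModelFunction f (fun x => m x y) y
  map : ∀ y ∈ edom f ∩ interior (edom h), HasMAP f (fun x => m x y) h Lu Ll y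
  qualification : ∀ y ∈ edom f ∩ interior (edom h), ∀ x ∈ edom f ∩ edom h,
    horizonSubdiff (fun x' => m x' y) x ∩ {v | -v ∈ normalCone (edom h) x} = {0}
  joint_subdiff : HorizonAndRegular f m ∨ SeparableSubdiff f m
  joint_proper : IsProper (joint m)
  joint_dom : ∀ y ∈ edom f, edom (fun x => m x y) = edom f
  joint_dom_subset : ∀ x y, m x y < ⊤ → x ∈ edom f
  joint_lsc : LowerSemicontinuous (joint m)
  joint_cont : ContinuousOn (joint m) {z | z.fst ∈ edom f ∧ z.snd ∈ edom f}

/-- Variation of the model with respect to the model centre: on every bounded subset of `dom f`,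
the partial subdifferential in the centre has an element of norm `O(‖x - y‖)`. -/
def RelativeErrorAssumption (f : Euc N → EReal) (m : Euc N → Euc N → EReal) : Prop :=
  ∀ B ⊆ edom f, Bornology.IsBounded B → ∃ c : ℝ, 0 < c ∧ ∀ x ∈ B, ∀ y ∈ B,
    subdiffNorm (m x) y ≤ ENNReal.ofReal (c * ‖x - y‖)

/-- `h` is strongly convex on every compact convex subset of the interior of its domain. -/
def LocalStrongConvexity (h : Euc N → EReal) : Prop :=
  ∀ B ⊆ interior (edom h), IsCompact B → Convex ℝ B → ∃ σ : ℝ, 0 < σ ∧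
    ∀ x ∈ B, ∀ y ∈ B, ((σ / 2 * ‖x - y‖ ^ 2 : ℝ) : EReal) ≤ bregman h x y

/-- `x` is a sequence generated by Model BPG with step sizes `τ k ∈ [τlo, τhi]`. -/
structure IsModelBPG (f h : Euc N → EReal) (m : Euc N → Euc N → EReal) (Lu : ℝ)
    (τlo τhi : ℝ) (τ : ℕ → ℝ) (x : ℕ → Euc N) : Prop where
  τlo_pos : 0 < τlo
  τlo_lt : τlo < τhi
  τhi_lt : τhi < 1 / Lu
  init_eq : x 0 = x 1
  init_mem : x 0 ∈ edom f ∩ interior (edom h)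
  step_mem : ∀ k, 1 ≤ k → τ k ∈ Icc τlo τhi
  update : ∀ k, 1 ≤ k →
    IsMinOn (fun z => m z (x k) + ((1 / τ k : ℝ) : EReal) * bregman h z (x k)) univ (x (k + 1))

/-- The Lyapunov function `(x, y) ↦ m x y + L D_h(x, y)`. -/
def lyapunov (h : Euc N → EReal) (m : Euc N → Euc N → EReal) (Lu : ℝ) (z : Euc2 N) : EReal :=
  m z.fst z.snd + (Lu : EReal) * bregman h z.fst z.snd

end ModelBPG

end

noncomputable section

namespace ModelBPG

/-! ### Sum rules for Fréchet and limiting subgradients; epigraph normals and regularity -/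

section Calculus

variable {V : Type*} [NormedAddCommGroup V] [InnerProductSpace ℝ V]

/-! The rates follow from two inequalities for the gap `e n` between the Lyapunov value at two
consecutive iterates and its limit. Sufficient decrease: comparing the minimizer of the subproblem
with its centre, and bounding `f` by the previous model, the gap drops by a multiple of the squared
length of the next step (`lyapunovReal_step_le`, with local strong convexity of `h`). Relative
error: the Lyapunov function has a subgradient at the pair whose norm is at most a multiple of the
last step (`exists_subdiffNorm_lyapunov_le`). Inserting the latter in the Kurdyka–Łojasiewicz
inequality bounds `e n ^ θ` by a multiple of the last step (`exists_tail_energy`). Together they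
give `e (n + 1) ^ (2 * θ) ≤ M * (e n - e (n + 1))`, which forces finite termination, geometric decay
or power decay according to `θ`; the step lengths then control the distance to the limit.

Two points take most of the work. First, iterates must stay in `int dom h`: the qualification
condition gives a fuzzy sum rule a convergent multiplier, hence a convex subgradient of `h` at the
new iterate, and essential smoothness excludes subgradients on the boundary (`mem_of_isMinOn_step`).

Second, optimality of a step only yields a partial subgradient in the first variable, while the
relative error needs a joint one with a small second component (`exists_joint_limSubdiff`). Under
the product formula this is immediate. Under the horizon and regularity condition, a penalization
argument lifts the partial subgradient to a joint one, but with an uncontrolled second component. By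
regularity that component is a Fréchet subgradient in the centre. The horizon condition also makes
`dom f` open, so small subgradients exist at all nearby centres, and a mean value argument
(`norm_le_of_forall_exists_frechetSubdiff`) shows that then every Fréchet subgradient is small. -/

lemma exists_real_of_mem_edom {X : Type*} {f : X → EReal} (hbot : ∀ z, f z ≠ ⊥) {x : X}
    (hx : x ∈ edom f) : ∃ r : ℝ, f x = r :=
  ⟨(f x).toReal, (EReal.coe_toReal (ne_of_lt hx) (hbot x)).symm⟩

lemma mem_edom_of_eq_coe {X : Type*} {f : X → EReal} {x : X} {r : ℝ} (h : f x = r) :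
    x ∈ edom f := by
  simp [edom, h]

/-- Fréchet subgradients in terms of the finite values of the function. -/
lemma mem_frechetSubdiff_iff {f : V → EReal} (hbot : ∀ z, f z ≠ ⊥) {x : V} {r : ℝ}
    (hr : f x = r) {v : V} :
    v ∈ frechetSubdiff f x ↔ ∀ ε : ℝ, 0 < ε → ∀ᶠ z in 𝓝 x, ∀ s : ℝ, f z = s →
      r + (inner ℝ v (z - x) - ε * ‖z - x‖) ≤ s := by
  simp only [frechetSubdiff, mem_ofPred_eq, mem_edom_of_eq_coe hr, true_and, hr]
  refine forall₂_congr fun ε _ => eventually_congr (Eventually.of_forall fun z => ?_)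
  constructor
  · intro h s hs
    rw [hs] at h
    exact_mod_cast h
  · intro h
    by_cases hz : f z = ⊤
    · simp [hz]
    · have hs := (EReal.coe_toReal hz (hbot z)).symm
      rw [hs]
      exact_mod_cast h _ hs

lemma add_coe_eq_coe {a : EReal} {b s : ℝ} : a + b = s ↔ a = ((s - b : ℝ) : EReal) := by
  induction a with
  | bot => simpa using (EReal.coe_ne_bot (s - b)).symm
  | top => simpa using (EReal.coe_ne_top (s - b)).symm
  | coe a =>
    norm_cast
    constructor <;> intro h <;> linarith

lemma add_coe_ne_bot {a : EReal} (ha : a ≠ ⊥) (b : ℝ) : a + b ≠ ⊥ := by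
  induction a with
  | bot => simp at ha
  | top => simp
  | coe a => exact EReal.coe_ne_bot (a + b)

/-- Sum rule for Fréchet subgradients with a function that is differentiable at the point. -/
lemma add_mem_frechetSubdiff [CompleteSpace V] {f F : V → EReal} (hf : ∀ z, f z ≠ ⊥)
    (hF : ∀ z, F z ≠ ⊥) {φ : V → ℝ} {x v G : V} (hv : v ∈ frechetSubdiff f x)
    (hφ : HasGradientAt φ G x) (hFf : ∀ᶠ z in 𝓝 x, F z = f z + (φ z : ℝ)) :
    v + G ∈ frechetSubdiff F x := by
  obtain ⟨r, hr⟩ := exists_real_of_mem_edom hf hv.1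
  have hFx : F x = ((r + φ x : ℝ) : EReal) := by rw [hFf.self_of_nhds, hr]; norm_cast
  rw [mem_frechetSubdiff_iff hf hr] at hv
  rw [mem_frechetSubdiff_iff hF hFx]
  intro ε hε
  have h1 := hv (ε / 2) (by positivity)
  have h2 := (hasGradientAt_iff_isLittleO.1 hφ).def (half_pos hε)
  filter_upwards [h1, h2, hFf] with z h1 h2 h3 s hs
  rw [h3, add_coe_eq_coe] at hs
  have h4 := h1 _ hs
  rw [Real.norm_eq_abs] at h2
  have h5 := (abs_le.1 h2).1
  rw [inner_add_left]
  linarith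

lemma zero_mem_frechetSubdiff {f : V → EReal} {x : V} (hx : x ∈ edom f)
    (h : ∀ᶠ z in 𝓝 x, f x ≤ f z) : (0 : V) ∈ frechetSubdiff f x := by
  refine ⟨hx, fun ε hε => ?_⟩
  filter_upwards [h] with z hz
  refine le_trans ?_ hz
  conv_rhs => rw [← add_zero (f x)]
  gcongr
  have : 0 ≤ ε * ‖z - x‖ := by positivity
  rw [inner_zero_left]
  exact_mod_cast (by linarith : (0 : ℝ) - ε * ‖z - x‖ ≤ 0)

/-- The Fermat rule for the sum of a function and a differentiable one. -/
lemma neg_mem_frechetSubdiff_of_localMin [CompleteSpace V] {f : V → EReal} (hf : ∀ z, f z ≠ ⊥)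
    {φ : V → ℝ} {x G : V} (hx : x ∈ edom f) (hφ : HasGradientAt φ G x)
    (h : ∀ᶠ z in 𝓝 x, f x + (φ x : ℝ) ≤ f z + (φ z : ℝ)) : -G ∈ frechetSubdiff f x := by
  have h0 : (0 : V) ∈ frechetSubdiff (fun z => f z + (φ z : ℝ)) x := by
    refine zero_mem_frechetSubdiff ?_ h
    obtain ⟨r, hr⟩ := exists_real_of_mem_edom hf hx
    exact mem_edom_of_eq_coe (r := r + φ x) (by rw [hr]; norm_cast)
  -- Since `0` is a subgradient of `f + φ`, adding the smooth function `-φ` recovers `f` and leaves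
  -- `-G`.
  have hneg : HasGradientAt (fun z => -φ z) (-G) x := by
    rw [hasGradientAt_iff_hasFDerivAt] at hφ ⊢
    rw [map_neg]
    exact hφ.neg
  have := add_mem_frechetSubdiff (F := f) (fun z => add_coe_ne_bot (hf z) _) hf h0 hneg
    (Eventually.of_forall fun z => ?_)
  · simpa using this
  · rw [add_assoc]
    norm_cast
    simp

lemma frechetSubdiff_subset_limSubdiff (f : V → EReal) (x : V) :
    frechetSubdiff f x ⊆ limSubdiff f x := fun v hv =>
  ⟨hv.1, fun _ => x, fun _ => v, tendsto_const_nhds, tendsto_const_nhds, fun _ => hv,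
    tendsto_const_nhds⟩

/-- Sum rule for limiting subgradients with a continuously differentiable function. -/
lemma add_mem_limSubdiff [CompleteSpace V] {f F : V → EReal} (hf : ∀ z, f z ≠ ⊥)
    (hF : ∀ z, F z ≠ ⊥) {φ : V → ℝ} {G : V → V} {x v : V} (hv : v ∈ limSubdiff f x)
    (hφ : ∀ᶠ z in 𝓝 x, HasGradientAt φ (G z) z) (hG : ContinuousAt G x)
    (hFf : ∀ᶠ z in 𝓝 x, F z = f z + (φ z : ℝ)) : v + G x ∈ limSubdiff F x := by
  obtain ⟨hx, y, w, hy, hfy, hw, hwv⟩ := hv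
  obtain ⟨r, hr⟩ := exists_real_of_mem_edom hf hx
  have hFx : F x = ((r + φ x : ℝ) : EReal) := by rw [hFf.self_of_nhds, hr]; norm_cast
  have hev : ∀ᶠ k in atTop, F (y k) = f (y k) + (φ (y k) : ℝ) ∧
      w k + G (y k) ∈ frechetSubdiff F (y k) := by
    filter_upwards [hy.eventually hFf.eventually_nhds, hy.eventually hφ] with k h1 h2
    exact ⟨h1.self_of_nhds, add_mem_frechetSubdiff hf hF (hw k) h2 h1⟩
  -- The pointwise sum rule is only available near `x`, whereas the definition wants subgradients at
  -- every index; hence the first `K` terms are dropped.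
  obtain ⟨K, hK⟩ := eventually_atTop.1 hev
  have hcont : ContinuousAt φ x := by
    have h := hφ.self_of_nhds
    rw [hasGradientAt_iff_hasFDerivAt] at h
    exact h.continuousAt
  have hsum : Tendsto (fun k => f (y k) + (φ (y k) : EReal)) atTop (𝓝 (F x)) := by
    have h1 : Tendsto (fun k => ((φ (y k) : ℝ) : EReal)) atTop (𝓝 (φ x : EReal)) :=
      (continuous_coe_real_ereal.tendsto _).comp (hcont.tendsto.comp hy)
    have h2 := (EReal.continuousAt_add (p := (f x, (φ x : EReal))) (by simp) (by simp)).tendsto.comp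
      (hfy.prodMk_nhds h1)
    rw [hFf.self_of_nhds]
    exact h2
  refine ⟨mem_edom_of_eq_coe hFx, fun k => y (k + K), fun k => w (k + K) + G (y (k + K)),
    (tendsto_add_atTop_iff_nat K).2 hy, ?_, fun k => (hK _ (by lia)).2, ?_⟩
  · refine ((tendsto_add_atTop_iff_nat K).2 hsum).congr fun k => ?_
    exact (hK _ (by lia)).1.symm
  · exact (tendsto_add_atTop_iff_nat K (f := fun k => w k + G (y k))).2
      (hwv.add (hG.tendsto.comp hy))

/-- Fréchet subgradients give Fréchet normals to the epigraph. -/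
lemma toLp_neg_one_mem_frechetNormalCone {f : V → EReal} (hbot : ∀ z, f z ≠ ⊥) {x v : V} {r : ℝ}
    (hr : f x = r) (hv : v ∈ frechetSubdiff f x) :
    WithLp.toLp 2 (v, (-1 : ℝ)) ∈ frechetNormalCone (epigraph f) (WithLp.toLp 2 (x, r)) := by
  refine ⟨by simp [epigraph, hr], fun ε hε => ?_⟩
  have h1 := (mem_frechetSubdiff_iff hbot hr).1 hv ε hε
  have hfst : Tendsto (fun p : WithLp 2 (V × ℝ) => p.fst) (𝓝 (WithLp.toLp 2 (x, r))) (𝓝 x) :=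
    (WithLp.fstL 2 ℝ V ℝ).continuous.tendsto _
  have h2 := hfst.eventually h1
  filter_upwards [nhdsWithin_le_nhds h2, self_mem_nhdsWithin] with p hp hpe
  have hpe' : f p.fst ≤ (p.snd : EReal) := hpe
  have hlt : p.fst ∈ edom f := lt_of_le_of_lt hpe' (EReal.coe_lt_top _)
  obtain ⟨s, hs⟩ := exists_real_of_mem_edom hbot hlt
  have h3 := hp s hs
  rw [hs] at hpe'
  have h4 : s ≤ p.snd := by exact_mod_cast hpe'
  have h5 : ‖p.fst - x‖ ≤ ‖p - WithLp.toLp 2 (x, r)‖ :=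
    WithLp.norm_fst_le _ (p - WithLp.toLp 2 (x, r))
  have h6 : ε * ‖p.fst - x‖ ≤ ε * ‖p - WithLp.toLp 2 (x, r)‖ := by gcongr
  have h7 : inner ℝ (WithLp.toLp 2 (v, (-1 : ℝ))) (p - WithLp.toLp 2 (x, r))
      = inner ℝ v (p.fst - x) - (p.snd - r) := by
    rw [WithLp.prod_inner_apply]
    simp
    ring
  rw [h7]
  linarith

/-- Fréchet normals `(v, -1)` to the epigraph give Fréchet subgradients. -/
lemma mem_frechetSubdiff_of_toLp_neg_one {f : V → EReal} (hbot : ∀ z, f z ≠ ⊥) {x v : V} {r : ℝ}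
    (hr : f x = r)
    (hv : WithLp.toLp 2 (v, (-1 : ℝ)) ∈ frechetNormalCone (epigraph f) (WithLp.toLp 2 (x, r))) :
    v ∈ frechetSubdiff f x := by
  rw [mem_frechetSubdiff_iff hbot hr]
  intro ε hε
  -- If the subgradient inequality fails at `z`, the point `A z` of the would-be minorant lies in
  -- the epigraph. Its displacement from `(x, r)` has inner product `ε * ‖z - x‖` with `(v, -1)` and
  -- norm at most `C * ‖z - x‖`, so normality with tolerance `ε / (2 * C)` is violated.
  set C : ℝ := 2 + ‖v‖ + ε with hC
  have hCpos : 0 < C := by positivity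
  have h1 := hv.2 (ε / (2 * C)) (by positivity)
  rw [eventually_nhdsWithin_iff] at h1
  let A : V → WithLp 2 (V × ℝ) := fun z =>
    WithLp.toLp 2 (z, r + (inner ℝ v (z - x) - ε * ‖z - x‖))
  have hA : Tendsto A (𝓝 x) (𝓝 (WithLp.toLp 2 (x, r))) := by
    have : ContinuousAt A x := by
      apply Continuous.continuousAt
      exact (WithLp.prod_continuous_toLp 2 V ℝ).comp (by fun_prop)
    simpa [ContinuousAt, A] using this
  filter_upwards [hA.eventually h1] with z hz s hs
  by_contra! hcon
  have hmem : A z ∈ epigraph f := by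
    change f z ≤ ((r + (inner ℝ v (z - x) - ε * ‖z - x‖) : ℝ) : EReal)
    rw [hs]
    exact_mod_cast hcon.le
  have h2 := hz hmem
  have hzx : z ≠ x := by
    rintro rfl
    rw [hr] at hs
    have : r = s := by exact_mod_cast hs
    simp [this] at hcon
  have hpos : 0 < ‖z - x‖ := norm_pos_iff.2 (sub_ne_zero.2 hzx)
  have h7 : inner ℝ (WithLp.toLp 2 (v, (-1 : ℝ))) (A z - WithLp.toLp 2 (x, r))
      = ε * ‖z - x‖ := by
    rw [WithLp.prod_inner_apply]
    simp [A]
  have h8 : ‖A z - WithLp.toLp 2 (x, r)‖ ≤ ‖z - x‖ + |inner ℝ v (z - x) - ε * ‖z - x‖| := by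
    have e : A z - WithLp.toLp 2 (x, r)
        = WithLp.toLp 2 (z - x, inner ℝ v (z - x) - ε * ‖z - x‖) := by
      simp only [A, ← WithLp.toLp_sub, Prod.mk_sub_mk, add_sub_cancel_left]
    rw [e, WithLp.prod_norm_eq_of_L2]
    apply Real.sqrt_le_iff.2
    refine ⟨by positivity, ?_⟩
    change ‖z - x‖ ^ 2 + ‖inner ℝ v (z - x) - ε * ‖z - x‖‖ ^ 2 ≤ _
    rw [Real.norm_eq_abs]
    have := mul_nonneg (norm_nonneg (z - x)) (abs_nonneg (inner ℝ v (z - x) - ε * ‖z - x‖))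
    nlinarith
  have h9 : |inner ℝ v (z - x) - ε * ‖z - x‖| ≤ (‖v‖ + ε) * ‖z - x‖ := by
    have := abs_real_inner_le_norm v (z - x)
    calc _ ≤ |inner ℝ v (z - x)| + |ε * ‖z - x‖| := abs_sub _ _
      _ ≤ ‖v‖ * ‖z - x‖ + ε * ‖z - x‖ := by
        rw [abs_of_nonneg (by positivity : 0 ≤ ε * ‖z - x‖)]; gcongr
      _ = _ := by ring
  rw [h7] at h2
  have h10 : ε / (2 * C) * ‖A z - WithLp.toLp 2 (x, r)‖ ≤ ε / (2 * C) * (C * ‖z - x‖) := by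
    gcongr
    rw [hC]
    nlinarith
  have h11 : ε / (2 * C) * (C * ‖z - x‖) = ε / 2 * ‖z - x‖ := by
    field_simp
  have : 0 < ε * ‖z - x‖ := by positivity
  linarith

/-- At a point of regularity every limiting subgradient is a Fréchet subgradient. -/
lemma limSubdiff_subset_frechetSubdiff {f : V → EReal} (hbot : ∀ z, f z ≠ ⊥) {x : V}
    (hreg : IsRegularAt f x) : limSubdiff f x ⊆ frechetSubdiff f x := by
  rintro v ⟨hx, y, w, hy, hfy, hw, hwv⟩
  obtain ⟨r, hr⟩ := exists_real_of_mem_edom hbot hx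
  have hC := hreg.2.2.2.2
  rw [hr, EReal.toReal_coe] at hC
  refine mem_frechetSubdiff_of_toLp_neg_one hbot hr ?_
  -- It now suffices that `(v, -1)` is a limiting normal: it is the limit of the Fréchet normals `(w
  -- k, -1)`, taken at graph points that converge because the values `f (y k)` do.
  rw [← hC]
  have hreal : ∀ k, f (y k) = (((f (y k)).toReal : ℝ) : EReal) := fun k =>
    (EReal.coe_toReal (ne_of_lt (hw k).1) (hbot _)).symm
  refine ⟨by simp [epigraph, hr], fun k => WithLp.toLp 2 (y k, (f (y k)).toReal),
    fun k => WithLp.toLp 2 (w k, (-1 : ℝ)), ?_,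
    fun k => toLp_neg_one_mem_frechetNormalCone hbot (hreal k) (hw k), ?_⟩
  · refine ((WithLp.prod_continuous_toLp 2 V ℝ).tendsto _).comp (hy.prodMk_nhds ?_)
    have h := (EReal.tendsto_toReal (a := f x) (ne_of_lt hx) (hbot x)).comp hfy
    rw [hr, EReal.toReal_coe] at h
    exact h
  · exact ((WithLp.prod_continuous_toLp 2 V ℝ).tendsto _).comp
      (hwv.prodMk_nhds tendsto_const_nhds)

end Calculus

/-! ### Exact location of minimizers by penalization on compact sets -/

section Penalization

lemma lowerSemicontinuous_add_coe {X : Type*} [TopologicalSpace X] {f : X → EReal} {φ : X → ℝ}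
    (hf : LowerSemicontinuous f) (hφ : Continuous φ) :
    LowerSemicontinuous fun z => f z + (φ z : EReal) :=
  hf.add' (continuous_coe_real_ereal.comp hφ).lowerSemicontinuous fun z =>
    EReal.continuousAt_add (by simp) (by simp)

lemma eventually_coe_sub_lt {X : Type*} [TopologicalSpace X] {f : X → EReal}
    (hf : LowerSemicontinuous f) {x : X} {r ε : ℝ} (hr : f x = r) (hε : 0 < ε) :
    ∀ᶠ u in 𝓝 x, ((r - ε : ℝ) : EReal) < f u := by
  refine hf x _ ?_
  change ((r - ε : ℝ) : EReal) < f x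
  rw [hr]
  exact_mod_cast sub_lt_self r hε

/-- A penalization principle: if on the compact set `K` all points with vanishing penalty and with
`Ψ`-value at most that of `z₀` lie in the open set `U`, then for a large penalty parameter the
penalized function has a minimizer over `K` in `U`. -/
lemma exists_penalized_min {X : Type*} [TopologicalSpace X] {K U : Set X} (hK : IsCompact K)
    (hU : IsOpen U) {Ψ : X → EReal} {P : X → ℝ} (hΨ : LowerSemicontinuous Ψ)
    (hbot : ∀ z, Ψ z ≠ ⊥) (hP : Continuous P) (hP0 : ∀ z, 0 ≤ P z) {z₀ : X} (hz₀ : z₀ ∈ K)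
    (hPz₀ : P z₀ = 0) (hfin : Ψ z₀ ≠ ⊤)
    (hkey : ∀ z ∈ K, P z = 0 → Ψ z ≤ Ψ z₀ → z ∈ U) :
    ∃ n : ℝ, 0 ≤ n ∧ ∃ z ∈ K ∩ U, Ψ z ≤ Ψ z₀ ∧
      ∀ z' ∈ K, Ψ z + ((n * P z : ℝ) : EReal) ≤ Ψ z' + ((n * P z' : ℝ) : EReal) := by
  obtain ⟨r, hr⟩ : ∃ r : ℝ, Ψ z₀ = r := ⟨_, (EReal.coe_toReal hfin (hbot z₀)).symm⟩
  -- A parameter that pushes the penalized function above `Ψ z₀` off `U` exists locally, and it may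
  -- be increased; compactness of `K \ U` makes it uniform. Where `P` vanishes, `n = 0` already
  -- works by `hkey` and semicontinuity.
  have hlarge : ∃ n : ℝ, 0 ≤ n ∧ ∀ z ∈ K \ U, Ψ z₀ < Ψ z + ((n * P z : ℝ) : EReal) := by
    refine (hK.diff hU).induction_on (p := fun S => ∃ n : ℝ, 0 ≤ n ∧ ∀ z ∈ S,
      Ψ z₀ < Ψ z + ((n * P z : ℝ) : EReal)) ⟨0, le_rfl, by simp⟩ ?_ ?_ ?_
    · rintro s t hst ⟨n, hn, h⟩
      exact ⟨n, hn, fun z hz => h z (hst hz)⟩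
    · rintro s t ⟨n, hn, h⟩ ⟨n', hn', h'⟩
      have hmono : ∀ a b : ℝ, a ≤ b → ∀ z,
          Ψ z + ((a * P z : ℝ) : EReal) ≤ Ψ z + ((b * P z : ℝ) : EReal) := by
        intro a b hab z
        have := mul_le_mul_of_nonneg_right hab (hP0 z)
        exact add_le_add le_rfl (EReal.coe_le_coe_iff.2 this)
      refine ⟨max n n', le_max_of_le_left hn, ?_⟩
      rintro z (hz | hz)
      · exact (h z hz).trans_le (hmono _ _ (le_max_left _ _) z)
      · exact (h' z hz).trans_le (hmono _ _ (le_max_right _ _) z)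
    · rintro z ⟨hzK, hzU⟩
      by_cases hPz : P z = 0
      · have hlt : Ψ z₀ < Ψ z := by
          by_contra! hle
          exact hzU (hkey z hzK hPz hle)
        refine ⟨{z' | Ψ z₀ < Ψ z'}, nhdsWithin_le_nhds (hΨ z _ hlt), 0, le_rfl, fun z' hz' => ?_⟩
        simpa using hz'
      · have hPpos : 0 < P z := lt_of_le_of_ne (hP0 z) (Ne.symm hPz)
        obtain ⟨M, hM⟩ : ∃ M : ℝ, (M : EReal) < Ψ z := by
          obtain ⟨M, -, hM⟩ := EReal.lt_iff_exists_real_btwn.1 (bot_lt_iff_ne_bot.2 (hbot z))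
          exact ⟨M, hM⟩
        have h1 := hΨ z _ hM
        have h2 : ∀ᶠ z' in 𝓝 z, P z / 2 < P z' :=
          hP.continuousAt.eventually (lt_mem_nhds (half_lt_self hPpos))
        -- Near `z` the function exceeds `M` and the penalty exceeds `P z / 2`, so this parameter
        -- adds at least the missing `r - M`.
        refine ⟨{z' | (M : EReal) < Ψ z' ∧ P z / 2 < P z'}, nhdsWithin_le_nhds (h1.and h2),
          max 0 ((r - M) / (P z / 2)), le_max_left _ _, ?_⟩
        rintro z' ⟨hz1, hz2⟩
        have h3 : r - M ≤ max 0 ((r - M) / (P z / 2)) * P z' := by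
          calc r - M = (r - M) / (P z / 2) * (P z / 2) := by field_simp
            _ ≤ max 0 ((r - M) / (P z / 2)) * (P z / 2) := by
              gcongr
              exact le_max_right _ _
            _ ≤ _ := by gcongr
        rw [hr]
        calc (r : EReal) = ((M + (r - M) : ℝ) : EReal) := by congr 1; ring
          _ ≤ ((M + max 0 ((r - M) / (P z / 2)) * P z' : ℝ) : EReal) := by
            exact_mod_cast by linarith
          _ = (M : EReal) + ((max 0 ((r - M) / (P z / 2)) * P z' : ℝ) : EReal) := by
            rw [EReal.coe_add]
          _ < _ := EReal.add_lt_add_right_coe hz1 _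
  obtain ⟨n, hn, hnlt⟩ := hlarge
  have hlsc : LowerSemicontinuous fun z => Ψ z + ((n * P z : ℝ) : EReal) :=
    lowerSemicontinuous_add_coe hΨ (hP.const_mul n)
  obtain ⟨z, hzK, hz⟩ := (hlsc.lowerSemicontinuousOn K).exists_isMinOn ⟨z₀, hz₀⟩ hK
  have hz0 : Ψ z + ((n * P z : ℝ) : EReal) ≤ Ψ z₀ := by simpa [hPz₀] using hz hz₀
  refine ⟨n, hn, z, ⟨hzK, ?_⟩, ?_, fun z' hz' => hz hz'⟩
  · by_contra hzU
    exact absurd (hnlt z ⟨hzK, hzU⟩) (not_lt.2 hz0)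
  · refine le_trans ?_ hz0
    conv_lhs => rw [← add_zero (Ψ z)]
    gcongr
    exact_mod_cast mul_nonneg hn (hP0 z)

end Penalization

/-! ### Bounded subsequences or limiting directions -/

section Sequences

/-- A sequence either has a convergent subsequence, or its norms blow up and the directions
converge along a subsequence. -/
lemma exists_subseq_tendsto_or_direction {V : Type*} [NormedAddCommGroup V] [NormedSpace ℝ V]
    [ProperSpace V] (p : ℕ → V) :
    (∃ a, ∃ φ : ℕ → ℕ, StrictMono φ ∧ Tendsto (p ∘ φ) atTop (𝓝 a)) ∨
    (∃ a, ∃ φ : ℕ → ℕ, StrictMono φ ∧ ‖a‖ = 1 ∧ (∀ n, 0 < ‖p (φ n)‖) ∧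
      Tendsto (fun n => ‖p (φ n)‖⁻¹) atTop (𝓝 0) ∧
      Tendsto (fun n => ‖p (φ n)‖⁻¹ • p (φ n)) atTop (𝓝 a)) := by
  by_cases h : Tendsto (fun n => ‖p n‖) atTop atTop
  · right
    obtain ⟨K, hK⟩ := eventually_atTop.1 (h.eventually (eventually_gt_atTop 0))
    have hu : ∀ n, ‖p (n + K)‖⁻¹ • p (n + K) ∈ Metric.sphere (0 : V) 1 := fun n => by
      have := hK (n + K) (by lia)
      simp [norm_smul, this.ne']
    obtain ⟨a, ha, φ, hφ, hlim⟩ := tendsto_subseq_of_bounded Metric.isBounded_sphere hu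
    rw [Metric.isClosed_sphere.closure_eq] at ha
    have hφ' : StrictMono fun n => φ n + K := fun a b hab => by simpa using hφ hab
    refine ⟨a, fun n => φ n + K, hφ', by simpa using ha, fun n => hK _ (by lia), ?_, hlim⟩
    exact tendsto_inv_atTop_zero.comp (h.comp hφ'.tendsto_atTop)
  · left
    rw [tendsto_atTop] at h
    push Not at h
    obtain ⟨C, hC⟩ := h
    have hfreq : ∃ᶠ n in atTop, p n ∈ Metric.closedBall (0 : V) C := by
      refine hC.mono fun n hn => ?_
      simpa using hn.le
    obtain ⟨a, -, φ, hφ, hlim⟩ :=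
      tendsto_subseq_of_frequently_bounded Metric.isBounded_closedBall hfreq
    exact ⟨a, φ, hφ, hlim⟩

end Sequences

/-! ### Fuzzy sum rule and its exact form under the horizon qualification -/

section SumRule

variable {V : Type*} [NormedAddCommGroup V] [InnerProductSpace ℝ V]

/-- Fréchet subgradients of a convex function are subgradients in the sense of convex analysis. -/
lemma convex_subgradient_of_frechet {k : V → EReal} (hbot : ∀ z, k z ≠ ⊥)
    (hconv : ConvexOn ℝ (edom k) (fun z => (k z).toReal)) {v p : V} {r : ℝ} (hr : k v = r)
    (hp : p ∈ frechetSubdiff k v) {z : V} {s : ℝ} (hs : k z = s) :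
    r + inner ℝ p (z - v) ≤ s := by
  -- The Fréchet inequality is tested at one point of the segment close to `v`; convexity bounds the
  -- value there, and all terms scale with `t`, which cancels.
  have key : ∀ ε : ℝ, 0 < ε → r + inner ℝ p (z - v) ≤ s + ε * ‖z - v‖ := by
    intro ε hε
    have h1 := (mem_frechetSubdiff_iff hbot hr).1 hp ε hε
    have hlim : Tendsto (fun t : ℝ => v + t • (z - v)) (𝓝[>] 0) (𝓝 v) := by
      have : Tendsto (fun t : ℝ => v + t • (z - v)) (𝓝 0) (𝓝 (v + (0 : ℝ) • (z - v))) :=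
        Continuous.tendsto (by fun_prop) 0
      simpa using this.mono_left nhdsWithin_le_nhds
    have h2 : ∀ᶠ t : ℝ in 𝓝[>] 0, t ∈ Ioo (0 : ℝ) 1 := Ioo_mem_nhdsGT one_pos
    obtain ⟨t, ht, ht0, ht1⟩ := ((hlim.eventually h1).and h2).exists
    have hv : v ∈ edom k := mem_edom_of_eq_coe hr
    have hz : z ∈ edom k := mem_edom_of_eq_coe hs
    have e : v + t • (z - v) = (1 - t) • v + t • z := by
      rw [smul_sub, sub_smul, one_smul]; abel
    have hmem : v + t • (z - v) ∈ edom k := by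
      rw [e]
      exact hconv.1 hv hz (by linarith) ht0.le (by ring)
    have h3 := hconv.2 hv hz (sub_nonneg.2 ht1.le) ht0.le (by ring)
    rw [← e] at h3
    have h4 := ht _ (EReal.coe_toReal (ne_of_lt hmem) (hbot _)).symm
    simp only [hr, hs, EReal.toReal_coe, smul_eq_mul] at h3
    rw [add_sub_cancel_left, inner_smul_right, norm_smul, Real.norm_of_nonneg ht0.le] at h4
    have h5 : t * (r + inner ℝ p (z - v)) ≤ t * (s + ε * ‖z - v‖) := by nlinarith
    exact le_of_mul_le_mul_left h5 ht0
  refine le_of_forall_pos_le_add fun δ hδ => ?_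
  refine (key (δ / (‖z - v‖ + 1)) (by positivity)).trans ?_
  gcongr
  rw [div_mul_eq_mul_div, div_le_iff₀ (by positivity)]
  nlinarith [norm_nonneg (z - v)]

lemma hasGradientAt_const_mul_norm_sub_sq [CompleteSpace V] (n : ℝ) (w u : V) :
    HasGradientAt (fun u => n * ‖u - w‖ ^ 2) ((2 * n) • (u - w)) u := by
  rw [hasGradientAt_iff_hasFDerivAt]
  have h := ((hasFDerivAt_id u).sub_const w).norm_sq.const_mul n
  have e : InnerProductSpace.toDual ℝ V ((2 * n) • (u - w))
      = n • 2 • (innerSL ℝ) (id u - w) ∘SL ContinuousLinearMap.id ℝ V := by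
    ext d
    simp [InnerProductSpace.toDual_apply_apply]
    ring
  rw [e]
  exact h

lemma hasGradientAt_fun_add [CompleteSpace V] {φ ψ : V → ℝ} {a b x : V}
    (h1 : HasGradientAt φ a x) (h2 : HasGradientAt ψ b x) :
    HasGradientAt (fun z => φ z + ψ z) (a + b) x := by
  rw [hasGradientAt_iff_hasFDerivAt] at h1 h2 ⊢
  rw [map_add]
  exact h1.add h2

/-- Lower bounds on both summands and an upper bound on the sum pin down each summand. This is how
closeness of function values is obtained from lower semicontinuity alone. -/
lemma le_add_of_add_coe_le {a b : EReal} {α β ε t s : ℝ} (ha : ((α - ε : ℝ) : EReal) ≤ a)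
    (hb : ((β - ε : ℝ) : EReal) ≤ b) (ht : 0 ≤ t) (hs : s ≤ α + β)
    (h : a + b + (t : EReal) ≤ (s : EReal)) :
    ∃ a' b' : ℝ, a = a' ∧ b = b' ∧ |a' - α| ≤ ε ∧ |b' - β| ≤ ε := by
  induction a with
  | bot => exact absurd (le_bot_iff.1 ha) (EReal.coe_ne_bot _)
  | top =>
    induction b with
    | bot => exact absurd (le_bot_iff.1 hb) (EReal.coe_ne_bot _)
    | top => simp at h
    | coe b => simp at h
  | coe a =>
    induction b with
    | bot => exact absurd (le_bot_iff.1 hb) (EReal.coe_ne_bot _)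
    | top => simp at h
    | coe b =>
      norm_cast at ha hb h
      exact ⟨a, b, rfl, rfl, abs_le.2 ⟨by linarith, by linarith⟩,
        abs_le.2 ⟨by linarith, by linarith⟩⟩

/-- Fuzzy sum rule at a minimizer of the sum of a lower semicontinuous and a convex function. -/
lemma exists_fuzzy_sum_subgradients [ProperSpace V] {g k : V → EReal}
    (hg : LowerSemicontinuous g) (hgb : ∀ z, g z ≠ ⊥) (hk : LowerSemicontinuous k)
    (hkb : ∀ z, k z ≠ ⊥) {x : V} {a b : ℝ} (ha : g x = a) (hb : k x = b)
    (hmin : ∀ z, g x + k x ≤ g z + k z) {ε : ℝ} (hε : 0 < ε) :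
    ∃ u v p q : V, ∃ a' b' : ℝ, ‖u - x‖ ≤ ε ∧ ‖v - x‖ ≤ ε ∧ g u = a' ∧ k v = b' ∧
      |a' - a| ≤ ε ∧ |b' - b| ≤ ε ∧ p ∈ frechetSubdiff k v ∧ q ∈ frechetSubdiff g u ∧
      ‖q + p‖ ≤ ε := by
  have h1 : ∀ᶠ u in 𝓝 x, ((a - ε : ℝ) : EReal) < g u :=
    eventually_coe_sub_lt hg ha hε
  have h2 : ∀ᶠ u in 𝓝 x, ((b - ε : ℝ) : EReal) < k u :=
    eventually_coe_sub_lt hk hb hε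
  obtain ⟨ρ₀, hρ₀, hball⟩ := Metric.nhds_basis_closedBall.eventually_iff.1 (h1.and h2)
  -- The gradients of the coupling penalty at `u` and `v` will cancel, so the sum of the two
  -- subgradients is `-2 • (u - x)`; hence the radius `ε / 2`.
  set ρ := min ρ₀ (ε / 2) with hρ
  have hρpos : 0 < ρ := lt_min hρ₀ (by positivity)
  have hlow : ∀ u ∈ Metric.closedBall x ρ, ((a - ε : ℝ) : EReal) < g u ∧
      ((b - ε : ℝ) : EReal) < k u := fun u hu =>
    hball (Metric.closedBall_subset_closedBall (min_le_left _ _) hu)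
  -- Doubling of variables: `g` and `k` get separate arguments, coupled by the penalty `‖u - v‖ ^
  -- 2`. The quadratic term makes `(x, x)` the only diagonal point of the compact set with value at
  -- most `Ψ (x, x)`, as `exists_penalized_min` requires.
  let Ψ : V × V → EReal := fun z => g z.1 + k z.2 + ((‖z.1 - x‖ ^ 2 : ℝ) : EReal)
  have hΨ : LowerSemicontinuous Ψ := by
    refine lowerSemicontinuous_add_coe ?_ (by fun_prop)
    exact (hg.comp continuous_fst).add' (hk.comp continuous_snd) fun z =>
      EReal.continuousAt_add (Or.inr (hkb _)) (Or.inl (hgb _))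
  have hΨb : ∀ z, Ψ z ≠ ⊥ := fun z => add_coe_ne_bot (by
    rw [Ne, EReal.add_eq_bot_iff]; simp [hgb, hkb]) _
  have hΨ0 : Ψ (x, x) = ((a + b : ℝ) : EReal) := by simp [Ψ, ha, hb]
  obtain ⟨n, hn, ⟨u, v⟩, ⟨-, hu, hv⟩, hle, hmn⟩ := exists_penalized_min
    (K := Metric.closedBall x ρ ×ˢ Metric.closedBall x ρ)
    (U := Metric.ball x ρ ×ˢ Metric.ball x ρ) (Ψ := Ψ) (P := fun z => ‖z.1 - z.2‖ ^ 2)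
    (z₀ := (x, x)) ((isCompact_closedBall x ρ).prod (isCompact_closedBall x ρ))
    (Metric.isOpen_ball.prod Metric.isOpen_ball) hΨ hΨb (by fun_prop) (fun z => by positivity)
    ⟨Metric.mem_closedBall_self hρpos.le, Metric.mem_closedBall_self hρpos.le⟩ (by simp)
    (by rw [hΨ0]; exact EReal.coe_ne_top _) (by
      rintro ⟨u, v⟩ ⟨hu, hv⟩ hP hle
      have huv : u = v := by simpa [sub_eq_zero] using hP
      subst huv
      have hl := hlow u hu
      obtain ⟨a', b', ha', hb', -, -⟩ := le_add_of_add_coe_le hl.1.le hl.2.le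
        (by positivity : 0 ≤ ‖u - x‖ ^ 2) le_rfl (by rw [← hΨ0]; exact hle)
      have h3 := hmin u
      have h4 : Ψ (u, u) ≤ Ψ (x, x) := hle
      rw [hΨ0] at h4
      simp only [Ψ] at h4
      rw [ha, hb, ha', hb'] at h3
      rw [ha', hb'] at h4
      norm_cast at h3 h4
      have h5 : ‖u - x‖ ^ 2 = 0 := le_antisymm (by linarith) (by positivity)
      have h6 : u = x := by simpa [sub_eq_zero] using h5
      subst h6
      exact ⟨Metric.mem_ball_self hρpos, Metric.mem_ball_self hρpos⟩)
  have hlu := hlow u (Metric.ball_subset_closedBall hu)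
  have hlv := hlow v (Metric.ball_subset_closedBall hv)
  obtain ⟨a', b', ha', hb', haε, hbε⟩ := le_add_of_add_coe_le hlu.1.le hlv.2.le
    (by positivity : 0 ≤ ‖u - x‖ ^ 2) le_rfl (by rw [← hΨ0]; exact hle)
  have hux : ‖u - x‖ ≤ ρ := by simpa [dist_eq_norm] using (Metric.mem_ball.1 hu).le
  have hvx : ‖v - x‖ ≤ ρ := by simpa [dist_eq_norm] using (Metric.mem_ball.1 hv).le
  have hρε : ρ ≤ ε / 2 := min_le_right _ _
  have hfp := neg_mem_frechetSubdiff_of_localMin hkb (mem_edom_of_eq_coe hb')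
    (hasGradientAt_const_mul_norm_sub_sq n u v) (by
      filter_upwards [Metric.isOpen_ball.mem_nhds hv] with w hw
      have h := hmn (u, w) ⟨Metric.ball_subset_closedBall hu, Metric.ball_subset_closedBall hw⟩
      simp only [Ψ, ha', hb'] at h
      by_cases hkw : k w = ⊤
      · rw [hkw, EReal.top_add_coe]; exact le_top
      · rw [← EReal.coe_toReal hkw (hkb w)] at h ⊢
        rw [hb']
        norm_cast at h ⊢
        rw [norm_sub_rev w u, norm_sub_rev v u]
        linarith)
  have hfq := neg_mem_frechetSubdiff_of_localMin hgb (mem_edom_of_eq_coe ha')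
    (hasGradientAt_fun_add (hasGradientAt_const_mul_norm_sub_sq n v u)
      (hasGradientAt_const_mul_norm_sub_sq 1 x u)) (by
      filter_upwards [Metric.isOpen_ball.mem_nhds hu] with w hw
      have h := hmn (w, v) ⟨Metric.ball_subset_closedBall hw, Metric.ball_subset_closedBall hv⟩
      simp only [Ψ, ha', hb'] at h
      by_cases hgw : g w = ⊤
      · rw [hgw, EReal.top_add_coe]; exact le_top
      · rw [← EReal.coe_toReal hgw (hgb w)] at h ⊢
        rw [ha']
        norm_cast at h ⊢
        linarith)
  refine ⟨u, v, _, _, a', b', by linarith, by linarith, ha', hb', haε, hbε, hfp, hfq, ?_⟩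
  have e : -((2 * n) • (u - v) + (2 * 1 : ℝ) • (u - x)) + -((2 * n) • (v - u))
      = -((2 : ℝ) • (u - x)) := by
    rw [← neg_sub u v, smul_neg]
    simp
  rw [e, norm_neg, norm_smul]
  simp only [Real.norm_ofNat]
  linarith

/-- Existence of a convex subgradient at a minimizer of a sum under the horizon qualification. -/
lemma exists_convex_subgradient_of_isMin [ProperSpace V] {g k : V → EReal}
    (hg : LowerSemicontinuous g) (hgb : ∀ z, g z ≠ ⊥) (hk : LowerSemicontinuous k)
    (hkb : ∀ z, k z ≠ ⊥) (hconv : ConvexOn ℝ (edom k) (fun z => (k z).toReal)) {x : V} {a b : ℝ}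
    (ha : g x = a) (hb : k x = b) (hmin : ∀ z, g x + k x ≤ g z + k z)
    (hq : horizonSubdiff g x ∩ {v | -v ∈ normalCone (edom k) x} ⊆ {0}) :
    ∃ p : V, ∀ z, ∀ s : ℝ, k z = s → b + inner ℝ p (z - x) ≤ s := by
  have hfz := fun n : ℕ => exists_fuzzy_sum_subgradients hg hgb hk hkb ha hb hmin
    (Nat.one_div_pos_of_nat (n := n) (α := ℝ))
  choose u v p q a' b' hu hv hga hkb' haε hbε hp hqf hpq using hfz
  have hε : Tendsto (fun n : ℕ => 1 / ((n : ℝ) + 1)) atTop (𝓝 0) :=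
    tendsto_one_div_add_atTop_nhds_zero_nat
  have hulim : Tendsto u atTop (𝓝 x) := by
    rw [tendsto_iff_norm_sub_tendsto_zero]
    exact squeeze_zero (fun n => norm_nonneg _) hu hε
  have hvlim : Tendsto v atTop (𝓝 x) := by
    rw [tendsto_iff_norm_sub_tendsto_zero]
    exact squeeze_zero (fun n => norm_nonneg _) hv hε
  have halim : Tendsto a' atTop (𝓝 a) := by
    rw [tendsto_iff_norm_sub_tendsto_zero]
    exact squeeze_zero (fun n => norm_nonneg _) haε hε
  have hblim : Tendsto b' atTop (𝓝 b) := by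
    rw [tendsto_iff_norm_sub_tendsto_zero]
    exact squeeze_zero (fun n => norm_nonneg _) hbε hε
  have hpqlim : Tendsto (fun n => q n + p n) atTop (𝓝 0) :=
    squeeze_zero_norm hpq hε
  have hsub : ∀ n z (s : ℝ), k z = s → b' n + inner ℝ (p n) (z - v n) ≤ s := fun n z s hs =>
    convex_subgradient_of_frechet hkb hconv (hkb' n) (hp n) hs
  -- A limit of the multipliers `p n` is the desired subgradient. If they blow up along a direction
  -- `c`, rescaling `q n + p n → 0` puts `-c` in the horizon subdifferential of `g`, and rescaling
  -- the subgradient inequality makes `c` normal to `dom k`; the qualification then contradicts `‖c‖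
  -- = 1`.
  rcases exists_subseq_tendsto_or_direction p with ⟨c, φ, hφ, hlim⟩ |
    ⟨c, φ, hφ, hc, hpos, hinv, hlim⟩
  · refine ⟨c, fun z s hs => ?_⟩
    have hT : Tendsto (fun n => b' (φ n) + inner ℝ (p (φ n)) (z - v (φ n))) atTop
        (𝓝 (b + inner ℝ c (z - x))) :=
      (hblim.comp hφ.tendsto_atTop).add
        (hlim.inner (tendsto_const_nhds.sub (hvlim.comp hφ.tendsto_atTop)))
    exact le_of_tendsto hT (Eventually.of_forall fun n => hsub _ z s hs)
  · exfalso
    have hhor : -c ∈ horizonSubdiff g x := by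
      refine ⟨mem_edom_of_eq_coe ha, u ∘ φ, q ∘ φ, fun n => ‖p (φ n)‖⁻¹,
        hulim.comp hφ.tendsto_atTop, ?_, fun n => hqf _, fun n => inv_pos.2 (hpos n), hinv, ?_⟩
      · rw [ha]
        refine ((continuous_coe_real_ereal.tendsto a).comp
          (halim.comp hφ.tendsto_atTop)).congr fun n => ?_
        simp [hga]
      · have h1 := (hinv.smul (hpqlim.comp hφ.tendsto_atTop)).sub hlim
        simp only [smul_zero, zero_sub] at h1
        refine h1.congr fun n => ?_
        simp
    have hnor : c ∈ normalCone (edom k) x := by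
      refine ⟨mem_edom_of_eq_coe hb, fun _ => x, fun _ => c, tendsto_const_nhds,
        fun _ => ⟨mem_edom_of_eq_coe hb, fun ε hε' => ?_⟩, tendsto_const_nhds⟩
      filter_upwards [self_mem_nhdsWithin] with z hz
      obtain ⟨s, hs⟩ := exists_real_of_mem_edom hkb hz
      have hT : Tendsto (fun n => ‖p (φ n)‖⁻¹ * b' (φ n) +
          inner ℝ (‖p (φ n)‖⁻¹ • p (φ n)) (z - v (φ n))) atTop
          (𝓝 (0 * b + inner ℝ c (z - x))) :=
        (hinv.mul (hblim.comp hφ.tendsto_atTop)).add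
          (hlim.inner (tendsto_const_nhds.sub (hvlim.comp hφ.tendsto_atTop)))
      have hT' : Tendsto (fun n => ‖p (φ n)‖⁻¹ * s) atTop (𝓝 (0 * s)) :=
        hinv.mul tendsto_const_nhds
      have := le_of_tendsto_of_tendsto hT hT' (Eventually.of_forall fun n => by
        have h1 := mul_le_mul_of_nonneg_left (hsub (φ n) z s hs) (inv_pos.2 (hpos n)).le
        simp only [inner_smul_left, conj_trivial]
        linarith)
      have hnn : 0 ≤ ε * ‖z - x‖ := by positivity
      linarith
    have : -c ∈ ({0} : Set V) := hq ⟨hhor, by simpa using hnor⟩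
    simp only [mem_singleton_iff, neg_eq_zero] at this
    simp [this] at hc

end SumRule

/-! ### Legendre functions: subgradients live only in the interior of the domain -/

section Legendre

variable {N : ℕ}

lemma hasGradientAt_grad {h : Euc N → EReal} (hL : IsLegendre h) {y : Euc N}
    (hy : y ∈ interior (edom h)) : HasGradientAt (fun z => (h z).toReal) (grad h y) y :=
  ((hL.differentiableOn y hy).differentiableAt (isOpen_interior.mem_nhds hy)).hasGradientAt

/-- The gradient inequality for a Legendre function. -/
lemma gradient_inequality {h : Euc N → EReal} (hL : IsLegendre h) {y z : Euc N}
    (hy : y ∈ interior (edom h)) (hz : z ∈ edom h) :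
    (h y).toReal + inner ℝ (grad h y) (z - y) ≤ (h z).toReal := by
  have hyd := interior_subset hy
  obtain ⟨r, hr⟩ := exists_real_of_mem_edom hL.proper.1 hyd
  obtain ⟨s, hs⟩ := exists_real_of_mem_edom hL.proper.1 hz
  have hfre : grad h y ∈ frechetSubdiff h y := by
    rw [mem_frechetSubdiff_iff hL.proper.1 hr]
    intro ε hε
    filter_upwards [(hasGradientAt_iff_isLittleO.1 (hasGradientAt_grad hL hy)).def hε] with w hw t ht
    simp only [hr, ht, EReal.toReal_coe, Real.norm_eq_abs] at hw
    linarith [(abs_le.1 hw).1]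
  rw [hr, hs]
  simpa using convex_subgradient_of_frechet hL.proper.1 hL.convexOn hr hfre hs

/-- A point at which an essentially smooth convex function has a subgradient is interior. -/
lemma mem_interior_of_convex_subgradient {h : Euc N → EReal} (hL : IsLegendre h) {x p : Euc N}
    {b : ℝ} (hb : h x = b) (hp : ∀ z, ∀ s : ℝ, h z = s → b + inner ℝ p (z - x) ≤ s) :
    x ∈ interior (edom h) := by
  by_contra hx
  have hxd : x ∈ edom h := mem_edom_of_eq_coe hb
  have hfr : x ∈ frontier (edom h) := ⟨subset_closure hxd, hx⟩
  obtain ⟨a, ha⟩ := hL.interior_nonempty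
  obtain ⟨ρ, hρ, hball⟩ := Metric.nhds_basis_closedBall.mem_iff.1 (isOpen_interior.mem_nhds ha)
  have hcont : ContinuousOn (fun z => (h z).toReal) (Metric.closedBall a ρ) :=
    hL.differentiableOn.continuousOn.mono hball
  obtain ⟨M, hM⟩ := (isCompact_closedBall a ρ).bddAbove_image hcont
  have hpath : ∀ t ∈ Ioo (0 : ℝ) 1, x + t • (a - x) ∈ interior (edom h) := fun t ht =>
    hL.convexOn.1.add_smul_sub_mem_interior hxd ha ⟨ht.1, ht.2.le⟩
  -- At a boundary point, gradients along the segment towards the interior point `a` would stay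
  -- bounded, against steepness. Indeed `p` bounds the values of `h` on the segment from below and
  -- the slope of `h` towards `a` as well; the gradient inequality tested on the ball around `a`,
  -- where `h ≤ M`, then bounds `inner ℝ G d` in every direction `d`.
  set C : ℝ := M - b + 2 * |inner ℝ p (a - x)| with hC
  have hbound : ∀ t ∈ Ioo (0 : ℝ) 1, ρ * ‖grad h (x + t • (a - x))‖ ≤ C := by
    intro t ht
    set y := x + t • (a - x) with hy
    set G := grad h y with hG
    have hyi := hpath t ht
    have hyd := interior_subset hyi
    obtain ⟨r, hr⟩ := exists_real_of_mem_edom hL.proper.1 hyd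
    have h1 : b + t * inner ℝ p (a - x) ≤ r := by
      have := hp y r hr
      rwa [hy, add_sub_cancel_left, inner_smul_right] at this
    have h2 := gradient_inequality hL hyi hxd
    rw [hr, hb, ← hG] at h2
    have exy : x - y = -(t • (a - x)) := by rw [hy]; abel
    rw [exy, inner_neg_right, inner_smul_right] at h2
    simp only [EReal.toReal_coe] at h2
    have h3 : inner ℝ p (a - x) ≤ inner ℝ G (a - x) := by
      have : t * inner ℝ p (a - x) ≤ t * inner ℝ G (a - x) := by linarith
      exact le_of_mul_le_mul_left this ht.1
    have h4 : ∀ d : Euc N, ‖d‖ ≤ ρ → inner ℝ G d ≤ C := by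
      intro d hd
      have hmem : a + d ∈ Metric.closedBall a ρ := by simpa [dist_eq_norm] using hd
      have h5 := gradient_inequality hL hyi (interior_subset (hball hmem))
      have h6 : (h (a + d)).toReal ≤ M := hM ⟨_, hmem, rfl⟩
      have e : a + d - y = (1 - t) • (a - x) + d := by
        rw [hy, sub_smul, one_smul]; abel
      rw [e, inner_add_right, inner_smul_right, hr, ← hG] at h5
      simp only [EReal.toReal_coe] at h5
      have h7 : -|inner ℝ p (a - x)| ≤ inner ℝ p (a - x) := neg_abs_le _
      have h8 : (1 - t) * inner ℝ p (a - x) ≤ (1 - t) * inner ℝ G (a - x) :=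
        mul_le_mul_of_nonneg_left h3 (by linarith [ht.2])
      have h9 : 0 ≤ |inner ℝ p (a - x)| := abs_nonneg _
      rw [hC]
      nlinarith [ht.1, ht.2]
    by_cases hG0 : G = 0
    · rw [hG0]
      simpa using h4 0 (by simpa using hρ.le)
    · have hGn : 0 < ‖G‖ := norm_pos_iff.2 hG0
      have := h4 ((ρ / ‖G‖) • G) (by
        rw [norm_smul, Real.norm_of_nonneg (by positivity)]
        field_simp; exact le_rfl)
      rw [inner_smul_right, real_inner_self_eq_norm_sq] at this
      calc ρ * ‖G‖ = ρ / ‖G‖ * ‖G‖ ^ 2 := by field_simp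
        _ ≤ C := this
  have hlim : Tendsto (fun t : ℝ => x + t • (a - x)) (𝓝[>] 0) (𝓝[interior (edom h)] x) := by
    refine tendsto_nhdsWithin_iff.2 ⟨?_, ?_⟩
    · have : Tendsto (fun t : ℝ => x + t • (a - x)) (𝓝 0) (𝓝 (x + (0 : ℝ) • (a - x))) :=
        Continuous.tendsto (by fun_prop) 0
      simpa using this.mono_left nhdsWithin_le_nhds
    · filter_upwards [Ioo_mem_nhdsGT (one_pos : (0 : ℝ) < 1)] with t ht using hpath t ht
  have hst := ((hL.steep x hfr).comp hlim).eventually (eventually_gt_atTop (C / ρ))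
  obtain ⟨t, ht1, ht2⟩ := (hst.and (Ioo_mem_nhdsGT (one_pos : (0 : ℝ) < 1))).exists
  have := hbound t ht2
  rw [Function.comp_apply, div_lt_iff₀ hρ] at ht1
  linarith

end Legendre

/-! ### Lifting partial subgradients along an orthogonal projection -/

section PartialSubdiff

variable {E : Type*} [NormedAddCommGroup E] [InnerProductSpace ℝ E]

/-- Orthogonal projections, as symmetric idempotent operators. -/
structure IsOrthProj (P : E →L[ℝ] E) : Prop where
  symm : ∀ a b, inner ℝ (P a) b = inner ℝ a (P b)
  idem : ∀ a, P (P a) = P a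

lemma IsOrthProj.compl {P : E →L[ℝ] E} (hP : IsOrthProj P) :
    IsOrthProj (ContinuousLinearMap.id ℝ E - P) where
  symm a b := by simp [inner_sub_left, inner_sub_right, hP.symm]
  idem a := by simp [hP.idem]

lemma IsOrthProj.norm_le {P : E →L[ℝ] E} (hP : IsOrthProj P) (a : E) : ‖P a‖ ≤ ‖a‖ := by
  by_cases h : P a = 0
  · simp [h]
  · have h1 : ‖P a‖ * ‖P a‖ ≤ ‖a‖ * ‖P a‖ := by
      rw [← real_inner_self_eq_norm_mul_norm, hP.symm, hP.idem]
      exact real_inner_le_norm _ _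
    exact le_of_mul_le_mul_right h1 (norm_pos_iff.2 h)

lemma IsOrthProj.hasFDerivAt_norm_sq {P : E →L[ℝ] E} (hP : IsOrthProj P) [CompleteSpace E]
    (w u : E) : HasFDerivAt (fun u => ‖P (u - w)‖ ^ 2)
      (InnerProductSpace.toDual ℝ E ((2 : ℝ) • P (u - w))) u := by
  have h := (P.hasFDerivAt.comp u ((hasFDerivAt_id u).sub_const w)).norm_sq
  have e : InnerProductSpace.toDual ℝ E ((2 : ℝ) • P (u - w)) =
      2 • (innerSL ℝ) ((P ∘ fun x => id x - w) u) ∘SL (P ∘SL ContinuousLinearMap.id ℝ E) := by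
    ext d
    simp [InnerProductSpace.toDual_apply_apply, ← hP.symm, hP.idem]
  rw [e]
  exact h

lemma IsOrthProj.hasGradientAt_norm_sq {P : E →L[ℝ] E} (hP : IsOrthProj P) [CompleteSpace E]
    (n : ℝ) (w u : E) :
    HasGradientAt (fun u => n * ‖P (u - w)‖ ^ 2) ((2 * n) • P (u - w)) u := by
  rw [hasGradientAt_iff_hasFDerivAt]
  have h := (hP.hasFDerivAt_norm_sq w u).const_mul n
  have e : InnerProductSpace.toDual ℝ E ((2 * n) • P (u - w)) =
      n • InnerProductSpace.toDual ℝ E ((2 : ℝ) • P (u - w)) := by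
    ext d
    simp [InnerProductSpace.toDual_apply_apply]
    ring
  rw [e]
  exact h

lemma IsOrthProj.hasGradientAt_norm {P : E →L[ℝ] E} (hP : IsOrthProj P) [CompleteSpace E]
    (n : ℝ) {w u : E} (hne : P (u - w) ≠ 0) :
    HasGradientAt (fun u => n * ‖P (u - w)‖) ((n / ‖P (u - w)‖) • P (u - w)) u := by
  rw [hasGradientAt_iff_hasFDerivAt]
  have hpos : 0 < ‖P (u - w)‖ := norm_pos_iff.2 hne
  have h := ((hP.hasFDerivAt_norm_sq w u).sqrt (by positivity)).const_mul n
  simp only [Real.sqrt_sq (norm_nonneg _)] at h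
  have e : InnerProductSpace.toDual ℝ E ((n / ‖P (u - w)‖) • P (u - w)) =
      n • (1 / (2 * ‖P (u - w)‖)) • InnerProductSpace.toDual ℝ E ((2 : ℝ) • P (u - w)) := by
    ext d
    simp [InnerProductSpace.toDual_apply_apply]
    field_simp
  rw [e]
  exact h

lemma hasGradientAt_neg_inner [CompleteSpace E] (w z₀ u : E) :
    HasGradientAt (fun u => -inner ℝ w (u - z₀)) (-w) u := by
  rw [hasGradientAt_iff_hasFDerivAt, map_neg]
  have h := ((InnerProductSpace.toDual ℝ E w).hasFDerivAt.comp u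
    ((hasFDerivAt_id u).sub_const z₀)).neg
  exact h

/-- `w` is a Fréchet subgradient at `z₀` of the restriction of `J` to `z₀ + range P`. -/
def IsPartialFrechet (J : E → EReal) (P : E →L[ℝ] E) (z₀ w : E) : Prop :=
  P w = w ∧ ∀ ε : ℝ, 0 < ε → ∀ᶠ z in 𝓝 z₀, P (z - z₀) = z - z₀ → ∀ r s : ℝ, J z₀ = r → J z = s →
    r + (inner ℝ w (z - z₀) - ε * ‖z - z₀‖) ≤ s

/-- Partial Fréchet subgradients are approximated by projections of full ones. -/
lemma exists_fuzzy_partial [ProperSpace E] {J : E → EReal} (hJ : LowerSemicontinuous J)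
    (hJb : ∀ z, J z ≠ ⊥) {P : E →L[ℝ] E} (hP : IsOrthProj P) {z₀ w : E} {r : ℝ} (hr : J z₀ = r)
    (hw : IsPartialFrechet J P z₀ w) {ε : ℝ} (hε : 0 < ε) :
    ∃ z u : E, ∃ s : ℝ, ‖z - z₀‖ ≤ ε ∧ J z = s ∧ |s - r| ≤ ε ∧ u ∈ frechetSubdiff J z ∧
      ‖P u - w‖ ≤ ε := by
  obtain ⟨ρ, hρ, hball⟩ := Metric.nhds_basis_closedBall.eventually_iff.1
    ((hw.2 (ε / 4) (by positivity)).and (eventually_coe_sub_lt hJ hr hε))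
  -- The last term makes the linear part of `φ` at most `ε` on the ball, which gives the upper bound
  -- on the value `s`.
  set δ := min ρ (min ε (ε / (‖w‖ + 1))) with hδ
  have hδpos : 0 < δ := by positivity
  have hδε : δ ≤ ε := (min_le_right _ _).trans (min_le_left _ _)
  have hδw : ‖w‖ * δ ≤ ε := by
    have h1 : δ ≤ ε / (‖w‖ + 1) := (min_le_right _ _).trans (min_le_right _ _)
    rw [le_div_iff₀ (by positivity)] at h1
    nlinarith
  have hin := fun z (hz : z ∈ Metric.closedBall z₀ δ) =>
    hball (Metric.closedBall_subset_closedBall (min_le_left _ _) hz)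
  set κ := ε / 4 with hκ
  have hκpos : 0 < κ := by positivity
  -- On the slice through `z₀`, `J` is at least `r + inner ℝ w (z - z₀) - κ * ‖z - z₀‖`, so on the
  -- sphere of radius `δ` the sum `J + φ` is at least `r + κ * δ`. Leaving the slice is penalized
  -- through `Q`, whose contribution to the gradient is killed by `P`; the quadratic term
  -- contributes at most `4 * κ = ε`.
  let φ : E → ℝ := fun z => (2 * κ / δ) * ‖z - z₀‖ ^ 2 + -inner ℝ w (z - z₀)
  let Q := ContinuousLinearMap.id ℝ E - P
  have hQ : IsOrthProj Q := hP.compl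
  have hQ0 : ∀ a, Q a = 0 → P a = a := fun a ha =>
    (sub_eq_zero.1 (by simpa [Q] using ha)).symm
  obtain ⟨n, hn, z, ⟨hzK, hzU⟩, hle, hmn⟩ := exists_penalized_min
    (K := Metric.closedBall z₀ δ) (U := Metric.ball z₀ δ) (Ψ := fun z => J z + (φ z : ℝ))
    (P := fun z => ‖Q (z - z₀)‖ ^ 2) (z₀ := z₀) (isCompact_closedBall z₀ δ) Metric.isOpen_ball
    (lowerSemicontinuous_add_coe hJ (by fun_prop)) (fun z => add_coe_ne_bot (hJb z) _)
    (by fun_prop) (fun z => by positivity) (Metric.mem_closedBall_self hδpos.le) (by simp)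
    (by rw [hr, ← EReal.coe_add]; exact EReal.coe_ne_top _) (by
      intro z hz hPz hle
      have hQz : P (z - z₀) = z - z₀ := hQ0 _ (by simpa using hPz)
      by_cases hzt : J z = ⊤
      · simp only [hzt, hr, EReal.top_add_coe, ← EReal.coe_add] at hle
        exact absurd (top_le_iff.1 hle) (EReal.coe_ne_top _)
      · have hs := (EReal.coe_toReal hzt (hJb z)).symm
        have h1 := (hin z hz).1 hQz r _ hr hs
        simp only [hr] at hle
        rw [hs] at hle
        norm_cast at hle
        simp only [φ, sub_self, norm_zero, inner_zero_right] at hle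
        have hz' : ‖z - z₀‖ ≤ δ := by simpa [dist_eq_norm] using hz
        rw [Metric.mem_ball, dist_eq_norm]
        refine lt_of_le_of_ne hz' fun heq => ?_
        rw [heq] at h1 hle
        have h2 : 2 * κ / δ * δ ^ 2 = 2 * κ * δ := by field_simp
        have h3 : 0 < κ * δ := by positivity
        nlinarith)
  have hz' : ‖z - z₀‖ ≤ δ := by simpa [dist_eq_norm] using hzK
  have hzt : J z ≠ ⊤ := by
    intro hzt
    simp only [hzt, hr, EReal.top_add_coe, ← EReal.coe_add] at hle
    exact absurd (top_le_iff.1 hle) (EReal.coe_ne_top _)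
  have hs := (EReal.coe_toReal hzt (hJb z)).symm
  set s := (J z).toReal with hsdef
  have hlow := (hin z hzK).2
  rw [hs] at hlow
  norm_cast at hlow
  have hup : s ≤ r + ε := by
    simp only [hr] at hle
    rw [hs] at hle
    norm_cast at hle
    simp only [φ, sub_self, norm_zero, inner_zero_right] at hle
    have h1 := real_inner_le_norm w (z - z₀)
    have h2 : ‖w‖ * ‖z - z₀‖ ≤ ‖w‖ * δ := by gcongr
    have h3 : 0 ≤ 2 * κ / δ * ‖z - z₀‖ ^ 2 := by positivity
    linarith
  have hgrad : HasGradientAt (fun z => φ z + n * ‖Q (z - z₀)‖ ^ 2)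
      ((2 * (2 * κ / δ)) • (z - z₀) + -w + (2 * n) • Q (z - z₀)) z :=
    hasGradientAt_fun_add (hasGradientAt_fun_add (hasGradientAt_const_mul_norm_sub_sq _ z₀ z)
      (hasGradientAt_neg_inner w z₀ z)) (hQ.hasGradientAt_norm_sq n z₀ z)
  refine ⟨z, _, s, hz'.trans hδε, hs, abs_le.2 ⟨by linarith, by linarith⟩,
    neg_mem_frechetSubdiff_of_localMin hJb (lt_top_iff_ne_top.2 hzt) hgrad ?_, ?_⟩
  · filter_upwards [Metric.isOpen_ball.mem_nhds hzU] with z' hz'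
    have h := hmn z' (Metric.ball_subset_closedBall hz')
    rwa [add_assoc, add_assoc, ← EReal.coe_add, ← EReal.coe_add] at h
  · have hPQ : ∀ a, P (Q a) = 0 := fun a => by simp [Q, hP.idem]
    have e : P (-((2 * (2 * κ / δ)) • (z - z₀) + -w + (2 * n) • Q (z - z₀))) - w
        = -((2 * (2 * κ / δ)) • P (z - z₀)) := by
      rw [map_neg, map_add, map_add, map_smul, map_smul, hPQ, map_neg, hw.1]
      simp
    rw [e, norm_neg, norm_smul, Real.norm_of_nonneg (by positivity)]
    calc 2 * (2 * κ / δ) * ‖P (z - z₀)‖ ≤ 2 * (2 * κ / δ) * δ := by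
          gcongr
          exact (hP.norm_le _).trans hz'
      _ = ε := by rw [hκ]; field_simp; norm_num

/-- Partial limiting subgradients are projections of full limiting subgradients, under a horizon
condition. -/
lemma exists_mem_limSubdiff_proj_eq [ProperSpace E] {J : E → EReal}
    (hJ : LowerSemicontinuous J) (hJb : ∀ z, J z ≠ ⊥) {P : E →L[ℝ] E} (hP : IsOrthProj P)
    {z₀ w : E} {r : ℝ} (hr : J z₀ = r)
    (hhor : ∀ u ∈ horizonSubdiff J z₀, P u = 0 → u = 0)
    (hw : ∀ ε : ℝ, 0 < ε → ∃ z₁ w₁ : E, ∃ r₁ : ℝ, ‖z₁ - z₀‖ ≤ ε ∧ J z₁ = r₁ ∧ |r₁ - r| ≤ ε ∧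
      ‖w₁ - w‖ ≤ ε ∧ IsPartialFrechet J P z₁ w₁) :
    ∃ u ∈ limSubdiff J z₀, P u = w := by
  have hfz : ∀ n : ℕ, ∃ z u : E, ∃ s : ℝ, ‖z - z₀‖ ≤ 1 / ((n : ℝ) + 1) ∧ J z = s ∧
      |s - r| ≤ 1 / ((n : ℝ) + 1) ∧ u ∈ frechetSubdiff J z ∧ ‖P u - w‖ ≤ 1 / ((n : ℝ) + 1) := by
    intro n
    have hpos : 0 < 1 / ((n : ℝ) + 1) / 2 := by positivity
    obtain ⟨z₁, w₁, r₁, h1, h2, h3, h4, h5⟩ := hw _ hpos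
    obtain ⟨z, u, s, g1, g2, g3, g4, g5⟩ := exists_fuzzy_partial hJ hJb hP h2 h5 hpos
    refine ⟨z, u, s, ?_, g2, ?_, g4, ?_⟩
    · linarith [norm_sub_le_norm_sub_add_norm_sub z z₁ z₀]
    · linarith [abs_sub_le s r₁ r]
    · linarith [norm_sub_le_norm_sub_add_norm_sub (P u) w₁ w]
  choose z u s hz hs hsr hu hPu using hfz
  have hε : Tendsto (fun n : ℕ => 1 / ((n : ℝ) + 1)) atTop (𝓝 0) :=
    tendsto_one_div_add_atTop_nhds_zero_nat
  have hzlim : Tendsto z atTop (𝓝 z₀) := by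
    rw [tendsto_iff_norm_sub_tendsto_zero]
    exact squeeze_zero (fun n => norm_nonneg _) hz hε
  have hslim : Tendsto s atTop (𝓝 r) := by
    rw [tendsto_iff_norm_sub_tendsto_zero]
    exact squeeze_zero (fun n => norm_nonneg _) hsr hε
  have hJlim : Tendsto (fun n => J (z n)) atTop (𝓝 (J z₀)) := by
    rw [hr]
    exact ((continuous_coe_real_ereal.tendsto r).comp hslim).congr fun n => by simp [hs]
  have hPlim : Tendsto (fun n => P (u n)) atTop (𝓝 w) := by
    rw [tendsto_iff_norm_sub_tendsto_zero]
    exact squeeze_zero (fun n => norm_nonneg _) hPu hε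
  -- The projections `P (u n)` converge, so if `u n` blows up its limiting direction is a horizon
  -- subgradient in the kernel of `P`, which the hypothesis excludes.
  rcases exists_subseq_tendsto_or_direction u with ⟨c, φ, hφ, hlim⟩ |
    ⟨c, φ, hφ, hc, hpos, hinv, hlim⟩
  · refine ⟨c, ⟨mem_edom_of_eq_coe hr, z ∘ φ, u ∘ φ, hzlim.comp hφ.tendsto_atTop,
      hJlim.comp hφ.tendsto_atTop, fun n => hu _, hlim⟩, ?_⟩
    exact tendsto_nhds_unique ((P.continuous.tendsto c).comp hlim) (hPlim.comp hφ.tendsto_atTop)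
  · exfalso
    have h1 : c ∈ horizonSubdiff J z₀ :=
      ⟨mem_edom_of_eq_coe hr, z ∘ φ, u ∘ φ, fun n => ‖u (φ n)‖⁻¹, hzlim.comp hφ.tendsto_atTop,
        hJlim.comp hφ.tendsto_atTop, fun n => hu _, fun n => inv_pos.2 (hpos n), hinv, hlim⟩
    have h2 : P c = 0 := by
      refine tendsto_nhds_unique ((P.continuous.tendsto c).comp hlim) ?_
      have h3 := hinv.smul (hPlim.comp hφ.tendsto_atTop)
      rw [zero_smul] at h3
      exact h3.congr fun n => by simp
    simp [hhor c h1 h2] at hc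

/-- Under a horizon condition, the projection of the domain along `range P` is a neighbourhood. -/
lemma eventually_exists_mem_edom_of_horizon [ProperSpace E] {J : E → EReal}
    (hJ : LowerSemicontinuous J) (hJb : ∀ z, J z ≠ ⊥) {P : E →L[ℝ] E} (hP : IsOrthProj P)
    {z₀ : E} {r : ℝ} (hr : J z₀ = r)
    (hhor : ∀ u ∈ horizonSubdiff J z₀, P u = 0 → u = 0) :
    ∀ᶠ z₁ in 𝓝 z₀, ∃ z ∈ edom J, P (z - z₁) = z - z₁ := by
  by_contra hcon
  let Q := ContinuousLinearMap.id ℝ E - P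
  have hQ : IsOrthProj Q := hP.compl
  have hQ0 : ∀ a, Q a = 0 → P a = a := fun a ha =>
    (sub_eq_zero.1 (by simpa [Q] using ha)).symm
  have hPQ : ∀ a, P (Q a) = 0 := fun a => by simp [Q, hP.idem]
  have hQP : ∀ a, Q (P a) = 0 := fun a => by simp [Q, hP.idem]
  have hsplit : ∀ a, ‖a‖ ≤ ‖P a‖ + ‖Q a‖ := fun a => by
    have : a = P a + Q a := by simp [Q]
    conv_lhs => rw [this]
    exact norm_add_le _ _
  have hfz : ∀ ε : ℝ, 0 < ε → ∃ z u : E, ∃ s t : ℝ, ‖z - z₀‖ ≤ ε ∧ J z = s ∧ |s - r| ≤ ε ∧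
      u ∈ frechetSubdiff J z ∧ 0 < t ∧ t ≤ ε ∧ ‖Q (t • u)‖ = 1 ∧ ‖P (t • u)‖ ≤ ε := by
    intro ε hε
    obtain ⟨ρ, hρ, hball⟩ := Metric.nhds_basis_closedBall.eventually_iff.1
      (eventually_coe_sub_lt hJ hr hε)
    set δ := min ρ ε with hδ
    have hδpos : 0 < δ := by positivity
    have hδε : δ ≤ ε := min_le_right _ _
    have hin := fun z (hz : z ∈ Metric.closedBall z₀ δ) =>
      hball (Metric.closedBall_subset_closedBall (min_le_left _ _) hz)
    -- At the minimizer below, `φ z ≤ 2 * ε`. Thus `K` yields `‖P (z - z₀)‖ ≤ δ / 3`, and the three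
    -- terms of `n` yield, in order, `1 / n ≤ ε`, `‖Q (z - z₁)‖ ≤ δ / 4`, and a `P`-component of the
    -- rescaled subgradient of size at most `ε`. In particular the minimizer is interior to the
    -- ball.
    set K := 18 * ε / δ ^ 2 with hK
    have hKpos : 0 < K := by positivity
    set n := 1 / ε + 8 * ε / δ + 2 * K * δ / ε with hn
    have hnpos : 0 < n := by positivity
    have hn1 : 1 / ε ≤ n := by
      have : 0 < 8 * ε / δ := by positivity
      have : 0 < 2 * K * δ / ε := by positivity
      linarith
    have hn2 : 8 * ε / δ ≤ n := by
      have : 0 < 1 / ε := by positivity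
      have : 0 < 2 * K * δ / ε := by positivity
      linarith
    have hn3 : 2 * K * δ / ε ≤ n := by
      have : 0 < 1 / ε := by positivity
      have : 0 < 8 * ε / δ := by positivity
      linarith
    obtain ⟨z₁, hz₁, hz₁'⟩ : ∃ z₁, (¬ ∃ z ∈ edom J, P (z - z₁) = z - z₁) ∧
        z₁ ∈ Metric.ball z₀ (min (ε / n) (δ / 4)) :=
      ((not_eventually.1 hcon).and_eventually
        (Metric.ball_mem_nhds z₀ (by positivity))).exists
    rw [Metric.mem_ball, dist_eq_norm, lt_min_iff] at hz₁'
    have hQne : ∀ z ∈ edom J, Q (z - z₁) ≠ 0 := fun z hz h => hz₁ ⟨z, hz, hQ0 _ h⟩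
    -- The unsquared norm is essential: the slice through `z₁` misses the domain, so the norm is
    -- differentiable at the minimizer, and its gradient has length exactly `n`. After scaling by `1
    -- / n` the subgradients converge to a horizon subgradient `c` with `P c = 0` and `‖Q c‖ = 1`.
    let φ : E → ℝ := fun z => n * ‖Q (z - z₁)‖ + K * ‖P (z - z₀)‖ ^ 2
    have hlsc : LowerSemicontinuous fun z => J z + (φ z : ℝ) :=
      lowerSemicontinuous_add_coe hJ (by fun_prop)
    have hz₀m : z₀ ∈ Metric.closedBall z₀ δ := Metric.mem_closedBall_self hδpos.le
    obtain ⟨z, hzK, hzmin⟩ := (hlsc.lowerSemicontinuousOn _).exists_isMinOn ⟨z₀, hz₀m⟩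
      (isCompact_closedBall z₀ δ)
    have hle : J z + (φ z : ℝ) ≤ ((r + φ z₀ : ℝ) : EReal) := by
      have := hzmin hz₀m
      simp only [mem_ofPred_eq, hr] at this
      exact_mod_cast this
    have hzt : J z ≠ ⊤ := by
      intro hzt
      rw [hzt, EReal.top_add_coe] at hle
      exact absurd (top_le_iff.1 hle) (EReal.coe_ne_top _)
    have hs := (EReal.coe_toReal hzt (hJb z)).symm
    set s := (J z).toReal with hsdef
    have hlow := hin z hzK
    rw [hs] at hlow hle
    norm_cast at hlow hle
    have hφ0 : φ z₀ ≤ ε := by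
      have h1 : ‖Q (z₀ - z₁)‖ ≤ ε / n := by
        refine (hQ.norm_le _).trans ?_
        rw [norm_sub_rev]
        exact hz₁'.1.le
      have h2 : n * ‖Q (z₀ - z₁)‖ ≤ n * (ε / n) := by gcongr
      have h3 : n * (ε / n) = ε := by field_simp
      simp only [φ, sub_self, map_zero, norm_zero]
      linarith
    have hA : 0 ≤ n * ‖Q (z - z₁)‖ := by positivity
    have hB : 0 ≤ K * ‖P (z - z₀)‖ ^ 2 := by positivity
    have hφz : φ z = n * ‖Q (z - z₁)‖ + K * ‖P (z - z₀)‖ ^ 2 := rfl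
    have hQz : ‖Q (z - z₁)‖ ≤ δ / 4 := by
      have h1 : n * ‖Q (z - z₁)‖ ≤ 2 * ε := by linarith
      have h2 : 8 * ε / δ * ‖Q (z - z₁)‖ ≤ n * ‖Q (z - z₁)‖ := by gcongr
      have h3 : 8 * ε / δ * ‖Q (z - z₁)‖ ≤ 2 * ε := h2.trans h1
      have h4 : 8 * ε / δ * ‖Q (z - z₁)‖ = (2 * ε) * (4 * ‖Q (z - z₁)‖ / δ) := by
        field_simp; ring
      have h5 : 4 * ‖Q (z - z₁)‖ / δ ≤ 1 := by
        rw [h4] at h3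
        by_contra! hc
        nlinarith
      rw [div_le_one hδpos] at h5
      linarith
    have hPz : ‖P (z - z₀)‖ ≤ δ / 3 := by
      have h1 : K * ‖P (z - z₀)‖ ^ 2 ≤ 2 * ε := by linarith
      have h2 : K * ‖P (z - z₀)‖ ^ 2 = (2 * ε) * (3 * ‖P (z - z₀)‖ / δ) ^ 2 := by
        rw [hK]; field_simp; ring
      have h3 : (3 * ‖P (z - z₀)‖ / δ) ^ 2 ≤ 1 := by
        rw [h2] at h1
        by_contra! hc
        nlinarith
      have h4 : 3 * ‖P (z - z₀)‖ / δ ≤ 1 := by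
        by_contra! hc
        nlinarith
      rw [div_le_one hδpos] at h4
      linarith
    have hQz0 : ‖Q (z - z₀)‖ ≤ δ / 2 := by
      have e : Q (z - z₀) = Q (z - z₁) + Q (z₁ - z₀) := by rw [← map_add]; simp
      rw [e]
      have h1 := norm_add_le (Q (z - z₁)) (Q (z₁ - z₀))
      have h2 := hQ.norm_le (z₁ - z₀)
      linarith [hz₁'.2]
    have hzU : z ∈ Metric.ball z₀ δ := by
      rw [Metric.mem_ball, dist_eq_norm]
      linarith [hsplit (z - z₀)]
    have hzd : z ∈ edom J := lt_top_iff_ne_top.2 hzt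
    have hQzne := hQne z hzd
    have hQzpos : 0 < ‖Q (z - z₁)‖ := norm_pos_iff.2 hQzne
    have hgrad : HasGradientAt φ ((n / ‖Q (z - z₁)‖) • Q (z - z₁) + (2 * K) • P (z - z₀)) z :=
      hasGradientAt_fun_add (hQ.hasGradientAt_norm n hQzne) (hP.hasGradientAt_norm_sq K z₀ z)
    refine ⟨z, _, s, 1 / n, ?_, hs, ?_, neg_mem_frechetSubdiff_of_localMin hJb hzd hgrad ?_,
      by positivity, ?_, ?_, ?_⟩
    · rw [Metric.mem_ball, dist_eq_norm] at hzU
      linarith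
    · exact abs_le.2 ⟨by linarith, by linarith⟩
    · filter_upwards [Metric.isOpen_ball.mem_nhds hzU] with z' hz'
      exact hzmin (Metric.ball_subset_closedBall hz')
    · rw [div_le_iff₀ hnpos]
      rw [div_le_iff₀ hε] at hn1
      linarith
    · rw [map_smul, map_neg, map_add, map_smul, map_smul, hQP, hQ.idem, smul_zero, add_zero,
        smul_neg, norm_neg, norm_smul, norm_smul, Real.norm_of_nonneg (by positivity),
        Real.norm_of_nonneg (by positivity)]
      field_simp
    · rw [map_smul, map_neg, map_add, map_smul, map_smul, hPQ, hP.idem, smul_zero, zero_add,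
        smul_neg, norm_neg, norm_smul, norm_smul, Real.norm_of_nonneg (by positivity),
        Real.norm_of_nonneg (by positivity)]
      rw [div_le_iff₀ hε] at hn3
      have h1 : 2 * K * ‖P (z - z₀)‖ ≤ 2 * K * δ := by
        gcongr
        linarith
      rw [one_div, inv_mul_le_iff₀ hnpos]
      linarith
  choose z u s t hz hs hsr hu ht htε hQ1 hPε using
    fun n : ℕ => hfz _ (Nat.one_div_pos_of_nat (n := n) (α := ℝ))
  have hε : Tendsto (fun n : ℕ => 1 / ((n : ℝ) + 1)) atTop (𝓝 0) :=
    tendsto_one_div_add_atTop_nhds_zero_nat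
  have hzlim : Tendsto z atTop (𝓝 z₀) := by
    rw [tendsto_iff_norm_sub_tendsto_zero]
    exact squeeze_zero (fun n => norm_nonneg _) hz hε
  have hslim : Tendsto s atTop (𝓝 r) := by
    rw [tendsto_iff_norm_sub_tendsto_zero]
    exact squeeze_zero (fun n => norm_nonneg _) hsr hε
  have hJlim : Tendsto (fun n => J (z n)) atTop (𝓝 (J z₀)) := by
    rw [hr]
    exact ((continuous_coe_real_ereal.tendsto r).comp hslim).congr fun n => by simp [hs]
  have htlim : Tendsto t atTop (𝓝 0) := squeeze_zero (fun n => (ht n).le) htε hε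
  have hPlim : Tendsto (fun n => P (t n • u n)) atTop (𝓝 0) := squeeze_zero_norm hPε hε
  have hbd : ∀ n, t n • u n ∈ Metric.closedBall (0 : E) 2 := fun n => by
    have h1 := hsplit (t n • u n)
    have h2 : 1 / ((n : ℝ) + 1) ≤ 1 := by
      rw [div_le_one (by positivity)]
      linarith [(Nat.cast_nonneg n : (0 : ℝ) ≤ n)]
    rw [mem_closedBall_zero_iff]
    linarith [hQ1 n, hPε n]
  obtain ⟨c, -, φ, hφ, hlim⟩ := tendsto_subseq_of_bounded Metric.isBounded_closedBall hbd
  have h1 : c ∈ horizonSubdiff J z₀ :=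
    ⟨mem_edom_of_eq_coe hr, z ∘ φ, u ∘ φ, t ∘ φ, hzlim.comp hφ.tendsto_atTop,
      hJlim.comp hφ.tendsto_atTop, fun n => hu _, fun n => ht _, htlim.comp hφ.tendsto_atTop, hlim⟩
  have h2 : P c = 0 :=
    tendsto_nhds_unique ((P.continuous.tendsto c).comp hlim) (hPlim.comp hφ.tendsto_atTop)
  have h3 : ‖Q c‖ = 1 :=
    tendsto_nhds_unique ((continuous_norm.comp Q.continuous).tendsto c |>.comp hlim)
      (tendsto_const_nhds.congr fun n => (hQ1 (φ n)).symm)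
  rw [hhor c h1 h2, map_zero, norm_zero] at h3
  exact zero_ne_one h3

end PartialSubdiff

/-! ### A mean value argument for Fréchet subgradients -/

section SubgradientBound

variable {V : Type*} [NormedAddCommGroup V] [InnerProductSpace ℝ V]

/-- If a finite continuous function has at all points of a ball a Fréchet subgradient of norm at
most `R`, then all its Fréchet subgradients at the centre have norm at most `R`. -/
lemma norm_le_of_forall_exists_frechetSubdiff [ProperSpace V] {g : V → EReal}
    (hgb : ∀ z, g z ≠ ⊥) {y : V} {δ R : ℝ} (hδ : 0 < δ)
    (hfin : ∀ u ∈ Metric.closedBall y δ, g u ≠ ⊤)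
    (hcont : ContinuousOn (fun u => (g u).toReal) (Metric.closedBall y δ))
    (hsub : ∀ u ∈ Metric.closedBall y δ, ∃ w ∈ frechetSubdiff g u, ‖w‖ ≤ R) {w : V}
    (hw : w ∈ frechetSubdiff g y) : ‖w‖ ≤ R := by
  have hreal : ∀ u ∈ Metric.closedBall y δ, g u = (((g u).toReal : ℝ) : EReal) := fun u hu =>
    (EReal.coe_toReal (hfin u hu) (hgb u)).symm
  have hyB : y ∈ Metric.closedBall y δ := Metric.mem_closedBall_self hδ.le
  refine le_of_forall_gt_imp_ge_of_dense fun R' hR' => ?_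
  obtain ⟨R₀, hR₀, hR₀'⟩ : ∃ R₀, R < R₀ ∧ R₀ < R' := exists_between hR'
  obtain ⟨S, hS⟩ := (isCompact_closedBall y δ).bddAbove_image hcont
  obtain ⟨M, hM0, hM⟩ : ∃ M : ℝ, 0 ≤ M ∧ S - (g y).toReal < M * δ ^ 2 := by
    refine ⟨(|S - (g y).toReal| + 1) / δ ^ 2, by positivity, ?_⟩
    rw [div_mul_cancel₀ _ (by positivity)]
    linarith [le_abs_self (S - (g y).toReal)]
  have hR0 : 0 ≤ R := by
    obtain ⟨w', -, h⟩ := hsub y hyB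
    exact (norm_nonneg _).trans h
  have hc : ContinuousOn (fun u => (g u).toReal - (R₀ * ‖u - y‖ + M * ‖u - y‖ ^ 2))
      (Metric.closedBall y δ) := hcont.sub (by fun_prop)
  obtain ⟨u, huB, humax⟩ := (isCompact_closedBall y δ).exists_isMaxOn ⟨y, hyB⟩ hc
  have huδ : ‖u - y‖ ≤ δ := by simpa [dist_eq_norm] using huB
  -- At a maximizer `u ≠ y`, moving towards `y` stays in the ball. A subgradient of norm at most `R`
  -- lets `g` fall at a rate arbitrarily close to `R` at worst, while the subtracted term falls at
  -- rate at least `R₀ > R`, so the maximum would increase.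
  have huy : u = y := by
    by_contra hne
    have hpos : 0 < ‖u - y‖ := norm_pos_iff.2 (sub_ne_zero.2 hne)
    obtain ⟨w', hw', hw'R⟩ := hsub u huB
    have h1 := (mem_frechetSubdiff_iff hgb (hreal u huB)).1 hw' ((R₀ - R) / 2) (by linarith)
    have hlim : Tendsto (fun t : ℝ => u + t • (y - u)) (𝓝[>] 0) (𝓝 u) := by
      have : Tendsto (fun t : ℝ => u + t • (y - u)) (𝓝 0) (𝓝 (u + (0 : ℝ) • (y - u))) :=
        Continuous.tendsto (by fun_prop) 0
      simpa using this.mono_left nhdsWithin_le_nhds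
    obtain ⟨t, ht, ht0, ht1⟩ := ((hlim.eventually h1).and
      (Ioo_mem_nhdsGT (one_pos : (0 : ℝ) < 1))).exists
    set z := u + t • (y - u) with hz
    have ezy : z - y = (1 - t) • (u - y) := by
      rw [hz, sub_smul, one_smul, ← neg_sub u y, smul_neg]; abel
    have ezu : z - u = t • (y - u) := by rw [hz, add_sub_cancel_left]
    have hzy : ‖z - y‖ = (1 - t) * ‖u - y‖ := by
      rw [ezy, norm_smul, Real.norm_of_nonneg (by linarith)]
    have hzB : z ∈ Metric.closedBall y δ := by
      rw [mem_closedBall_iff_norm, hzy]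
      nlinarith
    have h2 := ht _ (hreal z hzB)
    have h3 : (g z).toReal - (R₀ * ‖z - y‖ + M * ‖z - y‖ ^ 2) ≤
      (g u).toReal - (R₀ * ‖u - y‖ + M * ‖u - y‖ ^ 2) := humax hzB
    rw [ezu, inner_smul_right, norm_smul, Real.norm_of_nonneg ht0.le, norm_sub_rev y u] at h2
    rw [hzy] at h3
    have h4 : -(R * ‖u - y‖) ≤ inner ℝ w' (y - u) := by
      have := abs_real_inner_le_norm w' (y - u)
      have h5 : ‖w'‖ * ‖y - u‖ ≤ R * ‖u - y‖ := by rw [norm_sub_rev]; gcongr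
      linarith [neg_abs_le (inner ℝ w' (y - u))]
    have h6 : M * ((1 - t) * ‖u - y‖) ^ 2 ≤ M * ‖u - y‖ ^ 2 := by
      gcongr
      nlinarith
    have h7 : t * -(R * ‖u - y‖) ≤ t * inner ℝ w' (y - u) := by gcongr
    have h8 : 0 < t * ‖u - y‖ := by positivity
    nlinarith
  subst huy
  have hupper : ∀ z ∈ Metric.closedBall u δ,
      (g z).toReal ≤ (g u).toReal + (R₀ * ‖z - u‖ + M * ‖z - u‖ ^ 2) := fun z hz => by
    have : (g z).toReal - (R₀ * ‖z - u‖ + M * ‖z - u‖ ^ 2) ≤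
      (g u).toReal - (R₀ * ‖u - u‖ + M * ‖u - u‖ ^ 2) := humax hz
    simp only [sub_self, norm_zero] at this
    linarith
  by_cases hw0 : w = 0
  · rw [hw0, norm_zero]; linarith
  have hwpos : 0 < ‖w‖ := norm_pos_iff.2 hw0
  have h1 := (mem_frechetSubdiff_iff hgb (hreal u huB)).1 hw ((R' - R₀) / 2) (by linarith)
  have hlim : Tendsto (fun t : ℝ => u + t • w) (𝓝[>] 0) (𝓝 u) := by
    have : Tendsto (fun t : ℝ => u + t • w) (𝓝 0) (𝓝 (u + (0 : ℝ) • w)) :=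
      Continuous.tendsto (by fun_prop) 0
    simpa using this.mono_left nhdsWithin_le_nhds
  -- For steps `t` below this threshold the quadratic term `M * (t * ‖w‖) ^ 2` uses at most half of
  -- the margin `R' - R₀`; the Fréchet error uses the other half.
  have hq : 0 < (R' - R₀) / 2 / ((M + 1) * ‖w‖) := by
    have : 0 < R' - R₀ := by linarith
    positivity
  obtain ⟨t, ⟨ht, htB⟩, ht0, ht1⟩ := (((hlim.eventually h1).and
    (hlim.eventually (Metric.closedBall_mem_nhds u hδ))).and (Ioo_mem_nhdsGT hq)).exists
  have h2 := ht _ (hreal _ htB)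
  have h3 := hupper _ htB
  rw [add_sub_cancel_left, norm_smul, Real.norm_of_nonneg ht0.le] at h2 h3
  rw [inner_smul_right, real_inner_self_eq_norm_sq] at h2
  rw [lt_div_iff₀ (by positivity)] at ht1
  have h4 : 0 < t * ‖w‖ := by positivity
  have h5 : (t * ‖w‖) * ‖w‖ ≤ (t * ‖w‖) * R' := by nlinarith
  exact le_of_mul_le_mul_left h5 h4

end SubgradientBound

variable {N : ℕ}

/-! ### Coordinate projections of the product space -/

section JointModel

/-- The projection `(x, y) ↦ (x, 0)`. -/
def projFst : Euc2 N →L[ℝ] Euc2 N :=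
  ((WithLp.prodContinuousLinearEquiv 2 ℝ (Euc N) (Euc N)).symm : Euc N × Euc N →L[ℝ] Euc2 N) ∘L
    (ContinuousLinearMap.inl ℝ (Euc N) (Euc N)) ∘L (WithLp.fstL 2 ℝ (Euc N) (Euc N))

/-- The projection `(x, y) ↦ (0, y)`. -/
def projSnd : Euc2 N →L[ℝ] Euc2 N :=
  ((WithLp.prodContinuousLinearEquiv 2 ℝ (Euc N) (Euc N)).symm : Euc N × Euc N →L[ℝ] Euc2 N) ∘L
    (ContinuousLinearMap.inr ℝ (Euc N) (Euc N)) ∘L (WithLp.sndL 2 ℝ (Euc N) (Euc N))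

lemma projFst_apply (z : Euc2 N) : projFst z = WithLp.toLp 2 (z.fst, 0) := rfl

lemma projSnd_apply (z : Euc2 N) : projSnd z = WithLp.toLp 2 (0, z.snd) := rfl

lemma isOrthProj_projFst : IsOrthProj (projFst (N := N)) where
  symm a b := by simp [projFst_apply, WithLp.prod_inner_apply]
  idem a := rfl

lemma isOrthProj_projSnd : IsOrthProj (projSnd (N := N)) where
  symm a b := by simp [projSnd_apply, WithLp.prod_inner_apply]
  idem a := rfl

lemma toLp_ext {z : Euc2 N} {a b : Euc N} (h1 : z.fst = a) (h2 : z.snd = b) :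
    z = WithLp.toLp 2 (a, b) := by
  subst h1 h2
  rfl

lemma fst_eq_zero_of_projFst {z : Euc2 N} (h : projFst z = 0) : z.fst = 0 :=
  congrArg (fun p : Euc2 N => p.fst) h

lemma snd_eq_zero_of_projSnd {z : Euc2 N} (h : projSnd z = 0) : z.snd = 0 :=
  congrArg (fun p : Euc2 N => p.snd) h

lemma continuous_toLp_prod {X : Type*} [TopologicalSpace X] {a b : X → Euc N} (ha : Continuous a)
    (hb : Continuous b) : Continuous fun t => (WithLp.toLp 2 (a t, b t) : Euc2 N) :=
  (WithLp.prod_continuous_toLp 2 _ _).comp (ha.prodMk hb)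

lemma tendsto_toLp_prod {X : Type*} {l : Filter X} {a b : X → Euc N} {a₀ b₀ : Euc N}
    (ha : Tendsto a l (𝓝 a₀)) (hb : Tendsto b l (𝓝 b₀)) :
    Tendsto (fun t => (WithLp.toLp 2 (a t, b t) : Euc2 N)) l (𝓝 (WithLp.toLp 2 (a₀, b₀))) :=
  ((WithLp.prod_continuous_toLp 2 _ _).tendsto _).comp (ha.prodMk_nhds hb)

lemma norm_toLp_zero_left (b : Euc N) : ‖(WithLp.toLp 2 (0, b) : Euc2 N)‖ = ‖b‖ := by
  simp

lemma norm_toLp_zero_right (a : Euc N) : ‖(WithLp.toLp 2 (a, 0) : Euc2 N)‖ = ‖a‖ := by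
  simp

lemma toLp_zero_add_toLp_zero (a b : Euc N) :
    (WithLp.toLp 2 (a, 0) : Euc2 N) + WithLp.toLp 2 (0, b) = WithLp.toLp 2 (a, b) :=
  toLp_ext (add_zero a) (zero_add b)

variable {m : Euc N → Euc N → EReal}

lemma snd_mem_frechetSubdiff {x y : Euc N} {u : Euc2 N}
    (hu : u ∈ frechetSubdiff (joint m) (WithLp.toLp 2 (x, y))) :
    u.snd ∈ frechetSubdiff (m x) y := by
  refine ⟨hu.1, fun ε hε => ?_⟩
  have hc : Tendsto (fun y' => (WithLp.toLp 2 (x, y') : Euc2 N)) (𝓝 y)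
      (𝓝 (WithLp.toLp 2 (x, y))) := tendsto_toLp_prod tendsto_const_nhds tendsto_id
  filter_upwards [hc.eventually (hu.2 ε hε)] with y' hy'
  have e : (WithLp.toLp 2 (x, y') : Euc2 N) - WithLp.toLp 2 (x, y) = WithLp.toLp 2 (0, y' - y) := by
    rw [← WithLp.toLp_sub]; simp
  rw [e, norm_toLp_zero_left, WithLp.prod_inner_apply] at hy'
  simpa [joint] using hy'

lemma isPartialFrechet_snd {x y w : Euc N}
    (hw : w ∈ frechetSubdiff (m x) y) :
    IsPartialFrechet (joint m) projSnd (WithLp.toLp 2 (x, y)) (WithLp.toLp 2 (0, w)) := by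
  refine ⟨rfl, fun ε hε => ?_⟩
  have hc : Tendsto (fun z : Euc2 N => z.snd) (𝓝 (WithLp.toLp 2 (x, y))) (𝓝 y) :=
    (WithLp.sndL 2 ℝ (Euc N) (Euc N)).continuous.tendsto _
  filter_upwards [hc.eventually (hw.2 ε hε)] with z hz hPz r s hr hs
  have h1 : z.fst - x = 0 := (congrArg (fun p : Euc2 N => p.fst) hPz).symm
  have h2 : z.fst = x := sub_eq_zero.1 h1
  have e : z - WithLp.toLp 2 (x, y) = WithLp.toLp 2 (0, z.snd - y) := toLp_ext h1 rfl
  rw [e, norm_toLp_zero_left, WithLp.prod_inner_apply]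
  have hr' : m x y = r := hr
  have hs' : m x z.snd = s := by rw [← h2]; exact hs
  rw [hr', hs'] at hz
  norm_cast at hz
  simpa using hz

lemma isPartialFrechet_fst {x y v : Euc N}
    (hv : v ∈ frechetSubdiff (fun x' => m x' y) x) :
    IsPartialFrechet (joint m) projFst (WithLp.toLp 2 (x, y)) (WithLp.toLp 2 (v, 0)) := by
  refine ⟨rfl, fun ε hε => ?_⟩
  have hc : Tendsto (fun z : Euc2 N => z.fst) (𝓝 (WithLp.toLp 2 (x, y))) (𝓝 x) :=
    (WithLp.fstL 2 ℝ (Euc N) (Euc N)).continuous.tendsto _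
  filter_upwards [hc.eventually (hv.2 ε hε)] with z hz hPz r s hr hs
  have h1 : z.snd - y = 0 := (congrArg (fun p : Euc2 N => p.snd) hPz).symm
  have h2 : z.snd = y := sub_eq_zero.1 h1
  have e : z - WithLp.toLp 2 (x, y) = WithLp.toLp 2 (z.fst - x, 0) := toLp_ext rfl h1
  rw [e, norm_toLp_zero_right, WithLp.prod_inner_apply]
  have hr' : m x y = r := hr
  have hs' : m z.fst y = s := by rw [← h2]; exact hs
  rw [hr', hs'] at hz
  norm_cast at hz
  simpa using hz

end JointModel

/-! ### Joint subgradients of the model with a small component in the centre -/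

section Regular

variable {f h : Euc N → EReal} {m : Euc N → Euc N → EReal} {Lu Ll : ℝ}

lemma ModelAssumption.model_ne_bot (hm : ModelAssumption f h m Lu Ll) (x y : Euc N) :
    m x y ≠ ⊥ :=
  hm.joint_proper.1 (WithLp.toLp 2 (x, y))

lemma ModelAssumption.model_lt_top (hm : ModelAssumption f h m Lu Ll) {x y : Euc N}
    (hx : x ∈ edom f) (hy : y ∈ edom f) : m x y < ⊤ := by
  have : x ∈ edom (fun x => m x y) := by rw [hm.joint_dom y hy]; exact hx
  exact this

lemma ModelAssumption.exists_model_eq_coe (hm : ModelAssumption f h m Lu Ll) {x y : Euc N}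
    (hx : x ∈ edom f) (hy : y ∈ edom f) : ∃ r : ℝ, m x y = r :=
  ⟨_, (EReal.coe_toReal (hm.model_lt_top hx hy).ne (hm.model_ne_bot x y)).symm⟩

/-- The horizon condition forces the domain to be open. -/
lemma isOpen_edom_of_horizonAndRegular (hm : ModelAssumption f h m Lu Ll)
    (hHR : HorizonAndRegular f m) : IsOpen (edom f) := by
  rw [isOpen_iff_mem_nhds]
  intro x hx
  obtain ⟨r, hr⟩ := hm.exists_model_eq_coe hx hx
  -- For `x'` near `x` the slice of points with first coordinate `x'` meets the domain of the joint
  -- model, and finiteness of the model anywhere on that slice forces `x' ∈ dom f`.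
  have hev := eventually_exists_mem_edom_of_horizon hm.joint_lsc hm.joint_proper.1
    isOrthProj_projSnd (z₀ := WithLp.toLp 2 (x, x)) (r := r) hr (fun u hu hPu => by
      have h0 := snd_eq_zero_of_projSnd hPu
      have e := toLp_ext (z := u) rfl h0
      rw [e] at hu
      rw [e, (hHR x hx x hx).2.1 _ hu]
      rfl)
  have hc : Tendsto (fun x' => (WithLp.toLp 2 (x', x) : Euc2 N)) (𝓝 x)
      (𝓝 (WithLp.toLp 2 (x, x))) := tendsto_toLp_prod tendsto_id tendsto_const_nhds
  filter_upwards [hc.eventually hev] with x' hx'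
  obtain ⟨z, hz, hPz⟩ := hx'
  have h1 : z.fst - x' = 0 := (congrArg (fun p : Euc2 N => p.fst) hPz).symm
  have h2 := hm.joint_dom_subset z.fst z.snd hz
  rwa [sub_eq_zero.1 h1] at h2

/-- Under the horizon condition and regularity, limiting partial subgradients in the centre are
Fréchet subgradients. -/
lemma mem_frechetSubdiff_snd_of_limSubdiff (hm : ModelAssumption f h m Lu Ll)
    (hHR : HorizonAndRegular f m) {x y w : Euc N} (hx : x ∈ edom f) (hy : y ∈ edom f)
    (hw : w ∈ limSubdiff (m x) y) : w ∈ frechetSubdiff (m x) y := by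
  obtain ⟨r, hr⟩ := hm.exists_model_eq_coe hx hy
  obtain ⟨u, hu, hPu⟩ := exists_mem_limSubdiff_proj_eq hm.joint_lsc hm.joint_proper.1
    isOrthProj_projSnd (z₀ := WithLp.toLp 2 (x, y)) (w := WithLp.toLp 2 (0, w)) (r := r) hr
    (fun u hu hPu => by
      have h0 := snd_eq_zero_of_projSnd hPu
      have e := toLp_ext (z := u) rfl h0
      rw [e] at hu
      rw [e, (hHR x hx y hy).2.1 _ hu]
      rfl)
    (fun ε hε => by
      obtain ⟨-, y', w', hy', hmy', hw', hww'⟩ := hw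
      have h1 : ∀ᶠ k in atTop, ‖y' k - y‖ < ε :=
        (tendsto_iff_norm_sub_tendsto_zero.1 hy').eventually (gt_mem_nhds hε)
      have h2 : ∀ᶠ k in atTop, ‖w' k - w‖ < ε :=
        (tendsto_iff_norm_sub_tendsto_zero.1 hww').eventually (gt_mem_nhds hε)
      have h3 : Tendsto (fun k => (m x (y' k)).toReal) atTop (𝓝 r) := by
        have := (EReal.tendsto_toReal (a := m x y) (by simp [hr]) (by simp [hr])).comp hmy'
        rw [hr, EReal.toReal_coe] at this
        exact this
      have h4 : ∀ᶠ k in atTop, ‖(m x (y' k)).toReal - r‖ < ε :=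
        (tendsto_iff_norm_sub_tendsto_zero.1 h3).eventually (gt_mem_nhds hε)
      obtain ⟨k, h1, h2, h4⟩ := (h1.and (h2.and h4)).exists
      refine ⟨WithLp.toLp 2 (x, y' k), WithLp.toLp 2 (0, w' k), (m x (y' k)).toReal, ?_,
        (EReal.coe_toReal (hw' k).1.ne (hm.model_ne_bot _ _)).symm, h4.le, ?_,
        isPartialFrechet_snd (hw' k)⟩
      · rw [← WithLp.toLp_sub, Prod.mk_sub_mk, sub_self, norm_toLp_zero_left]
        exact h1.le
      · rw [← WithLp.toLp_sub, Prod.mk_sub_mk, sub_self, norm_toLp_zero_left]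
        exact h2.le)
  -- Regularity turns the lift `u` into a joint Fréchet subgradient, and those do restrict to
  -- Fréchet subgradients in each variable.
  have h1 := limSubdiff_subset_frechetSubdiff hm.joint_proper.1 (hHR x hx y hy).2.2 hu
  have h2 : u.snd = w := congrArg (fun p : Euc2 N => p.snd) hPu
  rw [← h2]
  exact snd_mem_frechetSubdiff h1

lemma exists_mem_limSubdiff_of_subdiffNorm_le {V : Type*} [NormedAddCommGroup V]
    [InnerProductSpace ℝ V] {g : V → EReal} {y : V} {c ε : ℝ} (hc : 0 ≤ c) (hε : 0 < ε)
    (h : subdiffNorm g y ≤ ENNReal.ofReal c) : ∃ w ∈ limSubdiff g y, ‖w‖ ≤ c + ε := by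
  have h1 : subdiffNorm g y < ENNReal.ofReal (c + ε) :=
    h.trans_lt ((ENNReal.ofReal_lt_ofReal_iff (by positivity)).2 (by linarith))
  simp only [subdiffNorm, iInf_lt_iff, exists_prop] at h1
  obtain ⟨w, hw, hlt⟩ := h1
  refine ⟨w, hw, ?_⟩
  rw [← ofReal_norm, ENNReal.ofReal_lt_ofReal_iff (by positivity)] at hlt
  exact hlt.le

/-- Under the horizon condition, regularity and the bound on the variation with the model centre,
all Fréchet subgradients in the centre are small. -/
lemma norm_le_of_mem_frechetSubdiff_snd (hm : ModelAssumption f h m Lu Ll)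
    (hHR : HorizonAndRegular f m) {xbar : Euc N} {ρ c : ℝ} (hc : 0 < c)
    (hrel : ∀ x ∈ edom f ∩ Metric.ball xbar ρ, ∀ y ∈ edom f ∩ Metric.ball xbar ρ,
      subdiffNorm (m x) y ≤ ENNReal.ofReal (c * ‖x - y‖)) {x y w : Euc N}
    (hx : x ∈ edom f ∩ Metric.ball xbar ρ) (hy : y ∈ edom f ∩ Metric.ball xbar ρ)
    (hw : w ∈ frechetSubdiff (m x) y) : ‖w‖ ≤ c * ‖x - y‖ := by
  have hopen : IsOpen (edom f ∩ Metric.ball xbar ρ) :=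
    (isOpen_edom_of_horizonAndRegular hm hHR).inter Metric.isOpen_ball
  obtain ⟨δ₀, hδ₀, hsub⟩ := Metric.nhds_basis_closedBall.mem_iff.1 (hopen.mem_nhds hy)
  refine le_of_forall_pos_le_add fun ε hε => ?_
  -- Moving the centre by at most `δ` changes the bound `c * ‖x - u‖` by at most `ε / 2`; the other
  -- `ε / 2` pays for choosing a subgradient close to the infimum.
  set δ := min δ₀ (ε / (2 * c)) with hδ
  have hδpos : 0 < δ := by positivity
  have hδc : c * δ ≤ ε / 2 := by
    have h1 : δ ≤ ε / (2 * c) := min_le_right _ _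
    rw [le_div_iff₀ (by positivity)] at h1
    linarith
  have hB : Metric.closedBall y δ ⊆ edom f ∩ Metric.ball xbar ρ :=
    (Metric.closedBall_subset_closedBall (min_le_left _ _)).trans hsub
  refine norm_le_of_forall_exists_frechetSubdiff (hm.model_ne_bot x) hδpos
    (fun u hu => (hm.model_lt_top hx.1 (hB hu).1).ne) ?_ ?_ hw
  · intro u hu
    have h1 : ContinuousWithinAt (fun y' => m x y') (Metric.closedBall y δ) u := by
      have h2 := hm.joint_cont (WithLp.toLp 2 (x, u)) ⟨hx.1, (hB hu).1⟩
      refine Tendsto.comp (f := fun y' => WithLp.toLp 2 (x, y')) h2.tendsto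
        (tendsto_nhdsWithin_iff.2 ⟨?_, ?_⟩)
      · exact tendsto_toLp_prod tendsto_const_nhds (tendsto_id.mono_left nhdsWithin_le_nhds)
      · filter_upwards [self_mem_nhdsWithin] with y' hy'
        exact ⟨hx.1, (hB hy').1⟩
    exact (EReal.tendsto_toReal (hm.model_lt_top hx.1 (hB hu).1).ne
      (hm.model_ne_bot _ _)).comp h1.tendsto
  · intro u hu
    obtain ⟨w', hw', hle⟩ := exists_mem_limSubdiff_of_subdiffNorm_le (by positivity)
      (half_pos hε) (hrel x hx u (hB hu))
    refine ⟨w', mem_frechetSubdiff_snd_of_limSubdiff hm hHR hx.1 (hB hu).1 hw', hle.trans ?_⟩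
    have h1 : ‖y - u‖ ≤ δ := by rw [norm_sub_rev]; simpa [dist_eq_norm] using hu
    have h2 : ‖x - u‖ ≤ ‖x - y‖ + ‖y - u‖ := norm_sub_le_norm_sub_add_norm_sub x y u
    nlinarith

/-- A partial Fréchet subgradient of the model extends to a joint limiting subgradient whose
component in the centre is small. -/
lemma exists_joint_limSubdiff (hm : ModelAssumption f h m Lu Ll) {xbar : Euc N} {ρ c : ℝ}
    (hc : 0 < c)
    (hrel : ∀ x ∈ edom f ∩ Metric.ball xbar ρ, ∀ y ∈ edom f ∩ Metric.ball xbar ρ,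
      subdiffNorm (m x) y ≤ ENNReal.ofReal (c * ‖x - y‖)) {x y v : Euc N}
    (hx : x ∈ edom f ∩ Metric.ball xbar ρ) (hy : y ∈ edom f ∩ Metric.ball xbar ρ)
    (hv : v ∈ frechetSubdiff (fun x' => m x' y) x) {ε : ℝ} (hε : 0 < ε) :
    ∃ w : Euc N, WithLp.toLp 2 (v, w) ∈ limSubdiff (joint m) (WithLp.toLp 2 (x, y)) ∧
      ‖w‖ ≤ c * ‖x - y‖ + ε := by
  -- With regularity, `v` is lifted to a joint subgradient whose second component is automatically
  -- small. With separability, any small second component may be paired with `v`.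
  rcases hm.joint_subdiff with hHR | hsep
  · obtain ⟨r, hr⟩ := hm.exists_model_eq_coe hx.1 hy.1
    obtain ⟨u, hu, hPu⟩ := exists_mem_limSubdiff_proj_eq hm.joint_lsc hm.joint_proper.1
      isOrthProj_projFst (z₀ := WithLp.toLp 2 (x, y)) (w := WithLp.toLp 2 (v, 0)) (r := r) hr
      (fun u hu hPu => by
        have h0 := fst_eq_zero_of_projFst hPu
        have e := toLp_ext (z := u) h0 rfl
        rw [e] at hu
        rw [e, (hHR x hx.1 y hy.1).1 _ hu]
        rfl)
      (fun ε' hε' => ⟨WithLp.toLp 2 (x, y), _, r, by simpa using hε'.le, hr, by simpa using hε'.le,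
        by simpa using hε'.le, isPartialFrechet_fst hv⟩)
    have h1 : u.fst = v := congrArg (fun p : Euc2 N => p.fst) hPu
    refine ⟨u.snd, by rw [← toLp_ext (z := u) h1 rfl]; exact hu, ?_⟩
    have h2 := snd_mem_frechetSubdiff
      (limSubdiff_subset_frechetSubdiff hm.joint_proper.1 (hHR x hx.1 y hy.1).2.2 hu)
    linarith [norm_le_of_mem_frechetSubdiff_snd hm hHR hc hrel hx hy h2]
  · obtain ⟨w, hw, hle⟩ := exists_mem_limSubdiff_of_subdiffNorm_le (by positivity) hε
      (hrel x hx y hy)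
    refine ⟨w, ?_, hle⟩
    rw [(hsep x hx.1 y hy.1).1]
    exact ⟨frechetSubdiff_subset_limSubdiff _ _ hv, hw⟩

end Regular

/-! ### Bregman distances: convexity, semicontinuity and joint gradient -/

section Bregman

/-- The real value of the Bregman distance on `dom h × int dom h`. -/
def bregmanReal (h : Euc N → EReal) (x y : Euc N) : ℝ :=
  (h x).toReal - (h y).toReal - inner ℝ (grad h y) (x - y)

variable {h : Euc N → EReal}

lemma bregman_of_eq_coe {x y : Euc N} {s : ℝ} (hy : y ∈ interior (edom h)) (hs : h x = s) :
    bregman h x y = ((bregmanReal h x y : ℝ) : EReal) := by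
  rw [bregman, if_pos hy, bregmanReal, hs, EReal.toReal_coe, ← EReal.coe_sub]
  congr 1
  ring

lemma bregman_of_mem (hL : IsLegendre h) {x y : Euc N} (hx : x ∈ edom h)
    (hy : y ∈ interior (edom h)) : bregman h x y = ((bregmanReal h x y : ℝ) : EReal) := by
  obtain ⟨s, hs⟩ := exists_real_of_mem_edom hL.proper.1 hx
  exact bregman_of_eq_coe hy hs

lemma bregman_of_eq_top {x y : Euc N} (hx : h x = ⊤) : bregman h x y = ⊤ := by
  unfold bregman
  split_ifs
  · rw [hx, EReal.top_sub_coe]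
  · rfl

lemma bregmanReal_self (x : Euc N) : bregmanReal h x x = 0 := by simp [bregmanReal]

lemma bregmanReal_nonneg (hL : IsLegendre h) {x y : Euc N} (hx : x ∈ edom h)
    (hy : y ∈ interior (edom h)) : 0 ≤ bregmanReal h x y := by
  have := gradient_inequality hL hy hx
  unfold bregmanReal
  linarith

lemma coe_mul_bregman_ne_bot (hL : IsLegendre h) {c : ℝ} (hc : 0 < c) (x y : Euc N) :
    (c : EReal) * bregman h x y ≠ ⊥ := by
  by_cases hy : y ∈ interior (edom h)
  · by_cases hx : h x = ⊤
    · rw [bregman_of_eq_top hx, EReal.coe_mul_top_of_pos hc]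
      simp
    · rw [bregman_of_mem hL (lt_top_iff_ne_top.2 hx) hy, ← EReal.coe_mul]
      exact EReal.coe_ne_bot _
  · rw [bregman, if_neg hy, EReal.coe_mul_top_of_pos hc]
    simp

lemma edom_coe_mul_bregman (hL : IsLegendre h) {c : ℝ} (hc : 0 < c) {y : Euc N}
    (hy : y ∈ interior (edom h)) : edom (fun z => (c : EReal) * bregman h z y) = edom h := by
  ext z
  by_cases hz : h z = ⊤
  · simp [edom, bregman_of_eq_top hz, EReal.coe_mul_top_of_pos hc, hz]
  · have hz' : z ∈ edom h := lt_top_iff_ne_top.2 hz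
    simp only [hz', iff_true]
    refine mem_edom_of_eq_coe (r := c * bregmanReal h z y) ?_
    rw [bregman_of_mem hL hz' hy, EReal.coe_mul]

lemma lowerSemicontinuous_coe_mul_bregman (hL : IsLegendre h) {c : ℝ} (hc : 0 < c) {y : Euc N}
    (hy : y ∈ interior (edom h)) :
    LowerSemicontinuous (fun z => (c : EReal) * bregman h z y) := by
  have hmul : Continuous fun a : EReal => (c : EReal) * a := by
    have hc0 : (c : EReal) ≠ 0 := by exact_mod_cast hc.ne'
    refine continuous_iff_continuousAt.2 fun a => ?_
    have := EReal.continuousAt_mul (p := ((c : EReal), a)) (Or.inl hc0) (Or.inl hc0)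
      (Or.inl (EReal.coe_ne_bot _)) (Or.inl (EReal.coe_ne_top _))
    exact this.comp (f := fun a => ((c : EReal), a)) (by fun_prop)
  have hmono : Monotone fun a : EReal => (c : EReal) * a := fun a b hab =>
    mul_le_mul_of_nonneg_left hab (by exact_mod_cast hc.le)
  have hb : LowerSemicontinuous fun z => bregman h z y := by
    have e : (fun z => bregman h z y) = fun z => h z +
        ((-((h y).toReal + inner ℝ (grad h y) (z - y)) : ℝ) : EReal) := by
      funext z
      rw [bregman, if_pos hy, EReal.coe_neg, sub_eq_add_neg]
    rw [e]
    exact lowerSemicontinuous_add_coe hL.lsc (by fun_prop)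
  exact hmul.comp_lowerSemicontinuous hb hmono

lemma convexOn_coe_mul_bregman (hL : IsLegendre h) {c : ℝ} (hc : 0 < c) {y : Euc N}
    (hy : y ∈ interior (edom h)) :
    ConvexOn ℝ (edom fun z => (c : EReal) * bregman h z y)
      (fun z => ((c : EReal) * bregman h z y).toReal) := by
  rw [edom_coe_mul_bregman hL hc hy]
  have hval : ∀ z ∈ edom h, ((c : EReal) * bregman h z y).toReal = c * bregmanReal h z y := by
    intro z hz
    rw [bregman_of_mem hL hz hy, ← EReal.coe_mul, EReal.toReal_coe]
  refine ⟨hL.convexOn.1, fun a ha b hb s t hs ht hst => ?_⟩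
  have h1 := hL.convexOn.2 ha hb hs ht hst
  have hmem := hL.convexOn.1 ha hb hs ht hst
  simp only [smul_eq_mul] at h1 ⊢
  rw [hval _ hmem, hval _ ha, hval _ hb]
  have h2 : bregmanReal h (s • a + t • b) y ≤ s * bregmanReal h a y + t * bregmanReal h b y := by
    have e : s • a + t • b - y = s • (a - y) + t • (b - y) := by
      rw [smul_sub, smul_sub]
      have : y = s • y + t • y := by rw [← add_smul, hst, one_smul]
      nth_rw 1 [this]
      abel
    have hcst : (h y).toReal = s * (h y).toReal + t * (h y).toReal := by
      rw [← add_mul, hst, one_mul]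
    unfold bregmanReal
    rw [e, inner_add_right, inner_smul_right, inner_smul_right]
    nlinarith
  nlinarith

lemma hasGradientAt_bregmanReal_left (hL : IsLegendre h) (c : ℝ) {x y : Euc N}
    (hx : x ∈ interior (edom h)) :
    HasGradientAt (fun z => c * bregmanReal h z y) (c • (grad h x - grad h y)) x := by
  have h1 := hasGradientAt_grad hL hx
  rw [hasGradientAt_iff_hasFDerivAt] at h1 ⊢
  have h2 := ((h1.sub_const (h y).toReal).sub
    ((InnerProductSpace.toDual ℝ (Euc N) (grad h y)).hasFDerivAt.comp x
      ((hasFDerivAt_id x).sub_const y))).const_mul c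
  have e : InnerProductSpace.toDual ℝ (Euc N) (c • (grad h x - grad h y)) =
      c • (InnerProductSpace.toDual ℝ (Euc N) (grad h x) -
        InnerProductSpace.toDual ℝ (Euc N) (grad h y) ∘SL ContinuousLinearMap.id ℝ (Euc N)) := by
    ext d
    simp
  rw [e]
  exact h2

lemma contDiffOn_grad (hC : ContDiffOn ℝ 2 (fun x => (h x).toReal) (interior (edom h))) :
    ContDiffOn ℝ 1 (grad h) (interior (edom h)) := by
  have h1 := hC.fderiv_of_isOpen (m := 1) isOpen_interior (by norm_num)
  exact (InnerProductSpace.toDual ℝ (Euc N)).symm.toContinuousLinearEquiv.contDiff.comp_contDiffOn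
    h1

/-- The joint gradient of the Bregman distance. -/
def bregmanGrad (h : Euc N → EReal) (z : Euc2 N) : Euc2 N :=
  WithLp.toLp 2 (grad h z.fst - grad h z.snd,
    -(ContinuousLinearMap.adjoint (fderiv ℝ (grad h) z.snd) (z.fst - z.snd)))

/-- Differentiating in the second variable, the two terms with `grad h y` cancel and only the
derivative of `grad h` remains. It acts on the increment inside an inner product with `x - y`, hence
the adjoint. -/
lemma hasGradientAt_bregmanReal (hL : IsLegendre h)
    (hC : ContDiffOn ℝ 2 (fun x => (h x).toReal) (interior (edom h))) (c : ℝ) {z : Euc2 N}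
    (hx : z.fst ∈ interior (edom h)) (hy : z.snd ∈ interior (edom h)) :
    HasGradientAt (fun z : Euc2 N => c * bregmanReal h z.fst z.snd) (c • bregmanGrad h z) z := by
  have h1 := hasGradientAt_grad hL hx
  have h2 := hasGradientAt_grad hL hy
  rw [hasGradientAt_iff_hasFDerivAt] at h1 h2 ⊢
  have h3 : HasFDerivAt (grad h) (fderiv ℝ (grad h) z.snd) z.snd :=
    (((contDiffOn_grad hC).differentiableOn (by norm_num) _ hy).differentiableAt
      (isOpen_interior.mem_nhds hy)).hasFDerivAt
  have hf : HasFDerivAt (fun z : Euc2 N => z.fst) (WithLp.fstL 2 ℝ (Euc N) (Euc N)) z :=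
    (WithLp.fstL 2 ℝ (Euc N) (Euc N)).hasFDerivAt
  have hs : HasFDerivAt (fun z : Euc2 N => z.snd) (WithLp.sndL 2 ℝ (Euc N) (Euc N)) z :=
    (WithLp.sndL 2 ℝ (Euc N) (Euc N)).hasFDerivAt
  have h4 := (((h1.comp z hf).sub (h2.comp z hs)).sub
    ((h3.comp z hs).inner ℝ (hf.sub hs))).const_mul c
  refine h4.congr_fderiv ?_
  ext d
  change c * (inner ℝ (grad h z.fst) d.fst - inner ℝ (grad h z.snd) d.snd -
    (inner ℝ (grad h z.snd) (d.fst - d.snd) +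
      inner ℝ (fderiv ℝ (grad h) z.snd d.snd) (z.fst - z.snd))) =
    inner ℝ (c • bregmanGrad h z) d
  rw [inner_smul_left, WithLp.prod_inner_apply, conj_trivial]
  change _ = c * (inner ℝ (grad h z.fst - grad h z.snd) d.fst + inner ℝ
    (-(ContinuousLinearMap.adjoint (fderiv ℝ (grad h) z.snd) (z.fst - z.snd))) d.snd)
  rw [inner_neg_left, ContinuousLinearMap.adjoint_inner_left, real_inner_comm (z.fst - z.snd), inner_sub_left (grad h z.fst), inner_sub_right]
  ring

lemma continuousAt_bregmanGrad
    (hC : ContDiffOn ℝ 2 (fun x => (h x).toReal) (interior (edom h))) {z : Euc2 N}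
    (hx : z.fst ∈ interior (edom h)) (hy : z.snd ∈ interior (edom h)) :
    ContinuousAt (bregmanGrad h) z := by
  have hf : ContinuousAt (fun z : Euc2 N => z.fst) z :=
    (WithLp.fstL 2 ℝ (Euc N) (Euc N)).continuous.continuousAt
  have hs : ContinuousAt (fun z : Euc2 N => z.snd) z :=
    (WithLp.sndL 2 ℝ (Euc N) (Euc N)).continuous.continuousAt
  have hg := contDiffOn_grad hC
  have h1 : ContinuousAt (grad h) z.fst :=
    (hg.continuousOn _ hx).continuousAt (isOpen_interior.mem_nhds hx)
  have h2 : ContinuousAt (grad h) z.snd :=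
    (hg.continuousOn _ hy).continuousAt (isOpen_interior.mem_nhds hy)
  have h3 : ContinuousAt (fderiv ℝ (grad h)) z.snd :=
    (hg.continuousOn_fderiv_of_isOpen isOpen_interior le_rfl _ hy).continuousAt
      (isOpen_interior.mem_nhds hy)
  refine tendsto_toLp_prod ?_ ?_
  · exact (h1.tendsto.comp hf).sub (h2.tendsto.comp hs)
  · have h4 : Tendsto (fun z' : Euc2 N =>
        ContinuousLinearMap.adjoint (fderiv ℝ (grad h) z'.snd)) (𝓝 z)
        (𝓝 (ContinuousLinearMap.adjoint (fderiv ℝ (grad h) z.snd))) :=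
      (ContinuousLinearMap.adjoint.continuous.tendsto _).comp (h3.tendsto.comp hs)
    exact (ContinuousAt.clm_apply h4 (hf.sub hs)).neg

end Bregman

/-! ### One proximal step: interiority, descent and relative error -/

section Step

variable {f h : Euc N → EReal} {m : Euc N → Euc N → EReal} {Lu Ll : ℝ}

/-- The proximal step stays in `dom f ∩ int dom h`. -/
lemma mem_of_isMinOn_step (hm : ModelAssumption f h m Lu Ll)
    {y x : Euc N} {τ : ℝ} (hτ : 0 < τ) (hy : y ∈ edom f ∩ interior (edom h))
    (hmin : IsMinOn (fun z => m z y + ((1 / τ : ℝ) : EReal) * bregman h z y) univ x) :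
    x ∈ edom f ∩ interior (edom h) := by
  have hL := hm.legendre
  have hc : 0 < 1 / τ := by positivity
  have hmin' : ∀ z, m x y + ((1 / τ : ℝ) : EReal) * bregman h x y ≤
      m z y + ((1 / τ : ℝ) : EReal) * bregman h z y := fun z => hmin (mem_univ z)
  obtain ⟨r, hr⟩ := hm.exists_model_eq_coe hy.1 hy.1
  have hfin : m x y + ((1 / τ : ℝ) : EReal) * bregman h x y < ⊤ := by
    refine (hmin' y).trans_lt ?_
    rw [hr, bregman_of_mem hL (interior_subset hy.2) hy.2, ← EReal.coe_mul, ← EReal.coe_add]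
    exact EReal.coe_lt_top _
  have hk : ((1 / τ : ℝ) : EReal) * bregman h x y ≠ ⊥ := coe_mul_bregman_ne_bot hL hc x y
  have hmx : m x y ≠ ⊤ := by
    intro htop
    rw [htop, EReal.top_add_of_ne_bot hk] at hfin
    exact lt_irrefl _ hfin
  have hkx : ((1 / τ : ℝ) : EReal) * bregman h x y ≠ ⊤ := by
    intro htop
    rw [htop, EReal.add_top_of_ne_bot (hm.model_ne_bot x y)] at hfin
    exact lt_irrefl _ hfin
  have hxf : x ∈ edom f := hm.joint_dom_subset x y (lt_top_iff_ne_top.2 hmx)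
  have hxh : x ∈ edom h := by
    rw [← edom_coe_mul_bregman hL hc hy.2]
    exact lt_top_iff_ne_top.2 hkx
  refine ⟨hxf, ?_⟩
  have hmlsc : LowerSemicontinuous fun z => m z y := by
    have := hm.joint_lsc.comp (continuous_toLp_prod continuous_id (continuous_const (y := y)))
    exact this
  obtain ⟨p, hp⟩ := exists_convex_subgradient_of_isMin (g := fun z => m z y)
    (k := fun z => ((1 / τ : ℝ) : EReal) * bregman h z y) hmlsc (fun z => hm.model_ne_bot z y)
    (lowerSemicontinuous_coe_mul_bregman hL hc hy.2) (fun z => coe_mul_bregman_ne_bot hL hc z y)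
    (convexOn_coe_mul_bregman hL hc hy.2) (EReal.coe_toReal hmx (hm.model_ne_bot x y)).symm
    (b := 1 / τ * bregmanReal h x y)
    (by rw [bregman_of_mem hL hxh hy.2, EReal.coe_mul]) hmin'
    (by
      rw [edom_coe_mul_bregman hL hc hy.2]
      exact (hm.qualification y hy x ⟨hxf, hxh⟩).subset)
  obtain ⟨b, hb⟩ := exists_real_of_mem_edom hL.proper.1 hxh
  -- The Bregman term is `h` scaled by `1 / τ` plus an affine function; undoing both turns `p` into
  -- this subgradient of `h` itself.
  refine mem_interior_of_convex_subgradient hL (p := τ • p + grad h y) hb fun z s hs => ?_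
  have h1 := hp z (1 / τ * bregmanReal h z y) (by
    rw [bregman_of_eq_coe hy.2 hs, EReal.coe_mul])
  have h2 : bregmanReal h x y + τ * inner ℝ p (z - x) ≤ bregmanReal h z y := by
    have := mul_le_mul_of_nonneg_left h1 hτ.le
    calc _ = τ * (1 / τ * bregmanReal h x y + inner ℝ p (z - x)) := by field_simp
      _ ≤ _ := this
      _ = _ := by field_simp
  simp only [bregmanReal, hb, hs, EReal.toReal_coe] at h2
  have e : inner ℝ (grad h y) (z - y) = inner ℝ (grad h y) (z - x) + inner ℝ (grad h y) (x - y) := by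
    rw [← inner_add_right]; simp
  rw [inner_add_left, inner_smul_left, conj_trivial]
  linarith

/-- First order optimality condition of the proximal step. -/
lemma step_subgradient (hm : ModelAssumption f h m Lu Ll) {y x : Euc N} {τ : ℝ}
    (hy : y ∈ edom f ∩ interior (edom h)) (hx : x ∈ edom f ∩ interior (edom h))
    (hmin : IsMinOn (fun z => m z y + ((1 / τ : ℝ) : EReal) * bregman h z y) univ x) :
    -((1 / τ) • (grad h x - grad h y)) ∈ frechetSubdiff (fun x' => m x' y) x := by
  have hL := hm.legendre
  refine neg_mem_frechetSubdiff_of_localMin (fun z => hm.model_ne_bot z y)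
    (hm.model_lt_top hx.1 hy.1) (hasGradientAt_bregmanReal_left hL (1 / τ) hx.2) ?_
  filter_upwards [isOpen_interior.mem_nhds hx.2] with z hz
  have h1 := hmin (mem_univ z)
  simp only [mem_ofPred_eq] at h1
  rwa [bregman_of_mem hL (interior_subset hx.2) hy.2, bregman_of_mem hL (interior_subset hz) hy.2,
    ← EReal.coe_mul, ← EReal.coe_mul] at h1

/-- The growth function bounding the model error vanishes at distance `0`. -/
lemma model_self (hm : ModelAssumption f h m Lu Ll) {y : Euc N}
    (hy : y ∈ edom f ∩ interior (edom h)) : (m y y).toReal = (f y).toReal := by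
  obtain ⟨-, ω, hω, hle⟩ := hm.model y hy
  have h1 := hle y hy.1
  rw [sub_self, norm_zero, hω.map_zero] at h1
  have := abs_nonpos_iff.1 h1
  linarith

/-- The real values of the Lyapunov function. -/
def lyapunovReal (h : Euc N → EReal) (m : Euc N → Euc N → EReal) (Lu : ℝ) (x y : Euc N) : ℝ :=
  (m x y).toReal + Lu * bregmanReal h x y

lemma lyapunov_eq_add (hm : ModelAssumption f h m Lu Ll) {z : Euc2 N}
    (hx : z.fst ∈ edom h) (hy : z.snd ∈ interior (edom h)) :
    lyapunov h m Lu z = joint m z + ((Lu * bregmanReal h z.fst z.snd : ℝ) : EReal) := by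
  rw [lyapunov, bregman_of_mem hm.legendre hx hy, EReal.coe_mul]
  rfl

lemma lyapunov_eq_coe (hm : ModelAssumption f h m Lu Ll) {x y : Euc N}
    (hx : x ∈ edom f ∩ edom h) (hy : y ∈ edom f ∩ interior (edom h)) :
    lyapunov h m Lu (WithLp.toLp 2 (x, y)) = ((lyapunovReal h m Lu x y : ℝ) : EReal) := by
  obtain ⟨r, hr⟩ := hm.exists_model_eq_coe hx.1 hy.1
  rw [lyapunov_eq_add hm (z := WithLp.toLp 2 (x, y)) hx.2 hy.2, lyapunovReal, hr,
    EReal.toReal_coe, EReal.coe_add]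
  congr 1

lemma lyapunov_ne_bot (hm : ModelAssumption f h m Lu Ll) (z : Euc2 N) :
    lyapunov h m Lu z ≠ ⊥ := by
  rw [lyapunov, Ne, EReal.add_eq_bot_iff, not_or]
  exact ⟨hm.model_ne_bot _ _, coe_mul_bregman_ne_bot hm.legendre hm.Lu_pos _ _⟩

/-- Sufficient decrease of the Lyapunov function along a proximal step. -/
lemma lyapunovReal_step_le (hm : ModelAssumption f h m Lu Ll) {x y w : Euc N} {τ τhi : ℝ}
    (hτ : 0 < τ) (hτhi : τ ≤ τhi)
    (hw : w ∈ edom f ∩ interior (edom h)) (hy : y ∈ edom f ∩ interior (edom h))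
    (hx : x ∈ edom f ∩ interior (edom h))
    (hmin : IsMinOn (fun z => m z y + ((1 / τ : ℝ) : EReal) * bregman h z y) univ x) :
    lyapunovReal h m Lu x y + (1 / τhi - Lu) * bregmanReal h x y ≤ lyapunovReal h m Lu y w := by
  have hL := hm.legendre
  have h1 := hmin (mem_univ y)
  simp only [mem_ofPred_eq] at h1
  obtain ⟨r, hr⟩ := hm.exists_model_eq_coe hx.1 hy.1
  obtain ⟨s, hs⟩ := hm.exists_model_eq_coe hy.1 hy.1
  rw [bregman_of_mem hL (interior_subset hx.2) hy.2, bregman_of_mem hL (interior_subset hy.2) hy.2,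
    bregmanReal_self, hr, hs] at h1
  norm_cast at h1
  -- The value `f y` links both sides: minimality against the centre bounds the new model value plus
  -- `1 / τ` times the Bregman distance by `m y y = f y`, and the upper approximation bound for the
  -- previous centre `w` gives `f y ≤ lyapunovReal h m Lu y w`.
  have h2 := (hm.map w hw y ⟨hy.1, interior_subset hy.2⟩).2
  rw [bregman_of_mem hL (interior_subset hy.2) hw.2, EReal.toReal_coe] at h2
  have h3 := model_self hm hy
  rw [hs, EReal.toReal_coe] at h3
  have h4 : 1 / τhi * bregmanReal h x y ≤ 1 / τ * bregmanReal h x y :=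
    mul_le_mul_of_nonneg_right (one_div_le_one_div_of_le hτ hτhi)
      (bregmanReal_nonneg hL (interior_subset hx.2) hy.2)
  simp only [lyapunovReal, hr, EReal.toReal_coe]
  linarith

/-- Relative error bound: along proximal steps near a point the subgradients of the Lyapunov
function are controlled by the length of the step. -/
lemma exists_subdiffNorm_lyapunov_le (hm : ModelAssumption f h m Lu Ll)
    (hrel : RelativeErrorAssumption f m) {xbar : Euc N} (hxbar : xbar ∈ interior (edom h))
    {τlo : ℝ} (hτlo : 0 < τlo) :
    ∃ ρ b : ℝ, 0 < ρ ∧ 0 < b ∧ ∀ x ∈ edom f ∩ Metric.ball xbar ρ,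
      ∀ y ∈ edom f ∩ Metric.ball xbar ρ, ∀ τ : ℝ, τlo ≤ τ →
      IsMinOn (fun z => m z y + ((1 / τ : ℝ) : EReal) * bregman h z y) univ x →
      subdiffNorm (lyapunov h m Lu) (WithLp.toLp 2 (x, y)) ≤ ENNReal.ofReal (b * ‖x - y‖) := by
  have hL := hm.legendre
  have hLu := hm.Lu_pos
  have hg := contDiffOn_grad hm.contDiffOn
  obtain ⟨K, t, ht, hK⟩ := (hg.contDiffAt
    (isOpen_interior.mem_nhds hxbar)).exists_lipschitzOnWith
  obtain ⟨ρ, hρ, hball⟩ := Metric.nhds_basis_ball.mem_iff.1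
    (inter_mem ht (isOpen_interior.mem_nhds hxbar))
  have hKb : LipschitzOnWith K (grad h) (Metric.ball xbar ρ) :=
    hK.mono (hball.trans inter_subset_left)
  have hint : Metric.ball xbar ρ ⊆ interior (edom h) := hball.trans inter_subset_right
  obtain ⟨c, hc, hrel'⟩ := hrel (edom f ∩ Metric.ball xbar ρ) inter_subset_left
    (Metric.isBounded_ball.subset inter_subset_right)
  -- The first summand bounds the component `(Lu - 1 / τ) • (grad h x - grad h y)`. The second
  -- bounds the model part `w` and the Hessian part of the Bregman gradient, with the Lipschitz
  -- constant `K` of `grad h` also bounding its derivative.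
  refine ⟨ρ, (1 / τlo + Lu) * K + (c + Lu * K), hρ, by positivity,
    fun x hx y hy τ hτ hmin => ?_⟩
  have hτ0 : 0 < τ := hτlo.trans_le hτ
  set d := ‖x - y‖ with hd
  set b := (1 / τlo + Lu) * K + (c + Lu * K) with hb
  have hxi := hint hx.2
  have hyi := hint hy.2
  have hv := step_subgradient hm ⟨hy.1, hyi⟩ ⟨hx.1, hxi⟩ hmin
  have hlip : ‖grad h x - grad h y‖ ≤ K * d := by
    have := hKb.dist_le_mul x hx.2 y hy.2
    rwa [dist_eq_norm, dist_eq_norm] at this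
  have hH : ‖fderiv ℝ (grad h) y‖ ≤ K :=
    norm_fderiv_le_of_lipschitzOn ℝ (Metric.isOpen_ball.mem_nhds hy.2) hKb
  have hfst : Tendsto (fun z : Euc2 N => z.fst) (𝓝 (WithLp.toLp 2 (x, y))) (𝓝 x) :=
    (WithLp.fstL 2 ℝ (Euc N) (Euc N)).continuous.tendsto _
  have hsnd : Tendsto (fun z : Euc2 N => z.snd) (𝓝 (WithLp.toLp 2 (x, y))) (𝓝 y) :=
    (WithLp.sndL 2 ℝ (Euc N) (Euc N)).continuous.tendsto _
  have hnear : ∀ᶠ z : Euc2 N in 𝓝 (WithLp.toLp 2 (x, y)),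
      z.fst ∈ interior (edom h) ∧ z.snd ∈ interior (edom h) :=
    (hfst.eventually (isOpen_interior.mem_nhds hxi)).and
      (hsnd.eventually (isOpen_interior.mem_nhds hyi))
  have key : ∀ ε : ℝ, 0 < ε → subdiffNorm (lyapunov h m Lu) (WithLp.toLp 2 (x, y)) ≤
      ENNReal.ofReal (b * d + ε) := by
    intro ε hε
    obtain ⟨w, hw, hwle⟩ := exists_joint_limSubdiff hm hc hrel' hx hy hv hε
    have hmem := add_mem_limSubdiff (F := lyapunov h m Lu) hm.joint_proper.1 (lyapunov_ne_bot hm)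
      (φ := fun z : Euc2 N => Lu * bregmanReal h z.fst z.snd)
      (G := fun z => Lu • bregmanGrad h z) hw
      (hnear.mono fun z hz => hasGradientAt_bregmanReal hL hm.contDiffOn Lu hz.1 hz.2)
      ((continuousAt_bregmanGrad (z := WithLp.toLp 2 (x, y)) hm.contDiffOn hxi hyi).const_smul Lu)
      (hnear.mono fun z hz => lyapunov_eq_add hm (interior_subset hz.1) hz.2)
    refine (iInf₂_le _ hmem).trans ?_
    rw [← ofReal_norm]
    refine ENNReal.ofReal_le_ofReal ?_
    have e : (WithLp.toLp 2 (-((1 / τ) • (grad h x - grad h y)), w) : Euc2 N) +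
        Lu • bregmanGrad h (WithLp.toLp 2 (x, y)) =
        WithLp.toLp 2 ((Lu - 1 / τ) • (grad h x - grad h y), 0) + WithLp.toLp 2 (0, w -
          Lu • ContinuousLinearMap.adjoint (fderiv ℝ (grad h) y) (x - y)) := by
      rw [toLp_zero_add_toLp_zero]
      refine toLp_ext ?_ ?_
      · change -((1 / τ) • (grad h x - grad h y)) + Lu • (grad h x - grad h y) = _
        rw [sub_smul]; abel
      · change w + Lu • (-(ContinuousLinearMap.adjoint (fderiv ℝ (grad h) y) (x - y))) = _
        rw [smul_neg]; abel
    rw [e]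
    refine (norm_add_le _ _).trans ?_
    rw [norm_toLp_zero_left, norm_toLp_zero_right, norm_smul]
    have h1 : ‖Lu - 1 / τ‖ ≤ 1 / τlo + Lu := by
      have h2 : 1 / τ ≤ 1 / τlo := one_div_le_one_div_of_le hτlo hτ
      have h3 : 0 < 1 / τ := by positivity
      rw [Real.norm_eq_abs, abs_le]
      constructor <;> linarith
    have h2 : ‖Lu - 1 / τ‖ * ‖grad h x - grad h y‖ ≤ (1 / τlo + Lu) * (K * d) := by gcongr
    have h3 : ‖w - Lu • ContinuousLinearMap.adjoint (fderiv ℝ (grad h) y) (x - y)‖ ≤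
        (c * d + ε) + Lu * (K * d) := by
      refine (norm_sub_le _ _).trans (add_le_add hwle ?_)
      rw [norm_smul, Real.norm_of_nonneg hLu.le]
      gcongr
      refine (ContinuousLinearMap.le_opNorm _ _).trans ?_
      rw [LinearIsometryEquiv.norm_map]
      gcongr
    rw [hb]
    linarith
  -- The error `ε` came from the near-optimal second component `w`; it disappears in the infimum.
  refine ENNReal.le_of_forall_pos_le_add fun ε hε _ => (key ε hε).trans ?_
  rw [ENNReal.ofReal_add (by positivity) (by positivity), ENNReal.ofReal_coe_nnreal]

end Step

/-! ### Convergence rates from the decrease and Łojasiewicz inequalities -/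

section Rates

variable {V : Type*} [NormedAddCommGroup V] {X : ℕ → V} {xbar : V} {e : ℕ → ℝ} {a C θ : ℝ}

/-- Index convention of this part: `e n` is the energy of the pair `(X (n + 1), X n)`. Hence the
decrease from `e n` to `e (n + 1)` involves the next step, while the Łojasiewicz inequality at `n`
involves the step already taken. -/
lemma antitone_of_decrease (ha : 0 < a)
    (hdec : ∀ n, e (n + 1) + a * ‖X (n + 2) - X (n + 1)‖ ^ 2 ≤ e n) : Antitone e :=
  antitone_nat_of_succ_le fun n => by
    have : 0 ≤ a * ‖X (n + 2) - X (n + 1)‖ ^ 2 := by positivity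
    linarith [hdec n]

/-- If the energy vanishes at some index, the sequence is eventually constant. -/
lemma eventually_eq_of_energy_nonpos (hX : Tendsto X atTop (𝓝 xbar)) (he : Tendsto e atTop (𝓝 0))
    (ha : 0 < a) (hdec : ∀ n, e (n + 1) + a * ‖X (n + 2) - X (n + 1)‖ ^ 2 ≤ e n) {n₀ : ℕ}
    (hn₀ : e n₀ ≤ 0) : ∀ n, n₀ + 1 ≤ n → X n = xbar := by
  have hanti := antitone_of_decrease ha hdec
  have hnn : ∀ n, 0 ≤ e n := fun n => hanti.le_of_tendsto he n
  have hstep : ∀ j, X (n₀ + 1 + j) = X (n₀ + 1) := by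
    intro j
    induction j with
    | zero => rfl
    | succ j ih =>
      have h1 := hdec (n₀ + j)
      have h2 : e (n₀ + j) ≤ 0 := (hanti (Nat.le_add_right n₀ j)).trans hn₀
      have h3 : a * ‖X (n₀ + j + 2) - X (n₀ + j + 1)‖ ^ 2 ≤ 0 := by linarith [hnn (n₀ + j + 1)]
      have h4 : ‖X (n₀ + j + 2) - X (n₀ + j + 1)‖ ^ 2 ≤ 0 := by
        by_contra! hc
        nlinarith
      have h5 : X (n₀ + j + 2) = X (n₀ + j + 1) := by
        have : ‖X (n₀ + j + 2) - X (n₀ + j + 1)‖ ^ 2 = 0 := le_antisymm h4 (by positivity)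
        simpa [sub_eq_zero] using this
      have i1 : n₀ + 1 + (j + 1) = n₀ + j + 2 := by ring
      have i2 : n₀ + 1 + j = n₀ + j + 1 := by ring
      rw [i1, h5, ← i2, ih]
  have hconst : X (n₀ + 1) = xbar := by
    have h1 : Tendsto (fun j => X (j + (n₀ + 1))) atTop (𝓝 xbar) :=
      (tendsto_add_atTop_iff_nat (n₀ + 1)).2 hX
    refine tendsto_nhds_unique (tendsto_const_nhds.congr fun j => ?_) h1
    rw [add_comm j, hstep]
  intro n hn
  obtain ⟨j, rfl⟩ := Nat.exists_eq_add_of_le hn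
  rw [hstep, hconst]

/-- Finite convergence for exponent `0`. -/
lemma exists_energy_nonpos_of_exponent_zero (hX : Tendsto X atTop (𝓝 xbar))
    (hKL : ∀ n, 0 < e n → e n ^ (0 : ℝ) ≤ C * ‖X (n + 1) - X n‖) : ∃ n, e n ≤ 0 := by
  by_contra! hpos
  have h1 : Tendsto (fun n => C * ‖X (n + 1) - X n‖) atTop (𝓝 (C * ‖xbar - xbar‖)) :=
    ((((tendsto_add_atTop_iff_nat 1).2 hX).sub hX).norm).const_mul C
  -- With exponent `0` a positive energy would keep `C` times the step length above `1`, yet the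
  -- steps tend to `0`.
  have h2 := ge_of_tendsto' h1 fun n => by simpa using hKL n (hpos n)
  simp at h2
  linarith

/-- Linear convergence for exponents in `(0, 1/2]`. -/
lemma exists_linear_rate (hX : Tendsto X atTop (𝓝 xbar)) (ha : 0 < a) (hC : 0 < C)
    (hθ1 : θ ≤ 1 / 2) (hpos : ∀ n, 0 < e n) (he1 : ∀ n, e n ≤ 1)
    (hdec : ∀ n, e (n + 1) + a * ‖X (n + 2) - X (n + 1)‖ ^ 2 ≤ e n)
    (hKL : ∀ n, 0 < e n → e n ^ θ ≤ C * ‖X (n + 1) - X n‖) :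
    ∃ ρ D : ℝ, 0 < ρ ∧ ρ < 1 ∧ 0 < D ∧ ∀ n, ‖X (n + 1) - xbar‖ ≤ D * ρ ^ n := by
  set M := C ^ 2 / a with hM
  have hMpos : 0 < M := by positivity
  -- This ratio solves `e (n + 1) ≤ M * (e n - e (n + 1))` for `e (n + 1)`. That recursion needs the
  -- Łojasiewicz inequality only with exponent `1 / 2`, to which `θ ≤ 1 / 2` reduces because `e n ≤
  -- 1`.
  set q := M / (1 + M) with hq
  have hqpos : 0 < q := by positivity
  have hq1 : q < 1 := by rw [hq, div_lt_one (by positivity)]; linarith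
  have hsq : ∀ n, e n ≤ C ^ 2 * ‖X (n + 1) - X n‖ ^ 2 := by
    intro n
    have h1 : e n ^ (1 / 2 : ℝ) ≤ C * ‖X (n + 1) - X n‖ :=
      (Real.rpow_le_rpow_of_exponent_ge (hpos n) (he1 n) hθ1).trans (hKL n (hpos n))
    have h2 : (e n ^ (1 / 2 : ℝ)) ^ 2 = e n := by
      rw [← Real.sqrt_eq_rpow, Real.sq_sqrt (hpos n).le]
    rw [← h2, ← mul_pow]
    have := Real.rpow_nonneg (hpos n).le (1 / 2)
    gcongr
  have hstep : ∀ n, e (n + 1) ≤ q * e n := by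
    intro n
    have h1 := hsq (n + 1)
    have h2 := hdec n
    have h3 : e (n + 1) ≤ M * (e n - e (n + 1)) := by
      have h4 : a * ‖X (n + 2) - X (n + 1)‖ ^ 2 ≤ e n - e (n + 1) := by linarith
      calc e (n + 1) ≤ C ^ 2 * ‖X (n + 1 + 1) - X (n + 1)‖ ^ 2 := h1
        _ = M * (a * ‖X (n + 2) - X (n + 1)‖ ^ 2) := by rw [hM]; field_simp
        _ ≤ _ := by gcongr
    rw [hq, div_mul_eq_mul_div, le_div_iff₀ (by positivity)]
    linarith
  have hgeo : ∀ n, e n ≤ q ^ n * e 0 := by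
    intro n
    induction n with
    | zero => simp
    | succ n ih =>
      calc e (n + 1) ≤ q * e n := hstep n
        _ ≤ q * (q ^ n * e 0) := by gcongr
        _ = _ := by ring
  set ρ := √q with hρ
  have hρpos : 0 < ρ := Real.sqrt_pos.2 hqpos
  have hρ1 : ρ < 1 := by rw [hρ, Real.sqrt_lt' one_pos]; simpa using hq1
  set D := √(e 0 / a) with hD
  have hDpos : 0 < D := Real.sqrt_pos.2 (div_pos (hpos 0) ha)
  have hd : ∀ n, dist (X (n + 1)) (X (n + 1 + 1)) ≤ D * ρ ^ n := by
    intro n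
    rw [dist_comm, dist_eq_norm]
    refine abs_le_of_sq_le_sq' ?_ (by positivity) |>.2
    have h1 : (D * ρ ^ n) ^ 2 = e 0 / a * q ^ n := by
      rw [mul_pow, hD, Real.sq_sqrt (div_pos (hpos 0) ha).le, ← pow_mul, mul_comm n 2, pow_mul,
        hρ, Real.sq_sqrt hqpos.le]
    rw [h1, div_mul_eq_mul_div, le_div_iff₀ ha]
    have := hdec n
    have h2 := hgeo n
    have h3 := hpos (n + 1)
    linarith
  refine ⟨ρ, D / (1 - ρ), hρpos, hρ1, div_pos hDpos (by linarith), fun n => ?_⟩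
  have h1 := dist_le_of_le_geometric_of_tendsto ρ D (f := fun n => X (n + 1)) hρ1 hd
    ((tendsto_add_atTop_iff_nat 1).2 hX) n
  rw [dist_eq_norm] at h1
  calc _ ≤ _ := h1
    _ = _ := by ring

/-- Concavity of the power function: its graph lies below the tangent at `s`. This is Bernoulli's
inequality for `t / s`. -/
lemma rpow_sub_rpow_ge {s t q : ℝ} (hs : 0 < s) (ht : 0 ≤ t) (hq0 : 0 ≤ q) (hq1 : q ≤ 1) :
    q * s ^ (q - 1) * (s - t) ≤ s ^ q - t ^ q := by
  have h1 : (1 + (t / s - 1)) ^ q ≤ 1 + q * (t / s - 1) :=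
    rpow_one_add_le_one_add_mul_self (by linarith [div_nonneg ht hs.le]) hq0 hq1
  rw [add_sub_cancel, Real.div_rpow ht hs.le, div_le_iff₀ (Real.rpow_pos_of_pos hs q)] at h1
  rw [Real.rpow_sub_one hs.ne']
  have h2 : (1 + q * (t / s - 1)) * s ^ q = s ^ q - q * (s ^ q / s) * (s - t) := by
    field_simp
    ring
  linarith

/-- Length estimate for the tail of the sequence. -/
lemma norm_sub_limit_le_of_energy (hX : Tendsto X atTop (𝓝 xbar)) (ha : 0 < a) (hC : 0 < C)
    (hθ0 : 0 ≤ θ) (hθ1 : θ < 1) (hpos : ∀ n, 0 < e n)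
    (hdec : ∀ n, e (n + 1) + a * ‖X (n + 2) - X (n + 1)‖ ^ 2 ≤ e n)
    (hKL : ∀ n, 0 < e n → e n ^ θ ≤ C * ‖X (n + 1) - X n‖) (n : ℕ) :
    ‖X (n + 1) - xbar‖ ≤ ‖X (n + 1) - X n‖ + C / ((1 - θ) * a) * e n ^ (1 - θ) := by
  set q := 1 - θ with hq
  have hqpos : 0 < q := by linarith
  set B := C / (q * a) with hB
  have hBpos : 0 < B := by positivity
  -- Concavity of the desingularizing power turns the energy drop into a drop of `e n ^ q`, divided
  -- by the previous step length `d` through the Łojasiewicz inequality. So the squared new step is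
  -- at most `d * x`, and `4 * d * x ≤ (d + x) ^ 2`.
  have hstep : ∀ n, 2 * ‖X (n + 2) - X (n + 1)‖ ≤
      ‖X (n + 1) - X n‖ + B * (e n ^ q - e (n + 1) ^ q) := by
    intro n
    set d := ‖X (n + 1) - X n‖ with hd
    set d' := ‖X (n + 2) - X (n + 1)‖ with hd'
    have hθpos : 0 < e n ^ θ := Real.rpow_pos_of_pos (hpos n) θ
    have h1 := hKL n (hpos n)
    have hdpos : 0 < d := by
      by_contra! hc
      nlinarith
    have h2 := rpow_sub_rpow_ge (hpos n) (hpos (n + 1)).le hqpos.le (by linarith)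
    have e1 : q - 1 = -θ := by rw [hq]; ring
    rw [e1, Real.rpow_neg (hpos n).le] at h2
    have h3 : a * d' ^ 2 ≤ e n - e (n + 1) := by linarith [hdec n]
    have h4 : (C * d)⁻¹ ≤ (e n ^ θ)⁻¹ := inv_anti₀ hθpos h1
    have h5 : q * (C * d)⁻¹ * (a * d' ^ 2) ≤ e n ^ q - e (n + 1) ^ q := by
      refine le_trans ?_ h2
      gcongr
    have h6 : d' ^ 2 ≤ d * (B * (e n ^ q - e (n + 1) ^ q)) := by
      calc d' ^ 2 = d * (B * (q * (C * d)⁻¹ * (a * d' ^ 2))) := by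
            rw [hB]; field_simp
        _ ≤ _ := by gcongr
    set x := B * (e n ^ q - e (n + 1) ^ q) with hx
    have hx0 : 0 ≤ x := by
      by_contra! hc
      nlinarith [sq_nonneg d']
    refine abs_le_of_sq_le_sq' ?_ (by positivity) |>.2
    nlinarith [sq_nonneg (d - x)]
  -- Of the two copies of the new step in `hstep`, one lengthens the path and the other replaces the
  -- old step as carry-over, so this quantity does not increase with `j`.
  have hsum : ∀ j, ‖X (n + 1) - X (n + 1 + j)‖ + ‖X (n + j + 1) - X (n + j)‖ +
      B * e (n + j) ^ q ≤ ‖X (n + 1) - X n‖ + B * e n ^ q := by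
    intro j
    induction j with
    | zero => simp
    | succ j ih =>
      have h1 := hstep (n + j)
      have h2 := norm_sub_le_norm_sub_add_norm_sub (X (n + 1)) (X (n + 1 + j)) (X (n + 1 + (j + 1)))
      have i1 : n + 1 + (j + 1) = n + j + 2 := by ring
      have i2 : n + 1 + j = n + j + 1 := by ring
      have i3 : n + (j + 1) = n + j + 1 := by ring
      rw [i1, i2] at h2
      rw [i2] at ih
      rw [i1, i3, norm_sub_rev (X (n + j + 1 + 1))]
      rw [norm_sub_rev (X (n + j + 2))] at h1
      linarith
  have hlim : Tendsto (fun j => ‖X (n + 1) - X (n + 1 + j)‖) atTop (𝓝 ‖X (n + 1) - xbar‖) := by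
    refine (tendsto_const_nhds.sub ?_).norm
    have : Tendsto (fun j => X (j + (n + 1))) atTop (𝓝 xbar) :=
      (tendsto_add_atTop_iff_nat (n + 1)).2 hX
    exact this.congr fun j => by rw [add_comm]
  refine le_of_tendsto' hlim fun j => ?_
  have h1 := hsum j
  have h2 : 0 ≤ B * e (n + j) ^ q := mul_nonneg hBpos.le (Real.rpow_nonneg (hpos _).le _)
  linarith [norm_nonneg (X (n + j + 1) - X (n + j))]

/-- Sublinear decay of a positive sequence with `e (n+1) ^ (1+p) ≤ M (e n - e (n+1))`. -/
lemma linear_growth_rpow_neg {p M : ℝ} (hp0 : 0 < p) (hp1 : p ≤ 1) (hM : 0 < M)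
    (hpos : ∀ n, 0 < e n) (he1 : ∀ n, e n ≤ 1)
    (hrec : ∀ n, e (n + 1) ^ (1 + p) ≤ M * (e n - e (n + 1))) (n : ℕ) :
    p / (M + 1) * n ≤ (e n ^ p)⁻¹ := by
  induction n with
  | zero => simpa using Real.rpow_nonneg (hpos 0).le p
  | succ n ih =>
    set E := e (n + 1) ^ p with hE
    have hEpos : 0 < E := Real.rpow_pos_of_pos (hpos _) p
    have hE1 : E ≤ 1 := Real.rpow_le_one (hpos _).le (he1 _) hp0.le
    set s := E / M with hs
    have hspos : 0 < s := by positivity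
    have hsM : s ≤ 1 / M := by rw [hs]; gcongr
    have h1 : e (n + 1) * (1 + s) ≤ e n := by
      have h2 := hrec n
      rw [Real.rpow_add (hpos _), Real.rpow_one, ← hE] at h2
      have h3 : e (n + 1) * E / M ≤ e n - e (n + 1) := by
        rw [div_le_iff₀ hM]; linarith
      have h4 : e (n + 1) * (1 + s) = e (n + 1) + e (n + 1) * E / M := by rw [hs]; ring
      linarith
    have h2 : E * (1 + s) ^ p ≤ e n ^ p := by
      rw [hE, ← Real.mul_rpow (hpos _).le (by positivity)]
      exact Real.rpow_le_rpow (mul_nonneg (hpos _).le (by positivity)) h1 hp0.le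
    -- Bernoulli bounds concave powers from above; applied to the complementary exponent it gives
    -- the needed lower bound on `(1 + s) ^ p`.
    have h3 : (1 + s) ^ (1 - p) ≤ 1 + (1 - p) * s :=
      rpow_one_add_le_one_add_mul_self (by linarith) (by linarith) (by linarith)
    have h4 : (1 + s) ^ p * (1 + s) ^ (1 - p) = 1 + s := by
      rw [← Real.rpow_add (by positivity)]; simp
    have hden : 0 < 1 + (1 - p) * s := by nlinarith
    have hAp : 0 < (1 + s) ^ p := Real.rpow_pos_of_pos (by positivity) p
    have h5 : 1 + s ≤ (1 + s) ^ p * (1 + (1 - p) * s) :=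
      h4.symm.le.trans (mul_le_mul_of_nonneg_left h3 hAp.le)
    have h6 : (e n ^ p)⁻¹ ≤ (E * (1 + s) ^ p)⁻¹ := inv_anti₀ (by positivity) h2
    have h7 : (E * (1 + s) ^ p)⁻¹ ≤ E⁻¹ - p / (M + 1) := by
      have h8 : ((1 + s) ^ p)⁻¹ ≤ (1 + (1 - p) * s) / (1 + s) := by
        rw [le_div_iff₀ (by positivity), inv_mul_le_iff₀ hAp]
        exact h5
      have h9 : (1 + (1 - p) * s) / (1 + s) = 1 - p * s / (1 + s) := by
        field_simp
        ring
      -- Here `E ≤ 1` enters, replacing `M + E` by `M + 1` so that the increment is independent of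
      -- `n`.
      have h10 : p * (E / (M + 1)) ≤ p * s / (1 + s) := by
        rw [mul_div_assoc]
        refine mul_le_mul_of_nonneg_left ?_ hp0.le
        rw [div_le_div_iff₀ (by positivity) (by positivity), hs]
        have : E * (1 + E / M) = E / M * (M + E) := by field_simp
        rw [this]
        gcongr
      rw [mul_inv]
      calc E⁻¹ * ((1 + s) ^ p)⁻¹ ≤ E⁻¹ * (1 - p * (E / (M + 1))) := by
            gcongr
            linarith
        _ = E⁻¹ - p / (M + 1) := by field_simp
    push_cast
    linarith

/-- Sublinear convergence for exponents in `(1/2, 1)`. -/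
lemma exists_sublinear_rate (hX : Tendsto X atTop (𝓝 xbar)) (ha : 0 < a) (hC : 0 < C)
    (hθ0 : 1 / 2 < θ) (hθ1 : θ < 1) (hpos : ∀ n, 0 < e n) (he1 : ∀ n, e n ≤ 1)
    (hdec : ∀ n, e (n + 1) + a * ‖X (n + 2) - X (n + 1)‖ ^ 2 ≤ e n)
    (hKL : ∀ n, 0 < e n → e n ^ θ ≤ C * ‖X (n + 1) - X n‖) :
    ∃ D : ℝ, 0 < D ∧ ∀ n : ℕ, 1 ≤ n →
      ‖X (n + 2) - xbar‖ ≤ D * (n : ℝ) ^ (-((1 - θ) / (2 * θ - 1))) := by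
  set q := 1 - θ with hq
  have hqpos : 0 < q := by linarith
  set p := 2 * θ - 1 with hp
  have hppos : 0 < p := by linarith
  set M := C ^ 2 / a with hM
  have hMpos : 0 < M := by positivity
  -- As `1 + p = 2 * θ`, this is the squared Łojasiewicz inequality combined with the decrease.
  have hrec : ∀ n, e (n + 1) ^ (1 + p) ≤ M * (e n - e (n + 1)) := by
    intro n
    have h1 := hKL (n + 1) (hpos _)
    have h2 : e (n + 1) ^ (1 + p) = (e (n + 1) ^ θ) ^ 2 := by
      rw [← Real.rpow_natCast, ← Real.rpow_mul (hpos _).le]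
      congr 1
      rw [hp]; push_cast; ring
    have h3 : 0 ≤ e (n + 1) ^ θ := Real.rpow_nonneg (hpos _).le θ
    have h4 : a * ‖X (n + 2) - X (n + 1)‖ ^ 2 ≤ e n - e (n + 1) := by linarith [hdec n]
    rw [h2]
    calc (e (n + 1) ^ θ) ^ 2 ≤ (C * ‖X (n + 1 + 1) - X (n + 1)‖) ^ 2 := by gcongr
      _ = M * (a * ‖X (n + 2) - X (n + 1)‖ ^ 2) := by rw [hM]; field_simp
      _ ≤ _ := by gcongr
  have hgrow := linear_growth_rpow_neg hppos (by linarith) hMpos hpos he1 hrec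
  set μ := p / (M + 1) with hμ
  have hμpos : 0 < μ := by positivity
  set B := C / (q * a) with hB
  have hBpos : 0 < B := by positivity
  refine ⟨(1 / √a + B) * μ ^ (-(q / p)), by positivity, fun n hn => ?_⟩
  have hn0 : (0 : ℝ) < n := by exact_mod_cast hn
  have hdecay : e n ^ q ≤ μ ^ (-(q / p)) * (n : ℝ) ^ (-(q / p)) := by
    have hEp : 0 < e n ^ p := Real.rpow_pos_of_pos (hpos n) p
    have h1 : e n ^ p ≤ (μ * n)⁻¹ := by
      rw [le_inv_comm₀ hEp (by positivity)]
      exact hgrow n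
    have h2 : e n ^ q = (e n ^ p) ^ (q / p) := by
      rw [← Real.rpow_mul (hpos n).le]
      congr 1
      field_simp
    rw [h2, ← Real.mul_rpow hμpos.le hn0.le, Real.rpow_neg (by positivity),
      ← Real.inv_rpow (by positivity)]
    exact Real.rpow_le_rpow hEp.le h1 (by positivity)
  -- Used at `n + 1` so that the leading step is controlled by `e n` through the decrease. It is of
  -- order `√(e n)`, which is at most `e n ^ q` because `q < 1 / 2` and `e n ≤ 1`.
  have hlen := norm_sub_limit_le_of_energy hX ha hC (by linarith) hθ1 hpos hdec hKL (n + 1)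
  have hd : ‖X (n + 1 + 1) - X (n + 1)‖ ≤ 1 / √a * e n ^ q := by
    have hsa : 0 < √a := Real.sqrt_pos.2 ha
    have h1 : ‖X (n + 2) - X (n + 1)‖ ≤ √(e n / a) := by
      refine Real.le_sqrt_of_sq_le ?_
      rw [le_div_iff₀ ha]
      linarith [hdec n, hpos (n + 1)]
    have h2 : √(e n) ≤ e n ^ q := by
      rw [Real.sqrt_eq_rpow]
      exact Real.rpow_le_rpow_of_exponent_ge (hpos n) (he1 n) (by linarith)
    rw [Real.sqrt_div (hpos n).le] at h1
    calc _ ≤ _ := h1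
      _ = 1 / √a * √(e n) := by ring
      _ ≤ _ := by gcongr
  have hmono : e (n + 1) ^ q ≤ e n ^ q :=
    Real.rpow_le_rpow (hpos _).le (antitone_of_decrease ha hdec (Nat.le_succ n)) hqpos.le
  calc ‖X (n + 2) - xbar‖ ≤ 1 / √a * e n ^ q + B * e n ^ q := by
        refine hlen.trans (add_le_add hd ?_)
        gcongr
    _ = (1 / √a + B) * e n ^ q := by ring
    _ ≤ (1 / √a + B) * (μ ^ (-(q / p)) * (n : ℝ) ^ (-(q / p))) := by gcongr
    _ = _ := by ring

end Rates

/-! ### The two inequalities along the iterates of Model BPG -/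

section Convergence

variable {f h : Euc N → EReal} {m : Euc N → Euc N → EReal} {Lu Ll : ℝ}

/-- All iterates of Model BPG lie in `dom f ∩ int dom h`. -/
lemma IsModelBPG.iterate_mem (hm : ModelAssumption f h m Lu Ll) {τlo τhi : ℝ} {τ : ℕ → ℝ}
    {x : ℕ → Euc N} (halg : IsModelBPG f h m Lu τlo τhi τ x) (k : ℕ) :
    x k ∈ edom f ∩ interior (edom h) := by
  have hsucc : ∀ k, x (k + 1) ∈ edom f ∩ interior (edom h) := by
    intro k
    induction k with
    -- The update rule starts at index `1`, so the first point is covered by `x 0 = x 1`.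
    | zero => rw [zero_add, ← halg.init_eq]; exact halg.init_mem
    | succ k ih =>
      have hτ := halg.step_mem (k + 1) (by lia)
      exact mem_of_isMinOn_step hm (halg.τlo_pos.trans_le hτ.1) ih (halg.update (k + 1) (by lia))
  cases k with
  | zero => exact halg.init_mem
  | succ k => exact hsucc k

/-- The Lyapunov values converge along a sequence converging to a point of
`dom f ∩ int dom h`. -/
lemma tendsto_lyapunovReal (hm : ModelAssumption f h m Lu Ll) {x : ℕ → Euc N} {xbar : Euc N}
    (hx : ∀ k, x k ∈ edom f ∩ interior (edom h)) (hxbar : xbar ∈ edom f ∩ interior (edom h))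
    (hlim : Tendsto x atTop (𝓝 xbar)) :
    Tendsto (fun k => lyapunovReal h m Lu (x (k + 1)) (x k)) atTop
      (𝓝 (lyapunovReal h m Lu xbar xbar)) := by
  have hlim1 : Tendsto (fun k => x (k + 1)) atTop (𝓝 xbar) := (tendsto_add_atTop_iff_nat 1).2 hlim
  have hpair : Tendsto (fun k => (WithLp.toLp 2 (x (k + 1), x k) : Euc2 N)) atTop
      (𝓝 (WithLp.toLp 2 (xbar, xbar))) := tendsto_toLp_prod hlim1 hlim
  have hmt : Tendsto (fun k => m (x (k + 1)) (x k)) atTop (𝓝 (m xbar xbar)) := by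
    have h1 := hm.joint_cont (WithLp.toLp 2 (xbar, xbar)) ⟨hxbar.1, hxbar.1⟩
    exact h1.tendsto.comp (tendsto_nhdsWithin_iff.2
      ⟨hpair, Eventually.of_forall fun k => ⟨(hx _).1, (hx _).1⟩⟩)
  have hmr := (EReal.tendsto_toReal (hm.model_lt_top hxbar.1 hxbar.1).ne
    (hm.model_ne_bot _ _)).comp hmt
  have hB : ContinuousAt (fun z : Euc2 N => Lu * bregmanReal h z.fst z.snd)
      (WithLp.toLp 2 (xbar, xbar)) :=
    (hasGradientAt_bregmanReal (z := WithLp.toLp 2 (xbar, xbar)) hm.legendre hm.contDiffOn Lu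
      hxbar.2 hxbar.2).continuousAt
  exact hmr.add (hB.tendsto.comp hpair)

/-- The derivative of the desingularizing function is `c * (1 - θ) * s ^ (-θ)`, so the Łojasiewicz
inequality is a bound on `s ^ θ` by the subgradient norm, here already estimated by the step length.
-/
lemma rpow_le_of_one_le_mul {c θ s b d : ℝ} {S : ENNReal} (hc : 0 < c) (hθ : θ < 1) (hs : 0 < s)
    (hS : S ≤ ENNReal.ofReal (b * d))
    (h : 1 ≤ ENNReal.ofReal (deriv (fun s : ℝ => c * s ^ (1 - θ)) s) * S) :
    s ^ θ ≤ c * (1 - θ) * b * d := by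
  have hderiv : deriv (fun s : ℝ => c * s ^ (1 - θ)) s = c * (1 - θ) * (s ^ θ)⁻¹ := by
    have h1 := ((Real.hasDerivAt_rpow_const (x := s) (p := 1 - θ) (Or.inl hs.ne')).const_mul c).deriv
    rw [h1, ← Real.rpow_neg hs.le]
    ring_nf
  have hsθ : 0 < s ^ θ := Real.rpow_pos_of_pos hs θ
  have hpos : 0 ≤ c * (1 - θ) * (s ^ θ)⁻¹ := by
    have : 0 < 1 - θ := by linarith
    positivity
  have h2 : (1 : ENNReal) ≤ ENNReal.ofReal (c * (1 - θ) * (s ^ θ)⁻¹ * (b * d)) := by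
    rw [ENNReal.ofReal_mul hpos, ← hderiv]
    exact h.trans (mul_le_mul_right hS _)
  rw [ENNReal.one_le_ofReal] at h2
  have h3 : c * (1 - θ) * (s ^ θ)⁻¹ * (b * d) = (c * (1 - θ) * b * d) / s ^ θ := by
    field_simp
  rwa [h3, one_le_div hsθ] at h2

/-- Descent, relative error and the Kurdyka–Łojasiewicz inequality, combined along a tail of the
sequence. -/
lemma exists_tail_energy (hm : ModelAssumption f h m Lu Ll) (hrel : RelativeErrorAssumption f m)
    (hsc : LocalStrongConvexity h) {τlo τhi : ℝ} {τ : ℕ → ℝ} {x : ℕ → Euc N}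
    (halg : IsModelBPG f h m Lu τlo τhi τ x) {xbar : Euc N}
    (hxbar : xbar ∈ edom f ∩ interior (edom h)) (hlim : Tendsto x atTop (𝓝 xbar)) {c θ : ℝ}
    (hc : 0 < c) (hθ1 : θ < 1)
    (hKL : HasKLPropertyAt (lyapunov h m Lu) (WithLp.toLp 2 (xbar, xbar))
      (fun s : ℝ => c * s ^ (1 - θ))) :
    ∃ (K : ℕ) (e : ℕ → ℝ) (a C : ℝ), 0 < a ∧ 0 < C ∧ Tendsto e atTop (𝓝 0) ∧ (∀ n, e n ≤ 1) ∧
      (∀ n, e (n + 1) + a * ‖x (n + 2 + K) - x (n + 1 + K)‖ ^ 2 ≤ e n) ∧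
      (∀ n, 0 < e n → e n ^ θ ≤ C * ‖x (n + 1 + K) - x (n + K)‖) := by
  have hL := hm.legendre
  have hx := halg.iterate_mem hm
  have hτlo := halg.τlo_pos
  have hτhi : 0 < τhi := hτlo.trans halg.τlo_lt
  obtain ⟨ρ, b, hρ, hb, hbound⟩ := exists_subdiffNorm_lyapunov_le hm hrel hxbar.2 hτlo
  obtain ⟨ρ', hρ', hball⟩ := Metric.nhds_basis_closedBall.mem_iff.1
    (isOpen_interior.mem_nhds hxbar.2)
  obtain ⟨σ, hσ, hstrong⟩ := hsc (Metric.closedBall xbar ρ') hball (isCompact_closedBall _ _)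
    (convex_closedBall _ _)
  obtain ⟨η, hη, -, U, hU, hKLU⟩ := hKL
  set Fbar := lyapunovReal h m Lu xbar xbar with hFbar
  have hFbar' : lyapunov h m Lu (WithLp.toLp 2 (xbar, xbar)) = (Fbar : EReal) :=
    lyapunov_eq_coe hm ⟨hxbar.1, interior_subset hxbar.2⟩ hxbar
  set F : ℕ → ℝ := fun k => lyapunovReal h m Lu (x (k + 1)) (x k) with hF
  have hF' : ∀ k, lyapunov h m Lu (WithLp.toLp 2 (x (k + 1), x k)) = (F k : EReal) := fun k =>
    lyapunov_eq_coe hm ⟨(hx _).1, interior_subset (hx _).2⟩ (hx k)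
  have hFlim : Tendsto F atTop (𝓝 Fbar) := tendsto_lyapunovReal hm hx hxbar hlim
  have hlim1 : Tendsto (fun k => x (k + 1)) atTop (𝓝 xbar) := (tendsto_add_atTop_iff_nat 1).2 hlim
  have hpair : Tendsto (fun k => (WithLp.toLp 2 (x (k + 1), x k) : Euc2 N)) atTop
      (𝓝 (WithLp.toLp 2 (xbar, xbar))) := tendsto_toLp_prod hlim1 hlim
  have hFη : ∀ᶠ k in atTop, (F k : EReal) < (Fbar : EReal) + η := by
    have h1 : (Fbar : EReal) < (Fbar : EReal) + η := by
      conv_lhs => rw [← add_zero (Fbar : EReal)]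
      exact EReal.add_lt_add_left_coe hη Fbar
    exact ((continuous_coe_real_ereal.tendsto Fbar).comp hFlim).eventually (gt_mem_nhds h1)
  have hF1 : ∀ᶠ k in atTop, F k - Fbar < 1 := by
    have h1 : Tendsto (fun k => F k - Fbar) atTop (𝓝 0) := by
      simpa using hFlim.sub_const Fbar
    exact h1.eventually (gt_mem_nhds one_pos)
  -- From `K` on, all local statements hold at once: relative error, strong convexity, the
  -- Łojasiewicz neighbourhood and value range, energies below `1`, and indices at which the update
  -- rule is in force.
  obtain ⟨K, hK⟩ := eventually_atTop.1 ((hlim.eventually (Metric.ball_mem_nhds xbar hρ)).and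
    ((hlim.eventually (Metric.closedBall_mem_nhds xbar hρ')).and
      ((hpair.eventually hU).and (hFη.and (hF1.and (eventually_ge_atTop 1))))))
  -- The decrease constant is positive because the step sizes stay below `1 / Lu`; `σ / 2` converts
  -- the Bregman distance into a squared norm.
  have ha : 0 < (1 / τhi - Lu) * (σ / 2) := by
    have h1 : τhi * Lu < 1 := by
      have := halg.τhi_lt
      rwa [lt_div_iff₀ hm.Lu_pos] at this
    have h2 : Lu < 1 / τhi := by
      rw [lt_div_iff₀ hτhi]; linarith
    have : 0 < 1 / τhi - Lu := by linarith
    positivity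
  have hgap : 0 ≤ 1 / τhi - Lu := by
    by_contra! hcon
    nlinarith
  refine ⟨K, fun n => F (n + K) - Fbar, (1 / τhi - Lu) * (σ / 2), c * (1 - θ) * b, ha, ?_, ?_,
    fun n => (hK (n + K) (by lia)).2.2.2.2.1.le, fun n => ?_, fun n hpos => ?_⟩
  · have : 0 < 1 - θ := by linarith
    positivity
  · have h1 : Tendsto (fun k => F k - Fbar) atTop (𝓝 0) := by
      simpa using hFlim.sub_const Fbar
    exact (tendsto_add_atTop_iff_nat K).2 h1
  · have hK1 := hK (n + 1 + K) (by lia)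
    have hK2 := hK (n + 2 + K) (by lia)
    have hge : 1 ≤ n + 1 + K := by lia
    have hτ := halg.step_mem _ hge
    have e1 : n + 1 + K = n + K + 1 := by lia
    have e2 : n + 2 + K = n + K + 1 + 1 := by lia
    have hstep := lyapunovReal_step_le hm (hτlo.trans_le hτ.1) hτ.2 (hx (n + K)) (hx (n + 1 + K))
      (hx (n + 1 + K + 1)) (halg.update _ hge)
    have hs := hstrong _ hK2.2.1 _ hK1.2.1
    rw [bregman_of_mem hL (interior_subset (hx _).2) (hx _).2] at hs
    norm_cast at hs
    have h3 := mul_le_mul_of_nonneg_left hs hgap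
    simp only [hF]
    rw [e1] at hstep h3 ⊢
    rw [e2] at h3 ⊢
    linarith
  · have hKn := hK (n + K) (by lia)
    have hKn1 := hK (n + 1 + K) (by lia)
    have hge : 1 ≤ n + K := hKn.2.2.2.2.2
    have hτ := halg.step_mem _ hge
    have e1 : n + 1 + K = n + K + 1 := by lia
    rw [e1] at hKn1 ⊢
    have hS := hbound (x (n + K + 1)) ⟨(hx _).1, hKn1.1⟩ (x (n + K)) ⟨(hx _).1, hKn.1⟩ _ hτ.1
      (halg.update _ hge)
    have hlt : Fbar < F (n + K) := by linarith
    have hineq := hKLU _ hKn.2.2.1 (by rw [hFbar', hF']; exact_mod_cast hlt)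
      (by rw [hFbar', hF']; exact hKn.2.2.2.1)
    rw [hFbar', hF', EReal.toReal_coe, EReal.toReal_coe] at hineq
    exact rpow_le_of_one_le_mul hc hθ1 hpos hS hineq

end Convergence

end ModelBPG

end

/-! ### The three rates, transferred from the tail to the whole sequence -/

theorem mainTheorem3 {N : ℕ} (f h : ModelBPG.Euc N → EReal)
    (m : ModelBPG.Euc N → ModelBPG.Euc N → EReal) (Lu Ll : ℝ)
    (hf : ModelBPG.ObjectiveAssumption f)
    (hm : ModelBPG.ModelAssumption f h m Lu Ll)
    (hrel : ModelBPG.RelativeErrorAssumption f m)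
    (hsc : ModelBPG.LocalStrongConvexity h)
    (τlo τhi : ℝ) (τ : ℕ → ℝ) (x : ℕ → ModelBPG.Euc N)
    (halg : ModelBPG.IsModelBPG f h m Lu τlo τhi τ x)
    (xbar : ModelBPG.Euc N) (hxbar : xbar ∈ ModelBPG.edom f ∩ interior (ModelBPG.edom h))
    (hlim : Filter.Tendsto x Filter.atTop (nhds xbar))
    (c θ : ℝ) (hc : 0 < c) (hθ0 : 0 ≤ θ) (hθ1 : θ < 1)
    (hKL : ModelBPG.HasKLPropertyAt (ModelBPG.lyapunov h m Lu) (WithLp.toLp 2 (xbar, xbar))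
      (fun s : ℝ => c * s ^ (1 - θ))) :
    (θ = 0 → ∃ K : ℕ, ∀ k, K ≤ k → x k = xbar) ∧
    (0 < θ → θ ≤ 1 / 2 → ∃ ρ G : ℝ, 0 ≤ ρ ∧ ρ < 1 ∧ 0 < G ∧ ∀ k : ℕ, ‖x k - xbar‖ ≤ G * ρ ^ k) ∧
    (1 / 2 < θ → ∃ G : ℝ, 0 < G ∧ ∀ k : ℕ, 1 ≤ k →
      ‖x k - xbar‖ ≤ G * (k : ℝ) ^ (-((1 - θ) / (2 * θ - 1)))) := by
  obtain ⟨K, e, a, C, ha, hC, he, he1, hdec, hkl⟩ :=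
    ModelBPG.exists_tail_energy hm hrel hsc halg hxbar hlim hc hθ1 hKL
  have hX : Tendsto (fun n => x (n + K)) atTop (𝓝 xbar) := (tendsto_add_atTop_iff_nat K).2 hlim
  have hfinite : (∃ n, e n ≤ 0) → ∃ K' : ℕ, ∀ k, K' ≤ k → x k = xbar := by
    rintro ⟨n, hn⟩
    refine ⟨n + 1 + K, fun k hk => ?_⟩
    have := ModelBPG.eventually_eq_of_energy_nonpos hX he ha hdec hn (k - K) (by lia)
    rwa [Nat.sub_add_cancel (by lia)] at this
  -- If the energy reaches zero the sequence terminates, and any rate holds trivially; the rate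
  -- lemmas may then assume positive energies.
  have hbigO : ∀ g : ℕ → ℝ, (∃ n, e n ≤ 0) → (fun k => x k - xbar) =O[atTop] g := by
    intro g hn
    obtain ⟨K', hK'⟩ := hfinite hn
    refine Asymptotics.IsBigO.of_bound 1 ?_
    filter_upwards [eventually_ge_atTop K'] with k hk
    simp [hK' k hk]
  refine ⟨?_, ?_, ?_⟩
  · rintro rfl
    exact hfinite (ModelBPG.exists_energy_nonpos_of_exponent_zero hX hkl)
  · intro _ hθ2
    obtain ⟨ρ, hρ0, hρ1, hO⟩ : ∃ ρ : ℝ, 0 < ρ ∧ ρ < 1 ∧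
        (fun k => x k - xbar) =O[atTop] fun k => ρ ^ k := by
      by_cases hn : ∃ n, e n ≤ 0
      · exact ⟨1 / 2, by norm_num, by norm_num, hbigO _ hn⟩
      · push Not at hn
        obtain ⟨ρ, D, hρ0, hρ1, hD, hle⟩ :=
          ModelBPG.exists_linear_rate hX ha hC hθ2 hn he1 hdec hkl
        refine ⟨ρ, hρ0, hρ1, Asymptotics.IsBigO.of_bound (D / ρ ^ (K + 1)) ?_⟩
        filter_upwards [eventually_ge_atTop (K + 1)] with k hk
        obtain ⟨j, rfl⟩ := Nat.exists_eq_add_of_le hk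
        have h1 := hle j
        have e1 : K + 1 + j = j + 1 + K := by ring
        rw [Real.norm_of_nonneg (by positivity), pow_add, e1]
        calc _ ≤ _ := h1
          _ = _ := by field_simp; ring
    -- Since `ρ ^ k` never vanishes, enlarging the constant absorbs the finitely many initial
    -- indices.
    obtain ⟨G, hG, hle⟩ := Asymptotics.bound_of_isBigO_nat_atTop hO
    refine ⟨ρ, G, hρ0.le, hρ1, hG, fun k => ?_⟩
    have h1 := hle (x := k) (by positivity)
    rwa [Real.norm_of_nonneg (by positivity)] at h1
  · intro hθ2
    set r := (1 - θ) / (2 * θ - 1) with hr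
    have hrpos : 0 < r := div_pos (by linarith) (by linarith)
    have hO : (fun k => x k - xbar) =O[atTop] fun k : ℕ => (k : ℝ) ^ (-r) := by
      by_cases hn : ∃ n, e n ≤ 0
      · exact hbigO _ hn
      · push Not at hn
        obtain ⟨D, hD, hle⟩ :=
          ModelBPG.exists_sublinear_rate hX ha hC hθ2 hθ1 hn he1 hdec hkl
        refine Asymptotics.IsBigO.of_bound (D * (1 / 2) ^ (-r)) ?_
        -- For such `k`, the shifted index `j = k - (K + 2)` is at least `k / 2`, so the shift costs
        -- only the factor `(1 / 2) ^ (-r)`.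
        filter_upwards [eventually_ge_atTop (2 * (K + 2) + 1)] with k hk
        obtain ⟨j, rfl⟩ := Nat.exists_eq_add_of_le (show K + 2 ≤ k by lia)
        have hj : K + 2 + 1 ≤ j := by lia
        have h1 := hle j (by lia)
        have e1 : K + 2 + j = j + 2 + K := by ring
        have hj0 : (0 : ℝ) < j := by exact_mod_cast (show 0 < j by lia)
        have hk0 : (0 : ℝ) < ((K + 2 + j : ℕ) : ℝ) := by exact_mod_cast (show 0 < K + 2 + j by lia)
        have h2 : (1 / 2 : ℝ) * ((K + 2 + j : ℕ) : ℝ) ≤ j := by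
          have : ((K + 2 + j : ℕ) : ℝ) ≤ 2 * (j : ℝ) := by exact_mod_cast (by lia)
          linarith
        have h3 : (j : ℝ) ^ (-r) ≤ ((1 / 2 : ℝ) * ((K + 2 + j : ℕ) : ℝ)) ^ (-r) :=
          Real.rpow_le_rpow_of_nonpos (by positivity) h2 (by linarith)
        rw [Real.mul_rpow (by norm_num) hk0.le] at h3
        rw [Real.norm_of_nonneg (Real.rpow_nonneg hk0.le _)]
        calc ‖x (K + 2 + j) - xbar‖ ≤ D * (j : ℝ) ^ (-r) := by rw [e1]; exact h1
          _ ≤ D * ((1 / 2) ^ (-r) * ((K + 2 + j : ℕ) : ℝ) ^ (-r)) := by gcongr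
          _ = _ := by ring
    obtain ⟨G, hG, hle⟩ := Asymptotics.bound_of_isBigO_nat_atTop hO
    refine ⟨G, hG, fun k hk => ?_⟩
    have hk0 : (0 : ℝ) < k := by exact_mod_cast hk
    have h1 := hle (x := k) (Real.rpow_pos_of_pos hk0 _).ne'
    rwa [Real.norm_of_nonneg (Real.rpow_nonneg hk0.le _)] at h1
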